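/- Notation. $\mathbb N=\{0,1,2,\dots\}$; $\mathbb R_\pm=\{x:\pm x>0\}$; $\mathcal F u(\xi)=(2\pi)^{-1/2}\int e^{-ix\xi}u(x)\,dx$, extended to $\mathcal S'(\mathbb R)$ by $\langle\mathcal F T,\varphi\rangle=\langle T,\mathcal F\varphi\rangle$; $\mathcal S'(\overline{\mathbb R}_\pm)$ is the set of tempered distributions on $\mathbb R$ with support in $\overline{\mathbb R}_\pm$, and $\mathcal S(\overline{\mathbb R}_\pm)$ the set of restrictions to $\mathbb R_\pm$ of functions in $\mathcal S(\mathbb R)$. Let $P=\{(p_j,m_j)\}_{j\in\mathbb N}\subset\mathbb C\times\mathbb N$ be an appropriate power set: $\operatorname{Re}p_j\le\operatorname{Re}p_{j+1}$, $\operatorname{Re}p_j\to+\infty$, the $m_j$ are bounded, no $p_j$ is a negative integer, and $P$ contains $P_0=\{(j,0): j\in\mathbb N\}$. $\mathcal S_P(\mathbb R_+)$ is the set of smooth $u$ on $\mathbb R_+$, rapidly decreasing at $+\infty$ with all derivatives, for which there are $a_{jk}\in\mathbb C$ such that, for all $N,k\in\mathbb N$ and $\varepsilon>0$, $$\partial_x^k\Big(u(x)-\sum_{j<N}\sum_{l=0}^{m_j}a_{jl}\,x^{p_j}\ln^l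 x\Big)=O\big(x^{\operatorname{Re}p_N-\varepsilon-k}\big)\quad(x\to0^+),$$ and $\mathcal S_P(\mathbb R_-)=\{u: u(-\,\cdot)\in\mathcal S_P(\mathbb R_+)\}$. For $u\in\mathcal S_P(\mathbb R_+)$, the extension by zero $e_+u$ is $$\sum_{j<N}\sum_{l=0}^{m_j}a_{jl}\,x_+^{p_j}\ln^l x+\Big(u-\sum_{j<N}\sum_{l=0}^{m_j}a_{jl}\,x^{p_j}\ln^l x\Big)\mathbf 1_{x>0}$$ for any $N$ with $\operatorname{Re}p_N>-1$ (the choice does not matter); here $x_+^a$ is the homogeneous distribution obtained by analytic continuation in $a$ from $\operatorname{Re}a>-1$ to $\mathbb C\setminus\mathbb Z_{<0}$, and $x_+^a\ln^l x=\partial_a^l x_+^a$. The extension $e_-u$ of $u\in\mathcal S_P(\mathbb R_-)$ is the reflection of $e_+(u(-\,\cdot))$. Put $$\mathcal H^\pm=\{\mathcal F[e_\pm u]: u\in\mathcal S(\overline{\mathbb R}_\pm)\},\quad \mathcal H^\pm_P=\{\mathcal F[e_\pm u]: u\in\mathcal S_P(\mathbb R_\pm)\},\quad \mathcal H'^{\pm}=\{\mathcal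 F[U]: U\in\mathcal S'(\overline{\mathbb R}_\pm)\},$$ where on $\mathcal S(\overline{\mathbb R}_\pm)$ $e_\pm$ is extension by zero of functions. Let $\overline{\mathcal P}$ be the set of sequences $P'=\{(p'_j,m'_j)\}_{j\in\mathbb N}\subset\mathbb C\times\mathbb N$ with $\operatorname{Re}p'_j\ge\operatorname{Re}p'_{j+1}$ and $\operatorname{Re}p'_j\to-\infty$. For $P'\in\overline{\mathcal P}$, $C^\infty_{P'}(\mathbb R)$ is the set of $f\in C^\infty(\mathbb R)$ for which there are $a^\pm_{jk}\in\mathbb C$ such that, for each sign, all $N,k\in\mathbb N$ and $\varepsilon>0$, $$\partial_x^k\Big(f(x)-\sum_{j<N}\sum_{l=0}^{m'_j}a^\pm_{jl}\,|x|^{p'_j}\ln^l|x|\Big)=O\big(|x|^{\operatorname{Re}p'_N+\varepsilon-k}\big)\quad(x\to\pm\infty).$$ Lemma. (1) Every $u\in\mathcal S_P(\mathbb R_\pm)$ has an extension $e_\pm u\in\mathcal S'(\overline{\mathbb R}_\pm)$ as above, and $$\mathcal H^\pm=\mathcal H^\pm_{P_0}\subset\mathcal H^\pm_P\subset\mathcal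 H'^{\pm}.$$ (2) There is $P'\in\overline{\mathcal P}$ containing $\{(-p_j-1,\,m_j-i): j\in\mathbb N,\ 0\le i\le m_j\}$ as a subset, and for every such $P'$ $$\mathcal H^\pm_P\subset C^\infty_{P'}(\mathbb R),$$ i.e. each element of $\mathcal H^\pm_P$ is the distribution given by a function in $C^\infty_{P'}(\mathbb R)$. Moreover, with one sequence of coefficients $a_{jl}$ for both ends, this function has the expansion $\sum_{j}\sum_{l\le m'_j}a_{jl}\,(\xi\mp i0)^{p'_j}\ln^l(\xi\mp i0)$ as $|\xi|\to\infty$ (upper sign for $\mathcal H^+_P$, lower sign for $\mathcal H^-_P$), with the same remainder estimates, where $\ln(\xi\mp i0)=\ln|\xi|$ for $\xi>0$ and $\ln|\xi|\mp i\pi$ for $\xi<0$, and $(\xi\mp i0)^p=e^{p\ln(\xi\mp i0)}$. -/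

import Mathlib

open MeasureTheory Filter Topology Asymptotics SchwartzMap
open scoped ContDiff FourierTransform

noncomputable section

namespace LogPolyhom

/-! ### Power sets -/

/-- A sequence of pairs `(p j, m j)`: exponents `p j` and maximal powers `m j` of the logarithm. -/
abbrev PowerSeq : Type := ℕ → ℂ × ℕ

/-- Power sets for expansions at `0`: `Re p j` is nondecreasing and tends to `+∞`, and the
logarithmic orders are bounded. -/
structure IsPowerSetZero (P : PowerSeq) : Prop where
  mono : ∀ j, (P j).1.re ≤ (P (j + 1)).1.re
  tendsto : Tendsto (fun j => (P j).1.re) atTop atTop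
  bounded : ∃ m : ℕ, ∀ j, (P j).2 ≤ m

/-- Power sets for expansions at infinity: `Re p j` is nonincreasing and tends to `-∞`. -/
structure IsPowerSetInfty (P : PowerSeq) : Prop where
  anti : ∀ j, (P (j + 1)).1.re ≤ (P j).1.re
  tendsto : Tendsto (fun j => (P j).1.re) atTop atBot

/-- The Taylor power set `{(j, 0) | j ∈ ℕ}`. -/
def P₀ : PowerSeq := fun j => ((j : ℂ), 0)

/-- `P` contains `P₀` and none of its exponents is a negative integer. -/
structure IsAppropriate (P : PowerSeq) : Prop where
  isPowerSet : IsPowerSetZero P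
  contains : Set.range P₀ ⊆ Set.range P
  not_neg_int : ∀ (j n : ℕ), (P j).1 ≠ -((n : ℂ) + 1)

/-! ### Log-polyhomogeneous expansions -/

/-- The partial sum `∑_{j < N} ∑_{k ≤ m j} a j k * x ^ (p j) * (ln x) ^ k`, where `ln` is the branch
`ℓ` of the logarithm and `x ^ p = exp (p * ℓ x)`. -/
def partialSum (ℓ : ℝ → ℂ) (P : PowerSeq) (a : ℕ → ℕ → ℂ) (N : ℕ) (x : ℝ) : ℂ :=
  ∑ j ∈ Finset.range N, ∑ k ∈ Finset.range ((P j).2 + 1),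
    a j k * (Complex.exp ((P j).1 * ℓ x) * ℓ x ^ k)

/-- The real logarithm `ln |x|`. -/
def logAbs (x : ℝ) : ℂ := (Real.log |x| : ℝ)

/-- The boundary value `ln (x + τ i 0)`, for `τ = 1` or `τ = -1`: it is `ln x` for `x > 0` and
`ln |x| + τ i π` for `x < 0`. -/
def logBoundary (τ : ℤˣ) (x : ℝ) : ℂ :=
  if 0 < x then (Real.log |x| : ℝ)
  else (Real.log |x| : ℝ) + ((τ : ℤ) : ℂ) * (Real.pi : ℂ) * Complex.I

/-- `u(x) ∼ ∑ a j k x ^ (p j) (ln x) ^ k` as `x → 0+`: the remainder after the first `N` terms is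
`O(x ^ (Re p N - ε))` for all `ε > 0`, and this may be differentiated. -/
def HasExpansionZero (P : PowerSeq) (a : ℕ → ℕ → ℂ) (u : ℝ → ℂ) : Prop :=
  ∀ (N k : ℕ) (ε : ℝ), 0 < ε →
    (fun x => iteratedDeriv k (fun y => u y - partialSum logAbs P a N y) x)
      =O[𝓝[>] (0 : ℝ)] fun x => x ^ ((P N).1.re - ε - k)

/-- `f(x) ∼ ∑ a j k x ^ (p j) (ln x) ^ k` along `F` (`x → +∞` or `x → -∞`), with the branch `ℓ` of
the logarithm: the remainder after the first `N` terms is `O(|x| ^ (Re p N + ε))` for all `ε > 0`,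
and this may be differentiated. -/
def HasExpansionInfty (ℓ : ℝ → ℂ) (F : Filter ℝ) (P : PowerSeq) (a : ℕ → ℕ → ℂ) (f : ℝ → ℂ) :
    Prop :=
  ∀ (N k : ℕ) (ε : ℝ), 0 < ε →
    (fun x => iteratedDeriv k (fun y => f y - partialSum ℓ P a N y) x)
      =O[F] fun x => |x| ^ ((P N).1.re + ε - k)

/-! ### Function spaces

A sign `σ = ±1` selects the half-line `ℝ_σ = {x | 0 < σ x}`. Functions on `ℝ_σ` are functions on `ℝ`
of which only the values on `ℝ_σ` matter. -/

/-- Reflection of a function: `x ↦ u (σ x)`. -/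
def reflect (σ : ℤˣ) (u : ℝ → ℂ) : ℝ → ℂ := fun x => u (((σ : ℤ) : ℝ) * x)

/-- Smooth functions on `(0, ∞)` that are rapidly decreasing at `+∞` with all derivatives. -/
structure IsSmoothRapid (u : ℝ → ℂ) : Prop where
  smooth : ContDiffOn ℝ ∞ u (Set.Ioi 0)
  decay : ∀ n k : ℕ, ∃ C : ℝ, ∀ x : ℝ, 1 ≤ x → x ^ n * ‖iteratedDeriv k u x‖ ≤ C

/-- `u ∈ 𝓢_P(ℝ_+)` with the coefficients `a` in its expansion at `0`. -/
def InSchwartzP (P : PowerSeq) (a : ℕ → ℕ → ℂ) (u : ℝ → ℂ) : Prop :=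
  IsSmoothRapid u ∧ HasExpansionZero P a u

/-- The space `𝓢_P(ℝ_σ)`. -/
def schwartzP (σ : ℤˣ) (P : PowerSeq) : Set (ℝ → ℂ) :=
  {u | ∃ a, InSchwartzP P a (reflect σ u)}

/-- The space of restrictions to `ℝ_σ` of Schwartz functions on `ℝ`. -/
def schwartzClosed (σ : ℤˣ) : Set (ℝ → ℂ) :=
  {u | ∃ v : 𝓢(ℝ, ℂ), ∀ x : ℝ, 0 < ((σ : ℤ) : ℝ) * x → u x = v x}

/-- The space `C^∞_P(ℝ)` of smooth functions on `ℝ` with an expansion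
`∑ a j k |x| ^ (p j) (ln |x|) ^ k` as `x → +∞` and as `x → -∞`, each with its own coefficients. -/
def smoothP (P : PowerSeq) : Set (ℝ → ℂ) :=
  {f | ContDiff ℝ ∞ f ∧ (∃ a, HasExpansionInfty logAbs atTop P a f) ∧
    ∃ b, HasExpansionInfty logAbs atBot P b f}

/-- Smooth functions on `ℝ` with an expansion `∑ a j k (x + τ i 0) ^ (p j) (ln (x + τ i 0)) ^ k` as
`|x| → ∞`, with the same coefficients at both ends. -/
def smoothBoundaryP (τ : ℤˣ) (P : PowerSeq) : Set (ℝ → ℂ) :=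
  {f | ContDiff ℝ ∞ f ∧ ∃ a, HasExpansionInfty (logBoundary τ) atTop P a f ∧
    HasExpansionInfty (logBoundary τ) atBot P a f}

/-! ### Tempered distributions -/

/-- `ξ ↦ (2π)⁻¹ ξ`. -/
def scaleEquiv : ℝ ≃L[ℝ] ℝ :=
  ContinuousLinearEquiv.unitsEquivAut ℝ (Units.mk0 ((2 * Real.pi)⁻¹) (by positivity))

/-- The Fourier transform `ℱ φ (ξ) = (2π)^(-1/2) ∫ exp (-i x ξ) φ(x) dx` on Schwartz functions. -/
def fourierS : 𝓢(ℝ, ℂ) →L[ℂ] 𝓢(ℝ, ℂ) :=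
  (((√(2 * Real.pi))⁻¹ : ℝ) : ℂ) •
    (SchwartzMap.compCLMOfContinuousLinearEquiv ℂ scaleEquiv).comp
      (FourierTransform.fourierCLM ℂ 𝓢(ℝ, ℂ))

theorem fourierS_apply (φ : 𝓢(ℝ, ℂ)) (ξ : ℝ) :
    fourierS φ ξ = (((√(2 * Real.pi))⁻¹ : ℝ) : ℂ) *
      ∫ x : ℝ, Complex.exp (-(Complex.I * x * ξ)) * φ x := by
  have h : fourierS φ ξ = (((√(2 * Real.pi))⁻¹ : ℝ) : ℂ) * (𝓕 φ) (scaleEquiv ξ) := rfl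
  rw [h, SchwartzMap.fourier_coe, Real.fourier_real_eq_integral_exp_smul]
  congr 1
  apply integral_congr_ae
  filter_upwards with x
  rw [smul_eq_mul]
  congr 2
  have hs : scaleEquiv ξ = ξ * (2 * Real.pi)⁻¹ := rfl
  rw [hs]
  push_cast
  have : (Real.pi : ℂ) ≠ 0 := by exact_mod_cast Real.pi_ne_zero
  field_simp

/-- The Fourier transform of a tempered distribution: `⟨ℱ T, φ⟩ = ⟨T, ℱ φ⟩`. -/
def fourierD : 𝓢'(ℝ, ℂ) → 𝓢'(ℝ, ℂ) := PointwiseConvergenceCLM.precomp ℂ fourierS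

theorem fourierD_apply (T : 𝓢'(ℝ, ℂ)) (φ : 𝓢(ℝ, ℂ)) : fourierD T φ = T (fourierS φ) := rfl

/-- Tempered distributions on `ℝ` with support in the closed half-line `{x | 0 ≤ σ x}`. -/
def temperedHalf (σ : ℤˣ) : Set 𝓢'(ℝ, ℂ) :=
  {T | Distribution.dsupport T ⊆ {x : ℝ | 0 ≤ ((σ : ℤ) : ℝ) * x}}

/-- `(-1)^n / ((z + 1) ⋯ (z + n)) ∫_0^∞ x ^ (z + n) φ^(n)(x) dx`, which is `⟨x_+^z, φ⟩` for
`Re z + n > -1`. -/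
def rieszPlus (n : ℕ) (z : ℂ) (φ : ℝ → ℂ) : ℂ :=
  (-1) ^ n / (∏ i ∈ Finset.range n, (z + (i + 1))) *
    ∫ x in Set.Ioi (0 : ℝ), (x : ℂ) ^ (z + n) * iteratedDeriv n φ x

/-- The homogeneous distribution with logarithms `x_+^z ln^k x`, for `z` not a negative integer, as
the `k`-th derivative in `z` of `x_+^z`. -/
def logHom (z : ℂ) (k : ℕ) (φ : ℝ → ℂ) : ℂ :=
  iteratedDeriv k (fun w => rieszPlus ⌈-z.re⌉₊ w φ) z

/-- `T` is the extension `e_σ u` by zero of `u ∈ 𝓢_P(ℝ_σ)` to a tempered distribution: it is the sum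
of finitely many terms `a j k x_+^(p j) ln^k x` of the expansion of `u` at `0`, as homogeneous
distributions, and of the locally integrable remainder, extended by zero as a function (all of it
reflected if `σ = -1`). -/
def IsExtension (σ : ℤˣ) (P : PowerSeq) (u : ℝ → ℂ) (T : 𝓢'(ℝ, ℂ)) : Prop :=
  ∃ (a : ℕ → ℕ → ℂ) (N : ℕ), InSchwartzP P a (reflect σ u) ∧ -1 < (P N).1.re ∧
    ∀ φ : 𝓢(ℝ, ℂ), T φ =
      (∑ j ∈ Finset.range N, ∑ k ∈ Finset.range ((P j).2 + 1),
        a j k * logHom (P j).1 k (reflect σ φ)) +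
      ∫ x in Set.Ioi (0 : ℝ),
        (reflect σ u x - partialSum logAbs P a N x) * reflect σ φ x

/-- `T` is the extension by zero of the integrable function `u` on `ℝ_σ`. -/
def IsZeroExtension (σ : ℤˣ) (u : ℝ → ℂ) (T : 𝓢'(ℝ, ℂ)) : Prop :=
  ∀ φ : 𝓢(ℝ, ℂ), T φ = ∫ x in {x : ℝ | 0 < ((σ : ℤ) : ℝ) * x}, u x * φ x

/-- `H^σ`: Fourier transforms of `e_σ u`, `u` a Schwartz function smooth up to the boundary. -/
def hardyS (σ : ℤˣ) : Set 𝓢'(ℝ, ℂ) :=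
  {H | ∃ u ∈ schwartzClosed σ, ∃ T, IsZeroExtension σ u T ∧ H = fourierD T}

/-- `H^σ_P`: Fourier transforms of `e_σ u`, `u ∈ 𝓢_P(ℝ_σ)`. -/
def hardyP (σ : ℤˣ) (P : PowerSeq) : Set 𝓢'(ℝ, ℂ) :=
  {H | ∃ u ∈ schwartzP σ P, ∃ T, IsExtension σ P u T ∧ H = fourierD T}

/-- `H'^σ`: Fourier transforms of tempered distributions with support in the closed half-line. -/
def hardyD (σ : ℤˣ) : Set 𝓢'(ℝ, ℂ) := fourierD '' temperedHalf σ

/-- The distributions given by the functions of a set `A`. -/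
def asDistributions (A : Set (ℝ → ℂ)) : Set 𝓢'(ℝ, ℂ) :=
  {H | ∃ f ∈ A, ∀ φ : 𝓢(ℝ, ℂ), Integrable (fun x => f x * φ x) ∧ H φ = ∫ x, f x * φ x}

/-- `P'` contains `{(-p j - 1, m j - i) | j ∈ ℕ, 0 ≤ i ≤ m j}`. -/
def ContainsDual (P P' : PowerSeq) : Prop :=
  ∀ j i : ℕ, i ≤ (P j).2 → (-(P j).1 - 1, (P j).2 - i) ∈ Set.range P'

end LogPolyhom

end

noncomputable section

namespace LogPolyhom

/-! Why the expansion holds. Replace each term `x ^ p * ln x ^ l` in the expansion of `u` at zero by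
its product with the cutoff `exp (-x) * ∑_{k ≤ K} x ^ k / k!`. This cutoff is `1 + O(x ^ (K + 1))`
at zero and decays exponentially. What remains of `u` after `N` such terms is flat at zero to any
order below `Re p N` if `K` is large, and rapidly decreasing. Integration by parts makes its Fourier
transform a smooth symbol of order `-m`, for every `m` below `Re p N + 1`
(`FlatRapid.isSymbol_halfFourier`).

The damped terms have explicit transforms. By the Gamma integral, `x ^ (p + k) * exp (-x)` goes to
`Γ(p + k + 1) * (1 + iθξ) ^ (-p - k - 1)`, up to the constant `(2π) ^ (-1/2)`; derivatives in `p`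
produce the logarithms. The sum over `k ≤ K` is a Taylor polynomial of the function `s ↦ Γ(p + 1) *
s ^ (-p - 1)`, centred at `1 + iθξ` and evaluated at `iθξ`. It therefore differs from the
homogeneous function of `iθξ` by a Taylor remainder, which gains about `K` powers of `ξ`
(`isSymbol_dampedSum_sub`). For `Re p ≤ -1` the transform formula follows by analytic continuation
in `p` (`rieszPlus_fourier_eq`). The function obtained does not depend on `N` and `K`, so both may
grow with the order wanted (`exists_transform`). Finally `log (iσξ)` is `ln (ξ - σ i0)` plus the
same constant on both half-lines. This yields one sequence of coefficients for both ends.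

Why the inclusions hold. By Leibniz' rule `x_+^p ln^k x` is a finite combination of integrals
against a derivative of the test function, hence tempered, and it vanishes on test functions that
vanish on the half-line. Taylor's formula puts Schwartz functions into the space for `P₀`.
Conversely, Borel's lemma gives a smooth function with the prescribed coefficients; subtracting it
leaves a function flat to infinite order, whose extension by zero is Schwartz
(`InSchwartzP.exists_schwartz_eqOn`). -/

/-! ### Symbols along a filter -/

/-- `g` is smooth along `F`, and its `k`-th derivative is `O(|x| ^ (α - k))`. -/
structure IsSymbol (F : Filter ℝ) (α : ℝ) (g : ℝ → ℂ) : Prop where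
  smooth : ∀ᶠ x in F, x ≠ 0 ∧ ContDiffAt ℝ ∞ g x
  bound : ∀ k : ℕ, iteratedDeriv k g =O[F] fun x => |x| ^ (α - k)

namespace IsSymbol

variable {F : Filter ℝ} {α β : ℝ} {f g : ℝ → ℂ}

theorem ne_zero (hf : IsSymbol F α f) : ∀ᶠ x in F, x ≠ 0 := hf.smooth.mono fun _ h => h.1

theorem congr_on {S : Set ℝ} (hf : IsSymbol F α f) (hS : IsOpen S) (hSF : S ∈ F)
    (h : Set.EqOn f g S) : IsSymbol F α g where
  smooth := by
    filter_upwards [hf.smooth, hSF] with x hx hxS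
    refine ⟨hx.1, hx.2.congr_of_eventuallyEq ?_⟩
    filter_upwards [hS.mem_nhds hxS] with y hy using (h hy).symm
  bound k := by
    refine (hf.bound k).congr' ?_ EventuallyEq.rfl
    filter_upwards [hSF] with x hxS using h.iteratedDeriv_of_isOpen hS k hxS

theorem mono (hf : IsSymbol F α f)
    (h : (fun x : ℝ => |x| ^ α) =O[F] fun x => |x| ^ β) : IsSymbol F β f where
  smooth := hf.smooth
  bound k := by
    refine (hf.bound k).trans ?_
    refine (h.mul (isBigO_refl (fun x : ℝ => |x| ^ (-(k : ℝ))) F)).congr' ?_ ?_ <;>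
    · filter_upwards [hf.ne_zero] with x hx
      rw [← Real.rpow_add (abs_pos.2 hx), sub_eq_add_neg]

theorem add (hf : IsSymbol F α f) (hg : IsSymbol F α g) :
    IsSymbol F α (fun x => f x + g x) where
  smooth := by
    filter_upwards [hf.smooth, hg.smooth] with x h1 h2 using ⟨h1.1, h1.2.add h2.2⟩
  bound k := by
    refine ((hf.bound k).add (hg.bound k)).congr' ?_ EventuallyEq.rfl
    filter_upwards [hf.smooth, hg.smooth] with x h1 h2
    exact (iteratedDeriv_fun_add (h1.2.of_le (mod_cast le_top))
      (h2.2.of_le (mod_cast le_top))).symm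

theorem const_mul (hf : IsSymbol F α f) (c : ℂ) : IsSymbol F α (fun x => c * f x) where
  smooth := hf.smooth.mono fun x h => ⟨h.1, contDiffAt_const.mul h.2⟩
  bound k := by
    have : iteratedDeriv k (fun x => c * f x) = fun x => c * iteratedDeriv k f x := by
      ext x; exact iteratedDeriv_const_mul_field c f
    rw [this]
    exact (hf.bound k).const_mul_left c

theorem neg (hf : IsSymbol F α f) : IsSymbol F α (fun x => -f x) := by
  simpa using hf.const_mul (-1)

theorem sub (hf : IsSymbol F α f) (hg : IsSymbol F α g) :
    IsSymbol F α (fun x => f x - g x) := by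
  simpa [sub_eq_add_neg] using hf.add hg.neg

theorem zero (hF : ∀ᶠ x in F, x ≠ 0) : IsSymbol F α (fun _ => 0) where
  smooth := hF.mono fun x h => ⟨h, contDiffAt_const⟩
  bound k := by
    have : iteratedDeriv k (fun _ : ℝ => (0 : ℂ)) = fun _ => 0 := by
      ext x; exact iteratedDeriv_fun_const_zero
    rw [this]
    exact isBigO_zero _ _

theorem sum {ι : Type*} {s : Finset ι} {f : ι → ℝ → ℂ} (hF : ∀ᶠ x in F, x ≠ 0)
    (hf : ∀ i ∈ s, IsSymbol F α (f i)) : IsSymbol F α (fun x => ∑ i ∈ s, f i x) := by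
  classical
  induction s using Finset.induction_on with
  | empty => simpa using zero hF
  | insert i s hi ih =>
    simp only [Finset.sum_insert hi]
    exact (hf i (Finset.mem_insert_self i s)).add
      (ih fun j hj => hf j (Finset.mem_insert_of_mem hj))

theorem mul (hf : IsSymbol F α f) (hg : IsSymbol F β g) :
    IsSymbol F (α + β) (fun x => f x * g x) where
  smooth := by
    filter_upwards [hf.smooth, hg.smooth] with x h1 h2 using ⟨h1.1, h1.2.mul h2.2⟩
  bound k := by
    have key : (fun x => ∑ i ∈ Finset.range (k + 1), (k.choose i : ℂ) * iteratedDeriv i f x *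
        iteratedDeriv (k - i) g x) =O[F] fun x => |x| ^ (α + β - k) := by
      refine IsBigO.fun_sum fun i hi => ?_
      have hik : i ≤ k := Nat.lt_succ_iff.1 (Finset.mem_range.1 hi)
      refine (((hf.bound i).const_mul_left (k.choose i : ℂ)).mul (hg.bound (k - i))).congr'
        EventuallyEq.rfl ?_
      filter_upwards [hf.ne_zero] with x hx
      rw [← Real.rpow_add (abs_pos.2 hx)]
      congr 1
      push_cast [Nat.cast_sub hik]
      ring
    refine key.congr' ?_ EventuallyEq.rfl
    filter_upwards [hf.smooth, hg.smooth] with x h1 h2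
    exact (iteratedDeriv_fun_mul (h1.2.of_le (mod_cast le_top))
      (h2.2.of_le (mod_cast le_top))).symm

theorem iteratedDeriv_symbol (hf : IsSymbol F α f) (hO : ∀ᶠ x in F, ∀ᶠ y in 𝓝 x, ContDiffAt ℝ ∞ f y)
    (m : ℕ) : IsSymbol F (α - m) (iteratedDeriv m f) where
  smooth := by
    filter_upwards [hf.ne_zero, hO] with x hx h
    refine ⟨hx, ?_⟩
    have hx' := h.self_of_nhds
    induction m with
    | zero => simpa using hx'
    | succ m ih =>
      rw [iteratedDeriv_succ]
      exact (ih.fderiv_right (m := ∞) (by simp)).clm_apply contDiffAt_const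
  bound k := by
    have : iteratedDeriv k (iteratedDeriv m f) = iteratedDeriv (k + m) f := by
      simp only [iteratedDeriv_eq_iterate, Function.iterate_add, Function.comp_apply]
    rw [this]
    refine (hf.bound (k + m)).congr_right fun x => ?_
    congr 1
    push_cast
    ring

theorem const (hF : ∀ᶠ x in F, x ≠ 0) (c : ℂ) : IsSymbol F 0 (fun _ => c) where
  smooth := hF.mono fun x h => ⟨h, contDiffAt_const⟩
  bound k := by
    rcases Nat.eq_zero_or_pos k with rfl | hk
    · simpa using isBigO_const_const c (one_ne_zero (α := ℝ)) F
    · have : iteratedDeriv k (fun _ : ℝ => c) = fun _ => 0 := by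
        ext x; rw [iteratedDeriv_const, if_neg hk.ne']
      rw [this]
      exact isBigO_zero _ _

theorem id (hF : ∀ᶠ x in F, x ≠ 0) : IsSymbol F 1 (fun x => (x : ℂ)) where
  smooth := hF.mono fun x h => ⟨h, Complex.ofRealCLM.contDiff.contDiffAt⟩
  bound k := by
    have hd : deriv (fun x : ℝ => (x : ℂ)) = fun _ => 1 := by
      ext x; exact Complex.ofRealCLM.hasDerivAt.deriv
    rcases k with _ | _ | k
    · simp only [iteratedDeriv_zero]
      refine IsBigO.of_bound 1 (Eventually.of_forall fun x => ?_)
      simp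
    · rw [zero_add, iteratedDeriv_one, hd]
      refine IsBigO.of_bound 1 (Eventually.of_forall fun x => ?_)
      simp
    · rw [iteratedDeriv_succ', hd]
      have : iteratedDeriv (k + 1) (fun _ : ℝ => (1 : ℂ)) = fun _ => 0 := by
        ext x; rw [iteratedDeriv_const, if_neg (Nat.succ_ne_zero k)]
      rw [this]
      exact isBigO_zero _ _

theorem pow (hF : ∀ᶠ x in F, x ≠ 0) (n : ℕ) : IsSymbol F n (fun x => (x : ℂ) ^ n) := by
  induction n with
  | zero => simpa using const hF 1
  | succ n ih =>
    simp only [pow_succ]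
    push_cast
    exact ih.mul (id hF)

end IsSymbol

/-! ### Log-homogeneous functions -/

/-- `x ^ p * (ln x) ^ k` for the branch `ℓ` of the logarithm. -/
def logPow (ℓ : ℝ → ℂ) (p : ℂ) (k : ℕ) (x : ℝ) : ℂ := Complex.exp (p * ℓ x) * ℓ x ^ k

theorem hasDerivAt_logPow {ℓ : ℝ → ℂ} {x : ℝ} (h : HasDerivAt ℓ ((x : ℂ)⁻¹) x) (p : ℂ) (k : ℕ) :
    HasDerivAt (logPow ℓ p k) ((x : ℂ)⁻¹ * (p * logPow ℓ p k x + k * logPow ℓ p (k - 1) x)) x := by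
  refine (((h.const_mul p).cexp).mul (h.pow k)).congr_deriv ?_
  simp only [logPow, Pi.pow_apply]
  ring

/-- The operator `x d/dx` preserves the span of `x ^ p * ln x ^ i`, `i ≤ k`, so every derivative
costs exactly one factor `x⁻¹`. -/
theorem iteratedDeriv_logPow {ℓ : ℝ → ℂ} {S : Set ℝ} (hS : IsOpen S) (h0 : ∀ x ∈ S, x ≠ 0)
    (h : ∀ x ∈ S, HasDerivAt ℓ ((x : ℂ)⁻¹) x) (p : ℂ) (k n : ℕ) :
    ∃ c : ℕ → ℂ, ∀ x ∈ S, iteratedDeriv n (logPow ℓ p k) x =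
      (x : ℂ)⁻¹ ^ n * ∑ i ∈ Finset.range (k + 1), c i * logPow ℓ p i x := by
  induction n with
  | zero =>
    refine ⟨fun i => if i = k then 1 else 0, fun x _ => ?_⟩
    simp [Finset.sum_ite_eq']
  | succ n ih =>
    obtain ⟨c, hc⟩ := ih
    -- `p` comes from the power, `-n` from the prefactor `x⁻¹ ^ n`, and `(i + 1) * c (i + 1)` from
    -- differentiating the next power of the logarithm, absent at the top `i = k`.
    refine ⟨fun i => (p - n) * c i + (i + 1) * (if i + 1 ≤ k then c (i + 1) else 0),
      fun x hx => ?_⟩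
    have hx0 : (x : ℂ) ≠ 0 := by exact_mod_cast h0 x hx
    have hinv : HasDerivAt (fun y : ℝ => (y : ℂ)⁻¹) (-((x : ℂ)⁻¹ ^ 2)) x := by
      have := (hasDerivAt_inv hx0).comp_ofReal
      refine this.congr_deriv ?_
      rw [inv_pow]
    have hsum := HasDerivAt.fun_sum (u := Finset.range (k + 1)) fun i _ =>
      (hasDerivAt_logPow (h x hx) p i).const_mul (c i)
    have hd := (hinv.fun_pow n).mul hsum
    have heq : iteratedDeriv n (logPow ℓ p k) =ᶠ[𝓝 x] fun y : ℝ => (y : ℂ)⁻¹ ^ n *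
        ∑ i ∈ Finset.range (k + 1), c i * logPow ℓ p i y := by
      filter_upwards [hS.mem_nhds hx] with y hy using hc y hy
    rw [iteratedDeriv_succ, heq.deriv_eq]
    refine hd.deriv.trans ?_
    have e1 : ∑ i ∈ Finset.range (k + 1), c i * ((x : ℂ)⁻¹ * (p * logPow ℓ p i x +
        i * logPow ℓ p (i - 1) x)) = (x : ℂ)⁻¹ * (∑ i ∈ Finset.range (k + 1),
          p * (c i * logPow ℓ p i x) + ∑ i ∈ Finset.range (k + 1),
          (i * c i) * logPow ℓ p (i - 1) x) := by
      rw [← Finset.sum_add_distrib, Finset.mul_sum]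
      refine Finset.sum_congr rfl fun i _ => ?_
      ring
    have e2 : ∑ i ∈ Finset.range (k + 1), (i * c i) * logPow ℓ p (i - 1) x =
        ∑ i ∈ Finset.range (k + 1), ((i + 1) * (if i + 1 ≤ k then c (i + 1) else 0)) *
          logPow ℓ p i x := by
      rw [Finset.sum_range_succ', Finset.sum_range_succ (n := k)]
      simp only [Nat.cast_zero, zero_mul, add_zero, Nat.add_sub_cancel]
      rw [if_neg (by omega), mul_zero, zero_mul, add_zero]
      refine Finset.sum_congr rfl fun i hi => ?_
      rw [if_pos (by have := Finset.mem_range.1 hi; omega)]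
      push_cast
      ring
    have e3 : (n : ℂ) * (x : ℂ)⁻¹ ^ (n - 1) * -((x : ℂ)⁻¹ ^ 2) = -n * (x : ℂ)⁻¹ ^ (n + 1) := by
      rcases n with _ | n
      · simp
      · simp only [Nat.add_sub_cancel]; ring
    rw [e1, e2, e3]
    simp only [add_mul, Finset.sum_add_distrib, sub_mul, Finset.sum_sub_distrib]
    simp only [mul_assoc, ← Finset.mul_sum]
    ring

/-- `F` sees the powers of the logarithm as `O(|x| ^ η)`. -/
def LogBound (F : Filter ℝ) (η : ℝ) : Prop :=
  ∀ k : ℕ, (fun x : ℝ => (1 + |Real.log x|) ^ k) =O[F] fun x => |x| ^ η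

theorem logBound_nhdsGT {ε : ℝ} (hε : 0 < ε) : LogBound (𝓝[>] 0) (-ε) := by
  intro k
  have h0 : ∀ᶠ x : ℝ in 𝓝[>] 0, x ∈ Set.Ioo (0 : ℝ) 1 := Ioo_mem_nhdsGT one_pos
  -- The `k`-th power of this bound has exponent `-ε * k / (k + 1) ≥ -ε`; the denominator `k + 1`
  -- also covers `k = 0`.
  have h : (fun x : ℝ => |Real.log x|) =O[𝓝[>] 0] fun x => |x| ^ (-(ε / (k + 1))) := by
    have := (isLittleO_log_rpow_nhdsGT_zero (r := -(ε / (k + 1)))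
      (by rw [neg_lt_zero]; positivity)).isBigO.norm_left
    refine this.congr' EventuallyEq.rfl ?_
    filter_upwards [h0] with x hx
    rw [abs_of_pos hx.1]
  have h1 : (fun _ : ℝ => (1 : ℝ)) =O[𝓝[>] 0] fun x : ℝ => |x| ^ (-(ε / (k + 1))) := by
    refine IsBigO.of_bound 1 ?_
    filter_upwards [h0] with x hx
    rw [abs_of_pos hx.1, norm_one, one_mul, Real.norm_of_nonneg (Real.rpow_nonneg hx.1.le _)]
    exact Real.one_le_rpow_of_pos_of_le_one_of_nonpos hx.1 hx.2.le
      (by rw [neg_nonpos]; positivity)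
  refine ((h1.add h).pow k).trans ?_
  refine IsBigO.of_bound 1 ?_
  filter_upwards [h0] with x hx
  rw [abs_of_pos hx.1, one_mul, Real.norm_of_nonneg (pow_nonneg (Real.rpow_nonneg hx.1.le _) _),
    Real.norm_of_nonneg (Real.rpow_nonneg hx.1.le _), ← Real.rpow_natCast, ← Real.rpow_mul hx.1.le]
  refine Real.rpow_le_rpow_of_exponent_ge hx.1 hx.2.le ?_
  rw [neg_mul, neg_le_neg_iff, div_mul_eq_mul_div, div_le_iff₀ (by positivity)]
  nlinarith

theorem logBound_atTop {ε : ℝ} (hε : 0 < ε) : LogBound atTop ε := by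
  intro k
  have h0 : ∀ᶠ x : ℝ in atTop, 1 ≤ x := eventually_ge_atTop 1
  have h : (fun x : ℝ => |Real.log x|) =O[atTop] fun x => |x| ^ (ε / (k + 1)) := by
    have := (isLittleO_log_rpow_atTop (r := ε / (k + 1)) (by positivity)).isBigO.norm_left
    refine this.congr' EventuallyEq.rfl ?_
    filter_upwards [h0] with x hx
    rw [abs_of_pos (by linarith)]
  have h1 : (fun _ : ℝ => (1 : ℝ)) =O[atTop] fun x : ℝ => |x| ^ (ε / (k + 1)) := by
    refine IsBigO.of_bound 1 ?_
    filter_upwards [h0] with x hx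
    rw [abs_of_pos (by linarith), norm_one, one_mul,
      Real.norm_of_nonneg (Real.rpow_nonneg (by linarith) _)]
    exact Real.one_le_rpow hx (by positivity)
  refine ((h1.add h).pow k).trans ?_
  refine IsBigO.of_bound 1 ?_
  filter_upwards [h0] with x hx
  have hx0 : 0 < x := by linarith
  rw [abs_of_pos hx0, one_mul, Real.norm_of_nonneg (pow_nonneg (Real.rpow_nonneg hx0.le _) _),
    Real.norm_of_nonneg (Real.rpow_nonneg hx0.le _), ← Real.rpow_natCast, ← Real.rpow_mul hx0.le]
  refine Real.rpow_le_rpow_of_exponent_le hx ?_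
  rw [div_mul_eq_mul_div, div_le_iff₀ (by positivity)]
  nlinarith

theorem logBound_atBot {ε : ℝ} (hε : 0 < ε) : LogBound atBot ε := by
  intro k
  have := (logBound_atTop hε k).comp_tendsto tendsto_neg_atBot_atTop
  refine this.congr (fun x => ?_) fun x => ?_
  · simp
  · simp

/-- `ℓ` is a branch of the logarithm on the open set `S`, with bounded argument. -/
structure IsLogOn (ℓ : ℝ → ℂ) (S : Set ℝ) : Prop where
  isOpen : IsOpen S
  ne_zero : ∀ x ∈ S, x ≠ 0
  hasDerivAt : ∀ x ∈ S, HasDerivAt ℓ ((x : ℂ)⁻¹) x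
  re_eq : ∀ x ∈ S, (ℓ x).re = Real.log x
  im_le : ∃ B : ℝ, ∀ x ∈ S, |(ℓ x).im| ≤ B

theorem IsLogOn.mono {ℓ : ℝ → ℂ} {S T : Set ℝ} (h : IsLogOn ℓ S) (hT : IsOpen T) (hTS : T ⊆ S) :
    IsLogOn ℓ T where
  isOpen := hT
  ne_zero x hx := h.ne_zero x (hTS hx)
  hasDerivAt x hx := h.hasDerivAt x (hTS hx)
  re_eq x hx := h.re_eq x (hTS hx)
  im_le := h.im_le.imp fun _ hB x hx => hB x (hTS hx)

theorem IsLogOn.contDiffAt {ℓ : ℝ → ℂ} {S : Set ℝ} (h : IsLogOn ℓ S) {x : ℝ} (hx : x ∈ S) :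
    ContDiffAt ℝ ∞ ℓ x := by
  have h1 : ContDiffOn ℝ ∞ ℓ S := by
    rw [contDiffOn_infty_iff_deriv_of_isOpen h.isOpen]
    refine ⟨fun x hx => (h.hasDerivAt x hx).differentiableAt.differentiableWithinAt, ?_⟩
    have : ContDiffOn ℝ ∞ (fun x : ℝ => (x : ℂ)⁻¹) S := by
      refine ContDiffOn.inv (Complex.ofRealCLM.contDiff.contDiffOn) fun x hx => ?_
      exact_mod_cast h.ne_zero x hx
    exact this.congr fun x hx => (h.hasDerivAt x hx).deriv
  exact h1.contDiffAt (h.isOpen.mem_nhds hx)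

theorem IsLogOn.contDiffAt_logPow {ℓ : ℝ → ℂ} {S : Set ℝ} (h : IsLogOn ℓ S) {x : ℝ} (hx : x ∈ S)
    (p : ℂ) (k : ℕ) : ContDiffAt ℝ ∞ (logPow ℓ p k) x :=
  ((contDiffAt_const.mul (h.contDiffAt hx)).cexp).mul ((h.contDiffAt hx).pow k)

/-- Since `Im ℓ` is bounded by `B`, the modulus of `exp (p * ℓ x)` is `|x| ^ Re p` up to the factor
`exp (|Im p| * B)`, and `‖ℓ x‖` is comparable to `1 + |log x|`. The exponent `η` absorbs the
logarithms. -/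
theorem IsLogOn.logPow_isBigO {ℓ : ℝ → ℂ} {S : Set ℝ} {F : Filter ℝ} {η : ℝ} (h : IsLogOn ℓ S)
    (hF : S ∈ F) (hη : LogBound F η) (p : ℂ) (k : ℕ) :
    logPow ℓ p k =O[F] fun x => |x| ^ (p.re + η) := by
  obtain ⟨B, hB⟩ := h.im_le
  have h1 : logPow ℓ p k =O[F] fun x => |x| ^ p.re * (1 + |Real.log x|) ^ k := by
    refine IsBigO.of_bound (Real.exp (|p.im| * B) * (1 + B) ^ k) ?_
    filter_upwards [hF] with x hx
    have hB0 : 0 ≤ B := (abs_nonneg _).trans (hB x hx)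
    have hx0 : 0 < |x| := abs_pos.2 (h.ne_zero x hx)
    have e1 : ‖Complex.exp (p * ℓ x)‖ ≤ |x| ^ p.re * Real.exp (|p.im| * B) := by
      rw [Complex.norm_exp, Complex.mul_re, h.re_eq x hx, Real.rpow_def_of_pos hx0, Real.log_abs,
        ← Real.exp_add, Real.exp_le_exp]
      have : -(p.im * (ℓ x).im) ≤ |p.im| * B := by
        refine (neg_le_abs _).trans ?_
        rw [abs_mul]
        exact mul_le_mul_of_nonneg_left (hB x hx) (abs_nonneg _)
      linarith [mul_comm p.re (Real.log x)]
    have e2 : ‖ℓ x‖ ≤ (1 + B) * (1 + |Real.log x|) := by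
      refine (Complex.norm_le_abs_re_add_abs_im _).trans ?_
      rw [h.re_eq x hx]
      nlinarith [hB x hx, abs_nonneg (Real.log x)]
    have e3 : ‖ℓ x ^ k‖ ≤ (1 + B) ^ k * (1 + |Real.log x|) ^ k := by
      rw [norm_pow, ← mul_pow]
      exact pow_le_pow_left₀ (norm_nonneg _) e2 k
    rw [logPow, norm_mul, Real.norm_of_nonneg (by positivity)]
    calc _ ≤ (|x| ^ p.re * Real.exp (|p.im| * B)) * ((1 + B) ^ k * (1 + |Real.log x|) ^ k) :=
          mul_le_mul e1 e3 (norm_nonneg _) (by positivity)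
      _ = _ := by ring
  refine h1.trans (((isBigO_refl (fun x : ℝ => |x| ^ p.re) F).mul (hη k)).congr'
    EventuallyEq.rfl ?_)
  filter_upwards [hF] with x hx
  rw [Real.rpow_add (abs_pos.2 (h.ne_zero x hx))]

theorem IsLogOn.isSymbol_logPow {ℓ : ℝ → ℂ} {S : Set ℝ} {F : Filter ℝ} {η : ℝ} (h : IsLogOn ℓ S)
    (hF : S ∈ F) (hη : LogBound F η) (p : ℂ) (k : ℕ) :
    IsSymbol F (p.re + η) (logPow ℓ p k) where
  smooth := by
    filter_upwards [hF] with x hx using ⟨h.ne_zero x hx, h.contDiffAt_logPow hx p k⟩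
  bound n := by
    obtain ⟨c, hc⟩ := iteratedDeriv_logPow h.isOpen h.ne_zero h.hasDerivAt p k n
    have h1 : (fun x => ∑ i ∈ Finset.range (k + 1), c i * logPow ℓ p i x) =O[F]
        fun x => |x| ^ (p.re + η) :=
      IsBigO.fun_sum fun i _ => (h.logPow_isBigO hF hη p i).const_mul_left (c i)
    have h2 : (fun x : ℝ => (x : ℂ)⁻¹ ^ n) =O[F] fun x => |x| ^ (-(n : ℝ)) := by
      refine IsBigO.of_bound 1 (Eventually.of_forall fun x => ?_)
      rw [Real.rpow_neg (abs_nonneg _), Real.rpow_natCast, norm_pow, norm_inv, one_mul,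
        Complex.norm_real, Real.norm_eq_abs, norm_inv, norm_pow, Real.norm_eq_abs, abs_abs, inv_pow]
    refine (h2.mul h1).congr' ?_ ?_
    · filter_upwards [hF] with x hx using (hc x hx).symm
    · filter_upwards [hF] with x hx
      rw [← Real.rpow_add (abs_pos.2 (h.ne_zero x hx))]
      congr 1
      ring

theorem partialSum_eq_logPow (ℓ : ℝ → ℂ) (P : PowerSeq) (a : ℕ → ℕ → ℂ) (N : ℕ) (x : ℝ) :
    partialSum ℓ P a N x = ∑ j ∈ Finset.range N, ∑ k ∈ Finset.range ((P j).2 + 1),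
      a j k * logPow ℓ (P j).1 k x := rfl

theorem hasDerivAt_logAbs {x : ℝ} (hx : x ≠ 0) : HasDerivAt logAbs ((x : ℂ)⁻¹) x := by
  have := (Real.hasDerivAt_log hx).ofReal_comp
  rw [Complex.ofReal_inv] at this
  refine this.congr_of_eventuallyEq (Eventually.of_forall fun y => ?_)
  simp [logAbs]

theorem isLogOn_logAbs : IsLogOn logAbs {0}ᶜ where
  isOpen := isOpen_compl_singleton
  ne_zero x hx := hx
  hasDerivAt x hx := hasDerivAt_logAbs hx
  re_eq x _ := by simp [logAbs]
  im_le := ⟨0, fun x _ => by simp [logAbs]⟩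

theorem isLogOn_logBoundary (τ : ℤˣ) : IsLogOn (logBoundary τ) {0}ᶜ where
  isOpen := isOpen_compl_singleton
  ne_zero x hx := hx
  hasDerivAt x hx := by
    rcases lt_or_gt_of_ne (show x ≠ 0 from hx) with h | h
    · refine ((hasDerivAt_logAbs hx).add_const
        (((τ : ℤ) : ℂ) * (Real.pi : ℂ) * Complex.I)).congr_of_eventuallyEq ?_
      filter_upwards [gt_mem_nhds h] with y hy
      simp [logBoundary, logAbs, not_lt.2 (le_of_lt hy)]
    · refine (hasDerivAt_logAbs hx).congr_of_eventuallyEq ?_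
      filter_upwards [lt_mem_nhds h] with y hy
      simp [logBoundary, logAbs, hy]
  re_eq x _ := by
    unfold logBoundary
    split_ifs <;> simp
  im_le := by
    refine ⟨Real.pi, fun x _ => ?_⟩
    unfold logBoundary
    split_ifs
    · simp [Real.pi_pos.le]
    · rcases Int.units_eq_one_or τ with rfl | rfl <;> simp [abs_of_pos Real.pi_pos]

/-! ### Holomorphic dependence of integrals on a parameter -/

section Parametric

variable {X : Type*} [MeasurableSpace X] {μ : Measure X}

/-- Holomorphy makes a majorant of `F` alone sufficient: Cauchy's estimate on circles of radius `r`,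
which stay inside the ball of radius `2 * r`, bounds the derivative by `bound / r`. The first two
conclusions supply the hypotheses for the derivative on the smaller ball, so the statement can be
iterated. -/
theorem hasDerivAt_integral_of_holomorphic {U : Set ℂ} {F : ℂ → X → ℂ} {bound : X → ℝ}
    (hm : ∀ w ∈ U, AEStronglyMeasurable (F w) μ)
    (hd : ∀ᵐ x ∂μ, DifferentiableOn ℂ (fun w => F w x) U)
    (hb : ∀ᵐ x ∂μ, ∀ w ∈ U, ‖F w x‖ ≤ bound x) (hbi : Integrable bound μ)
    {w : ℂ} {r : ℝ} (hr : 0 < r) (hball : Metric.ball w (2 * r) ⊆ U) :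
    (∀ v ∈ Metric.ball w r, AEStronglyMeasurable (fun x => deriv (fun w => F w x) v) μ) ∧
    (∀ᵐ x ∂μ, ∀ v ∈ Metric.ball w r, ‖deriv (fun w => F w x) v‖ ≤ bound x / r) ∧
    ∀ v ∈ Metric.ball w r,
      HasDerivAt (fun w => ∫ x, F w x ∂μ) (∫ x, deriv (fun w => F w x) v ∂μ) v := by
  have hsub : ∀ v ∈ Metric.ball w r, ∀ z ∈ Metric.closedBall v r, z ∈ Metric.ball w (2 * r) := by
    intro v hv z hz
    rw [Metric.mem_ball] at hv ⊢
    rw [Metric.mem_closedBall] at hz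
    linarith [dist_triangle z v w]
  have hdat : ∀ᵐ x ∂μ, ∀ v ∈ Metric.ball w (2 * r), DifferentiableAt ℂ (fun w => F w x) v := by
    filter_upwards [hd] with x hx v hv
    exact (hx.mono hball).differentiableAt (Metric.isOpen_ball.mem_nhds hv)
  have hmeas : ∀ v ∈ Metric.ball w r,
      AEStronglyMeasurable (fun x => deriv (fun w => F w x) v) μ := by
    intro v hv
    -- The derivative is measurable in `x` as the limit of the difference quotients with these
    -- steps, of length at most `r`.
    set h : ℕ → ℂ := fun n => ((r / (n + 1) : ℝ) : ℂ) with hh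
    have hpos : ∀ n : ℕ, 0 < r / (n + 1 : ℝ) := fun n => by positivity
    have hle : ∀ n : ℕ, ‖h n‖ ≤ r := fun n => by
      rw [hh, Complex.norm_real, Real.norm_of_nonneg (hpos n).le]
      exact div_le_self hr.le (by linarith [(Nat.cast_nonneg n : (0 : ℝ) ≤ n)])
    have hlim : Tendsto h atTop (𝓝[≠] 0) := by
      refine tendsto_nhdsWithin_iff.2 ⟨?_, Eventually.of_forall fun n => ?_⟩
      · have : Tendsto (fun n : ℕ => r / ((n : ℝ) + 1)) atTop (𝓝 0) :=
          tendsto_const_nhds.div_atTop (tendsto_atTop_add_const_right _ _ tendsto_natCast_atTop_atTop)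
        simpa [hh, Function.comp_def] using (Complex.continuous_ofReal.tendsto 0).comp this
      · exact Complex.ofReal_ne_zero.2 (hpos n).ne'
    refine aestronglyMeasurable_of_tendsto_ae (f := fun n x => (h n)⁻¹ • (F (v + h n) x - F v x)) atTop
      (fun n => ?_) ?_
    · have h1 : v + h n ∈ Metric.closedBall v r := by simpa [dist_eq_norm] using hle n
      have h2 := (hm _ (hball (hsub v hv _ h1))).sub
        (hm _ (hball (hsub v hv v (Metric.mem_closedBall_self hr.le))))
      exact h2.const_smul (h n)⁻¹
    · filter_upwards [hdat] with x hx
      have := (hx v (hsub v hv v (Metric.mem_closedBall_self hr.le))).hasDerivAt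
      rw [hasDerivAt_iff_tendsto_slope_zero] at this
      exact this.comp hlim
  have hbd : ∀ᵐ x ∂μ, ∀ v ∈ Metric.ball w r, ‖deriv (fun w => F w x) v‖ ≤ bound x / r := by
    filter_upwards [hdat, hb] with x hx hbx v hv
    refine Complex.norm_deriv_le_of_forall_mem_sphere_norm_le hr ?_ fun z hz =>
      hbx z (hball (hsub v hv z (Metric.sphere_subset_closedBall hz)))
    refine DifferentiableOn.diffContOnCl fun z hz => ?_
    exact (hx z (hsub v hv z (Metric.closure_ball_subset_closedBall hz))).differentiableWithinAt
  refine ⟨hmeas, hbd, fun v hv => ?_⟩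
  have hvU : ∀ v ∈ Metric.ball w r, v ∈ U := fun v hv =>
    hball (hsub v hv v (Metric.mem_closedBall_self hr.le))
  refine (hasDerivAt_integral_of_dominated_loc_of_deriv_le (Metric.isOpen_ball.mem_nhds hv) ?_ ?_
    (hmeas v hv) hbd (hbi.div_const r) ?_).2
  · filter_upwards [Metric.isOpen_ball.mem_nhds hv] with z hz using hm z (hvU z hz)
  · refine hbi.mono' (hm v (hvU v hv)) ?_
    filter_upwards [hb] with x hx using hx v (hvU v hv)
  · filter_upwards [hdat] with x hx z hz
    exact (hx z (hsub z hz z (Metric.mem_closedBall_self hr.le))).hasDerivAt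

theorem exists_ball_subset_two_mul {U : Set ℂ} (hU : IsOpen U) {w : ℂ} (hw : w ∈ U) :
    ∃ r > 0, Metric.ball w (2 * r) ⊆ U := by
  obtain ⟨r, hr, h⟩ := Metric.isOpen_iff.1 hU w hw
  exact ⟨r / 2, by positivity, by rwa [mul_div_cancel₀ _ two_ne_zero]⟩

theorem differentiableOn_integral_of_holomorphic {U : Set ℂ} (hU : IsOpen U) {F : ℂ → X → ℂ}
    {bound : X → ℝ} (hm : ∀ w ∈ U, AEStronglyMeasurable (F w) μ)
    (hd : ∀ᵐ x ∂μ, DifferentiableOn ℂ (fun w => F w x) U)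
    (hb : ∀ᵐ x ∂μ, ∀ w ∈ U, ‖F w x‖ ≤ bound x) (hbi : Integrable bound μ) :
    DifferentiableOn ℂ (fun w => ∫ x, F w x ∂μ) U := by
  intro w hw
  obtain ⟨r, hr, hball⟩ := exists_ball_subset_two_mul hU hw
  exact ((hasDerivAt_integral_of_holomorphic hm hd hb hbi hr hball).2.2 w
    (Metric.mem_ball_self hr)).differentiableAt.differentiableWithinAt

theorem iteratedDeriv_integral_of_holomorphic (l : ℕ) : ∀ {U : Set ℂ} (_ : IsOpen U)
    {F : ℂ → X → ℂ} {bound : X → ℝ} (_ : ∀ w ∈ U, AEStronglyMeasurable (F w) μ)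
    (_ : ∀ᵐ x ∂μ, DifferentiableOn ℂ (fun w => F w x) U)
    (_ : ∀ᵐ x ∂μ, ∀ w ∈ U, ‖F w x‖ ≤ bound x) (_ : Integrable bound μ) {w : ℂ} (_ : w ∈ U),
    Integrable (fun x => iteratedDeriv l (fun w => F w x) w) μ ∧
      iteratedDeriv l (fun w => ∫ x, F w x ∂μ) w = ∫ x, iteratedDeriv l (fun w => F w x) w ∂μ := by
  induction l with
  | zero =>
    intro U _ F bound hm _ hb hbi w hw
    simp only [iteratedDeriv_zero, and_true]
    refine hbi.mono' (hm w hw) ?_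
    filter_upwards [hb] with x hx using hx w hw
  | succ l ih =>
    intro U hU F bound hm hd hb hbi w hw
    obtain ⟨r, hr, hball⟩ := exists_ball_subset_two_mul hU hw
    obtain ⟨h1, h2, h3⟩ := hasDerivAt_integral_of_holomorphic hm hd hb hbi hr hball
    have hd' : ∀ᵐ x ∂μ, DifferentiableOn ℂ (fun v => deriv (fun w => F w x) v)
        (Metric.ball w r) := by
      filter_upwards [hd] with x hx
      exact (hx.deriv hU).mono
        ((Metric.ball_subset_ball (by linarith)).trans hball)
    have := ih Metric.isOpen_ball h1 hd' h2 (hbi.div_const r) (Metric.mem_ball_self hr)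
    simp only [iteratedDeriv_succ']
    refine ⟨this.1, Eq.trans ?_ this.2⟩
    refine Filter.EventuallyEq.iteratedDeriv_eq l ?_
    filter_upwards [Metric.ball_mem_nhds w hr] with v hv using (h3 v hv).deriv

end Parametric

/-! ### Functions on the half-line and their Mellin integrals -/

/-- The two asymptotic bounds control `g` outside a compact interval in `(0, ∞)`, and there `g / x ^
a` is bounded by continuity. -/
theorem exists_bound_Ioi {g : ℝ → ℂ} {a b : ℝ} (hg : ContinuousOn g (Set.Ioi 0))
    (h0 : g =O[𝓝[>] 0] fun x => x ^ a) (hi : g =O[atTop] fun x => x ^ b) :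
    ∃ C : ℝ, 0 ≤ C ∧ ∀ x : ℝ, 0 < x → ‖g x‖ ≤ C * (x ^ a + x ^ b) := by
  obtain ⟨C₀, hC₀, h0⟩ := h0.exists_nonneg
  obtain ⟨C₁, hC₁, hi⟩ := hi.exists_nonneg
  obtain ⟨δ, hδ, h0⟩ := mem_nhdsGT_iff_exists_Ioo_subset.1 h0.bound
  obtain ⟨R, hi⟩ := eventually_atTop.1 hi.bound
  have hδ0 : 0 < δ := hδ
  obtain ⟨C₂, hC₂⟩ := isCompact_Icc.exists_bound_of_continuousOn (f := fun x : ℝ => g x / (x ^ a : ℝ))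
    (s := Set.Icc δ (max R δ)) (by
      refine (hg.mono fun x hx => lt_of_lt_of_le hδ0 hx.1).div ?_ fun x hx => ?_
      · refine Complex.continuous_ofReal.comp_continuousOn ?_
        exact continuousOn_id.rpow_const fun x hx => Or.inl (lt_of_lt_of_le hδ0 hx.1).ne'
      · exact_mod_cast (Real.rpow_pos_of_pos (lt_of_lt_of_le hδ0 hx.1) a).ne')
  refine ⟨C₀ + C₁ + |C₂|, by positivity, fun x hx => ?_⟩
  have ha := Real.rpow_pos_of_pos hx a
  have hb := Real.rpow_pos_of_pos hx b
  have hC : 0 ≤ |C₂| := abs_nonneg _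
  rcases lt_or_ge x δ with h | h
  · have : ‖g x‖ ≤ C₀ * ‖x ^ a‖ := h0 ⟨hx, h⟩
    rw [Real.norm_of_nonneg ha.le] at this
    nlinarith [mul_nonneg hC₀ hb.le, mul_nonneg hC₁ ha.le, mul_nonneg hC₁ hb.le,
      mul_nonneg hC ha.le, mul_nonneg hC hb.le]
  rcases lt_or_ge x (max R δ) with h' | h'
  · have := (hC₂ x ⟨h, h'.le⟩).trans (le_abs_self _)
    rw [norm_div, Complex.norm_real, Real.norm_of_nonneg ha.le, div_le_iff₀ ha] at this
    nlinarith [mul_nonneg hC₀ hb.le, mul_nonneg hC₁ ha.le, mul_nonneg hC₁ hb.le,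
      mul_nonneg hC₀ ha.le, mul_nonneg hC hb.le]
  · have : ‖g x‖ ≤ C₁ * ‖x ^ b‖ := hi x ((le_max_left _ _).trans h')
    rw [Real.norm_of_nonneg hb.le] at this
    nlinarith [mul_nonneg hC₀ hb.le, mul_nonneg hC₁ ha.le, mul_nonneg hC₀ ha.le,
      mul_nonneg hC ha.le, mul_nonneg hC hb.le]

/-- `g` is continuous on `(0, ∞)`, `O(x ^ b)` at `0` and rapidly decreasing at infinity. -/
structure RapidBound (b : ℝ) (g : ℝ → ℂ) : Prop where
  cont : ContinuousOn g (Set.Ioi 0)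
  bound : ∀ m : ℕ, ∃ C : ℝ, 0 ≤ C ∧ ∀ x : ℝ, 0 < x → ‖g x‖ ≤ C * (x ^ b * (1 + x) ^ (-(m : ℝ)))

theorem integrableOn_rpow_mul_one_add {a m : ℝ} (ha : -1 < a) (hm : a + 1 < m) :
    IntegrableOn (fun x : ℝ => x ^ a * (1 + x) ^ (-m)) (Set.Ioi 0) := by
  have hmeas : Measurable (fun x : ℝ => x ^ a * (1 + x) ^ (-m)) := by fun_prop
  rw [← Set.Ioc_union_Ioi_eq_Ioi zero_le_one]
  have hm0 : 0 < m := by linarith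
  refine IntegrableOn.union ?_ ?_
  · have : IntegrableOn (fun x : ℝ => x ^ a) (Set.Ioc 0 1) :=
      (intervalIntegrable_iff_integrableOn_Ioc_of_le zero_le_one).1
        (intervalIntegral.intervalIntegrable_rpow' ha)
    refine this.mono' hmeas.aestronglyMeasurable ?_
    filter_upwards [ae_restrict_mem measurableSet_Ioc] with x hx
    rw [Real.norm_of_nonneg (mul_nonneg (Real.rpow_nonneg hx.1.le _)
      (Real.rpow_nonneg (by linarith [hx.1]) _))]
    refine mul_le_of_le_one_right (Real.rpow_nonneg hx.1.le _) ?_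
    exact Real.rpow_le_one_of_one_le_of_nonpos (by linarith [hx.1]) (by linarith)
  · refine (integrableOn_Ioi_rpow_of_lt (show a - m < -1 by linarith) one_pos).mono'
      hmeas.aestronglyMeasurable ?_
    filter_upwards [ae_restrict_mem measurableSet_Ioi] with x hx
    have hx0 : (0 : ℝ) < x := one_pos.trans hx
    rw [Real.norm_of_nonneg (mul_nonneg (Real.rpow_nonneg hx0.le _)
      (Real.rpow_nonneg (by linarith) _)), sub_eq_add_neg, Real.rpow_add hx0]
    refine mul_le_mul_of_nonneg_left ?_ (Real.rpow_nonneg hx0.le _)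
    exact Real.rpow_le_rpow_of_nonpos hx0 (by linarith) (by linarith)

theorem cpow_eq_exp_logAbs {x : ℝ} (hx : 0 < x) (w : ℂ) :
    (x : ℂ) ^ w = Complex.exp (w * logAbs x) := by
  rw [Complex.cpow_def_of_ne_zero (by exact_mod_cast hx.ne'), ← Complex.ofReal_log hx.le, logAbs,
    abs_of_pos hx, mul_comm]

theorem iteratedDeriv_exp_mul_const (l : ℕ) (b c w : ℂ) :
    iteratedDeriv l (fun w => Complex.exp (w * b) * c) w = Complex.exp (w * b) * b ^ l * c := by
  induction l generalizing w with
  | zero => simp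
  | succ l ih =>
    rw [iteratedDeriv_succ, show iteratedDeriv l (fun w => Complex.exp (w * b) * c) =
      fun w => Complex.exp (w * b) * b ^ l * c from funext ih]
    have := (((hasDerivAt_id w).mul_const b).cexp.mul_const (b ^ l)).mul_const c
    refine this.deriv.trans ?_
    simp only [id]
    ring

/-- The Mellin integral `∫_0^∞ x ^ w g(x) dx`. -/
def mellinIoi (g : ℝ → ℂ) (w : ℂ) : ℂ := ∫ x in Set.Ioi (0 : ℝ), (x : ℂ) ^ w * g x

/-- From `x ^ Re w ≤ x ^ s + x ^ t` one majorant serves the whole strip `s ≤ Re w ≤ t`, as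
differentiation under the integral sign requires. -/
theorem norm_cpow_mul_le {g : ℝ → ℂ} {b C : ℝ} {m : ℕ} {x s t : ℝ} {w : ℂ} (hx : 0 < x)
    (h : ‖g x‖ ≤ C * (x ^ b * (1 + x) ^ (-(m : ℝ)))) (hs : s ≤ w.re) (ht : w.re ≤ t) :
    ‖(x : ℂ) ^ w * g x‖ ≤ C * (x ^ (s + b) * (1 + x) ^ (-(m : ℝ)) +
      x ^ (t + b) * (1 + x) ^ (-(m : ℝ))) := by
  have hw : x ^ w.re ≤ x ^ s + x ^ t := by
    rcases le_total x 1 with h1 | h1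
    · exact (Real.rpow_le_rpow_of_exponent_ge hx h1 hs).trans
        (le_add_of_nonneg_right (Real.rpow_nonneg hx.le _))
    · exact (Real.rpow_le_rpow_of_exponent_le h1 ht).trans
        (le_add_of_nonneg_left (Real.rpow_nonneg hx.le _))
  rw [norm_mul, Complex.norm_cpow_eq_rpow_re_of_pos hx]
  calc _ ≤ (x ^ s + x ^ t) * (C * (x ^ b * (1 + x) ^ (-(m : ℝ)))) :=
        mul_le_mul hw h (norm_nonneg _) (add_nonneg (Real.rpow_nonneg hx.le _)
          (Real.rpow_nonneg hx.le _))
    _ = _ := by rw [Real.rpow_add hx, Real.rpow_add hx]; ring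

theorem RapidBound.exists_dominating {b : ℝ} {g : ℝ → ℂ} (hg : RapidBound b g) {s t : ℝ}
    (hs : -1 < s + b) (hst : s ≤ t) : ∃ bound : ℝ → ℝ, IntegrableOn bound (Set.Ioi 0) ∧
      ∀ x : ℝ, 0 < x → ∀ w : ℂ, s ≤ w.re → w.re ≤ t → ‖(x : ℂ) ^ w * g x‖ ≤ bound x := by
  obtain ⟨m, hm⟩ := exists_nat_gt (t + b + 1)
  obtain ⟨C, -, hC⟩ := hg.bound m
  refine ⟨_, ?_, fun x hx w h1 h2 => norm_cpow_mul_le hx (hC x hx) h1 h2⟩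
  exact ((integrableOn_rpow_mul_one_add hs (by linarith)).add
    (integrableOn_rpow_mul_one_add (by linarith) (by linarith))).const_mul C

theorem RapidBound.aestronglyMeasurable {b : ℝ} {g : ℝ → ℂ} (hg : RapidBound b g) (w : ℂ) :
    AEStronglyMeasurable (fun x : ℝ => (x : ℂ) ^ w * g x) (volume.restrict (Set.Ioi 0)) := by
  refine ContinuousOn.aestronglyMeasurable (ContinuousOn.mul ?_ hg.cont) measurableSet_Ioi
  refine ContinuousOn.congr (f := fun x : ℝ => Complex.exp (w * logAbs x)) ?_
    fun x hx => cpow_eq_exp_logAbs hx w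
  intro x hx
  exact ((continuousAt_const.mul (hasDerivAt_logAbs (ne_of_gt hx)).continuousAt).cexp).continuousWithinAt

theorem mellin_holomorphic {g : ℝ → ℂ} {x : ℝ} (hx : 0 < x) (U : Set ℂ) :
    DifferentiableOn ℂ (fun w => (x : ℂ) ^ w * g x) U := by
  simp only [cpow_eq_exp_logAbs hx]
  fun_prop

theorem isOpen_re_strip (s t : ℝ) : IsOpen {w : ℂ | s < w.re ∧ w.re < t} :=
  (isOpen_lt continuous_const Complex.continuous_re).inter
    (isOpen_lt Complex.continuous_re continuous_const)

theorem RapidBound.iteratedDeriv_mellinIoi {b : ℝ} {g : ℝ → ℂ} (hg : RapidBound b g) {w : ℂ}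
    (hw : -1 < w.re + b) (l : ℕ) :
    IntegrableOn (fun x => logPow logAbs w l x * g x) (Set.Ioi 0) ∧
      iteratedDeriv l (mellinIoi g) w = ∫ x in Set.Ioi (0 : ℝ), logPow logAbs w l x * g x := by
  obtain ⟨s, hs1, hs2⟩ := exists_between (show -1 - b < w.re by linarith)
  obtain ⟨bound, hbi, hb⟩ := hg.exists_dominating (s := s) (t := w.re + 1) (by linarith)
    (by linarith)
  have key := iteratedDeriv_integral_of_holomorphic l (isOpen_re_strip s (w.re + 1))
    (F := fun w x => (x : ℂ) ^ w * g x) (μ := volume.restrict (Set.Ioi (0 : ℝ)))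
    (fun w _ => hg.aestronglyMeasurable w)
    ((ae_restrict_mem measurableSet_Ioi).mono fun x hx => mellin_holomorphic hx _)
    ((ae_restrict_mem measurableSet_Ioi).mono fun x hx v hv => hb x hx v hv.1.le hv.2.le) hbi
    (w := w) ⟨hs2, by linarith⟩
  have e : ∀ᵐ x : ℝ ∂(volume.restrict (Set.Ioi (0 : ℝ))),
      iteratedDeriv l (fun w => (x : ℂ) ^ w * g x) w = logPow logAbs w l x * g x := by
    filter_upwards [ae_restrict_mem measurableSet_Ioi] with x hx
    simp only [cpow_eq_exp_logAbs hx]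
    exact iteratedDeriv_exp_mul_const l _ _ _
  exact ⟨(integrable_congr e).1 key.1, key.2.trans (integral_congr_ae e)⟩

theorem RapidBound.differentiableOn_mellinIoi {b : ℝ} {g : ℝ → ℂ} (hg : RapidBound b g) :
    DifferentiableOn ℂ (mellinIoi g) {w | -1 - b < w.re} := by
  intro w hw
  have hw : -1 - b < w.re := hw
  obtain ⟨s, hs1, hs2⟩ := exists_between hw
  obtain ⟨bound, hbi, hb⟩ := hg.exists_dominating (s := s) (t := w.re + 1) (by linarith)
    (by linarith)
  have key := differentiableOn_integral_of_holomorphic (isOpen_re_strip s (w.re + 1))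
    (F := fun w x => (x : ℂ) ^ w * g x) (μ := volume.restrict (Set.Ioi (0 : ℝ)))
    (fun w _ => hg.aestronglyMeasurable w)
    ((ae_restrict_mem measurableSet_Ioi).mono fun x hx => mellin_holomorphic hx _)
    ((ae_restrict_mem measurableSet_Ioi).mono fun x hx v hv => hb x hx v hv.1.le hv.2.le) hbi
  exact (key.differentiableAt ((isOpen_re_strip s (w.re + 1)).mem_nhds
    ⟨hs2, by linarith⟩)).differentiableWithinAt

theorem RapidBound.integrableOn_cpow_mul {b : ℝ} {g : ℝ → ℂ} (hg : RapidBound b g) {w : ℂ}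
    (hw : -1 < w.re + b) : IntegrableOn (fun x : ℝ => (x : ℂ) ^ w * g x) (Set.Ioi 0) := by
  refine (hg.iteratedDeriv_mellinIoi hw 0).1.congr_fun (fun x hx => ?_) measurableSet_Ioi
  simp only [cpow_eq_exp_logAbs hx, logPow, pow_zero, mul_one]

/-! ### Schwartz functions on the half-line -/

/-- The iterated derivative of Schwartz functions. -/
def iterDerivS (n : ℕ) : 𝓢(ℝ, ℂ) →L[ℂ] 𝓢(ℝ, ℂ) := (SchwartzMap.derivCLM ℂ ℂ) ^ n

theorem iterDerivS_coe (n : ℕ) (ψ : 𝓢(ℝ, ℂ)) : ⇑(iterDerivS n ψ) = iteratedDeriv n ψ := by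
  induction n with
  | zero => simp [iterDerivS]
  | succ n ih =>
    rw [iteratedDeriv_succ, ← ih, iterDerivS, pow_succ']
    rfl

theorem norm_schwartz_le (ψ : 𝓢(ℝ, ℂ)) (m : ℕ) {x : ℝ} (hx : 0 < x) :
    ‖ψ x‖ ≤ 2 ^ m * (Finset.Iic (m, 0)).sup (schwartzSeminormFamily ℂ ℝ ℂ) ψ *
      (1 + x) ^ (-(m : ℝ)) := by
  have := SchwartzMap.one_add_le_sup_seminorm_apply (𝕜 := ℂ) (m := (m, 0)) (k := m) (n := 0) le_rfl
    le_rfl ψ x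
  rw [norm_iteratedFDeriv_zero, Real.norm_of_nonneg hx.le] at this
  rw [Real.rpow_neg (by positivity), Real.rpow_natCast, ← div_eq_mul_inv,
    le_div_iff₀ (by positivity), mul_comm]
  exact this

theorem rapidBound_schwartz (ψ : 𝓢(ℝ, ℂ)) : RapidBound 0 ψ where
  cont := ψ.continuous.continuousOn
  bound m := by
    refine ⟨2 ^ m * (Finset.Iic (m, 0)).sup (schwartzSeminormFamily ℂ ℝ ℂ) ψ,
      mul_nonneg (by positivity) (apply_nonneg _ _), fun x hx => ?_⟩
    rw [Real.rpow_zero, one_mul]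
    exact norm_schwartz_le ψ m hx

theorem RapidBound.tendsto_cpow_mul_zero {b : ℝ} {g : ℝ → ℂ} (hg : RapidBound b g) {w : ℂ}
    (hw : 0 < w.re + b) : Tendsto (fun x : ℝ => (x : ℂ) ^ w * g x) (𝓝[>] 0) (𝓝 0) := by
  obtain ⟨C, hC0, hC⟩ := hg.bound 0
  have hlim : Tendsto (fun x : ℝ => C * x ^ (w.re + b)) (𝓝[>] 0) (𝓝 0) := by
    have := (Real.continuousAt_rpow_const 0 (w.re + b) (Or.inr hw.le)).tendsto
    rw [Real.zero_rpow hw.ne'] at this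
    simpa using (this.mono_left nhdsWithin_le_nhds).const_mul C
  refine squeeze_zero_norm' ?_ hlim
  filter_upwards [self_mem_nhdsWithin] with x hx
  have hx : 0 < x := hx
  have h := hC x hx
  rw [Nat.cast_zero, neg_zero, Real.rpow_zero, mul_one] at h
  rw [norm_mul, Complex.norm_cpow_eq_rpow_re_of_pos hx, Real.rpow_add hx]
  calc _ ≤ x ^ w.re * (C * x ^ b) := mul_le_mul_of_nonneg_left h (Real.rpow_nonneg hx.le _)
    _ = _ := by ring

theorem RapidBound.tendsto_cpow_mul_atTop {b : ℝ} {g : ℝ → ℂ} (hg : RapidBound b g) (w : ℂ) :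
    Tendsto (fun x : ℝ => (x : ℂ) ^ w * g x) atTop (𝓝 0) := by
  obtain ⟨m, hm⟩ := exists_nat_gt (w.re + b)
  obtain ⟨C, hC0, hC⟩ := hg.bound m
  have hlim : Tendsto (fun x : ℝ => C * x ^ (-(m - (w.re + b)))) atTop (𝓝 0) := by
    simpa using (tendsto_rpow_neg_atTop (sub_pos.2 hm)).const_mul C
  refine squeeze_zero_norm' ?_ hlim
  filter_upwards [eventually_gt_atTop 0] with x hx
  rw [norm_mul, Complex.norm_cpow_eq_rpow_re_of_pos hx]
  have h1 : (1 + x) ^ (-(m : ℝ)) ≤ x ^ (-(m : ℝ)) :=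
    Real.rpow_le_rpow_of_nonpos hx (by linarith) (by simp)
  calc _ ≤ x ^ w.re * (C * (x ^ b * x ^ (-(m : ℝ)))) := by
        refine mul_le_mul_of_nonneg_left ((hC x hx).trans ?_) (Real.rpow_nonneg hx.le _)
        exact mul_le_mul_of_nonneg_left
          (mul_le_mul_of_nonneg_left h1 (Real.rpow_nonneg hx.le _)) hC0
    _ = _ := by
      rw [neg_sub, sub_eq_add_neg, Real.rpow_add hx, Real.rpow_add hx]; ring

/-- Integration by parts; the boundary term `x ^ (v + 1) * g x` vanishes at zero because `Re v >
-1`. This is the recursion that makes `rieszPlus` independent of the number of derivatives. -/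
theorem mellinIoi_deriv {g g' : ℝ → ℂ} (hg : RapidBound 0 g) (hg' : RapidBound 0 g')
    (hd : ∀ x, 0 < x → HasDerivAt g (g' x) x) {v : ℂ} (hv : -1 < v.re) :
    mellinIoi g' (v + 1) = -((v + 1) * mellinIoi g v) := by
  have hv1 : 0 < (v + 1).re := by simp; linarith
  have hu : ∀ x ∈ Set.Ioi (0 : ℝ), HasDerivAt (fun x : ℝ => (x : ℂ) ^ (v + 1))
      ((v + 1) * (x : ℂ) ^ v) x := by
    intro x hx
    have hx : 0 < x := hx
    have h := hasDerivAt_logPow (hasDerivAt_logAbs hx.ne') (v + 1) 0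
    refine (h.congr_of_eventuallyEq ?_).congr_deriv ?_
    · filter_upwards [lt_mem_nhds hx] with y hy
      rw [cpow_eq_exp_logAbs hy, logPow, pow_zero, mul_one]
    · have hx0 : (x : ℂ) ≠ 0 := by exact_mod_cast hx.ne'
      rw [logPow, pow_zero, mul_one, ← cpow_eq_exp_logAbs hx, Complex.cpow_add _ _ hx0,
        Complex.cpow_one, Nat.cast_zero, zero_mul, add_zero]
      field_simp
  have h := integral_Ioi_mul_deriv_eq_deriv_mul hu (fun x hx => hd x hx)
    (hg'.integrableOn_cpow_mul (by simpa using (by linarith : -1 < v.re + 1)))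
    (by
      have := (hg.integrableOn_cpow_mul (w := v) (by linarith)).const_mul (v + 1)
      simpa only [Pi.mul_def, mul_assoc] using! this)
    (hg.tendsto_cpow_mul_zero (by linarith)) (hg.tendsto_cpow_mul_atTop (v + 1))
  rw [mellinIoi, h, mellinIoi, sub_zero, zero_sub, ← integral_const_mul]
  simp only [mul_assoc]

/-! ### The homogeneous distributions -/

/-- The normalizing factor of `rieszPlus`. -/
def rieszCoeff (n : ℕ) (w : ℂ) : ℂ := (-1) ^ n / ∏ i ∈ Finset.range n, (w + (i + 1))

theorem rieszPlus_eq (n : ℕ) (w : ℂ) (φ : ℝ → ℂ) :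
    rieszPlus n w φ = rieszCoeff n w * mellinIoi (iteratedDeriv n φ) (w + n) := rfl

theorem rapidBound_iteratedDeriv (ψ : 𝓢(ℝ, ℂ)) (n : ℕ) : RapidBound 0 (iteratedDeriv n ψ) := by
  rw [← iterDerivS_coe]
  exact rapidBound_schwartz _

theorem rieszPlus_succ (ψ : 𝓢(ℝ, ℂ)) {n : ℕ} {w : ℂ} (hw : -1 < w.re + n) :
    rieszPlus (n + 1) w ψ = rieszPlus n w ψ := by
  have hne : w + (n + 1) ≠ 0 := by
    intro h
    have := congrArg Complex.re h
    simp at this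
    linarith
  have h := mellinIoi_deriv (rapidBound_iteratedDeriv ψ n) (rapidBound_iteratedDeriv ψ (n + 1))
    (fun x _ => by
      rw [iteratedDeriv_succ, ← iterDerivS_coe]
      exact (iterDerivS n ψ).hasDerivAt x) (v := w + n) (by simpa using hw)
  rw [rieszPlus_eq, rieszPlus_eq, rieszCoeff, rieszCoeff, Finset.prod_range_succ]
  push_cast
  rw [← add_assoc w, h, pow_succ, add_assoc w]
  -- At a pole the denominators of both sides vanish, and division by zero makes both sides zero.
  rcases eq_or_ne (∏ i ∈ Finset.range n, (w + (i + 1 : ℂ))) 0 with h0 | h0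
  · simp [h0]
  · field_simp

theorem rieszPlus_eq_mellinIoi (ψ : 𝓢(ℝ, ℂ)) (n : ℕ) {w : ℂ} (hw : -1 < w.re) :
    rieszPlus n w ψ = mellinIoi ψ w := by
  induction n with
  | zero => simp [rieszPlus_eq, rieszCoeff]
  | succ n ih =>
    rw [rieszPlus_succ ψ (by have := (Nat.cast_nonneg n : (0 : ℝ) ≤ n); linarith), ih]

/-- In `logHom` the number of derivatives is frozen at `⌈-p.re⌉₊` while the exponent varies;
strictness of this inequality keeps the integral convergent for exponents near `p`. -/
theorem neg_one_lt_re_add_ceil (p : ℂ) : -1 < p.re + (⌈-p.re⌉₊ : ℝ) := by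
  linarith [Nat.le_ceil (-p.re)]

theorem rieszCoeff_den_ne_zero {p : ℂ} (hp : ∀ n : ℕ, p ≠ -((n : ℂ) + 1)) (n : ℕ) :
    ∏ i ∈ Finset.range n, (p + (i + 1 : ℂ)) ≠ 0 :=
  Finset.prod_ne_zero_iff.2 fun i _ h => hp i (eq_neg_of_add_eq_zero_left h)

theorem contDiffAt_rieszCoeff {p : ℂ} (hp : ∀ n : ℕ, p ≠ -((n : ℂ) + 1)) (n : ℕ) (k : WithTop ℕ∞) :
    ContDiffAt ℂ k (rieszCoeff n) p := by
  refine contDiffAt_const.div ?_ (rieszCoeff_den_ne_zero hp n)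
  exact contDiffAt_prod fun i _ => contDiffAt_id.add contDiffAt_const

theorem RapidBound.contDiffAt_mellinIoi {b : ℝ} {g : ℝ → ℂ} (hg : RapidBound b g) {w : ℂ}
    (hw : -1 < w.re + b) (k : WithTop ℕ∞) : ContDiffAt ℂ k (mellinIoi g) w := by
  have ho : IsOpen {w : ℂ | -1 - b < w.re} := isOpen_lt continuous_const Complex.continuous_re
  exact (hg.differentiableOn_mellinIoi.contDiffOn ho).contDiffAt
    (ho.mem_nhds (show -1 - b < w.re by linarith))

theorem RapidBound.contDiffAt_mellinIoi_add {g : ℝ → ℂ} (hg : RapidBound 0 g) {w : ℂ} {n : ℕ}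
    (hw : -1 < w.re + n) (k : WithTop ℕ∞) : ContDiffAt ℂ k (fun w => mellinIoi g (w + n)) w := by
  have h := hg.contDiffAt_mellinIoi (w := w + n) (by simpa using hw) k
  exact ContDiffAt.comp (g := mellinIoi g) (f := fun w : ℂ => w + n) w h
    (contDiffAt_id.add contDiffAt_const)

/-- Leibniz' formula for `x_+^p ln^k x`. -/
theorem logHom_eq_sum {p : ℂ} (hp : ∀ n : ℕ, p ≠ -((n : ℂ) + 1)) (k : ℕ) (ψ : 𝓢(ℝ, ℂ)) :
    logHom p k ψ = ∑ i ∈ Finset.range (k + 1), k.choose i *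
      iteratedDeriv i (rieszCoeff ⌈-p.re⌉₊) p *
        ∫ x in Set.Ioi (0 : ℝ), logPow logAbs (p + ⌈-p.re⌉₊) (k - i) x *
          iterDerivS ⌈-p.re⌉₊ ψ x := by
  have hr := rapidBound_schwartz (iterDerivS ⌈-p.re⌉₊ ψ)
  have hw := neg_one_lt_re_add_ceil p
  have e : (fun w => rieszPlus ⌈-p.re⌉₊ w ψ) = fun w => rieszCoeff ⌈-p.re⌉₊ w *
      mellinIoi (iterDerivS ⌈-p.re⌉₊ ψ) (w + ⌈-p.re⌉₊) := by
    ext w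
    rw [rieszPlus_eq, iterDerivS_coe]
  rw [logHom, e, iteratedDeriv_fun_mul (contDiffAt_rieszCoeff hp _ _)
    (hr.contDiffAt_mellinIoi_add hw _)]
  refine Finset.sum_congr rfl fun i _ => ?_
  congr 1
  rw [iteratedDeriv_comp_add_const (k - i) (mellinIoi (iterDerivS ⌈-p.re⌉₊ ψ)) (⌈-p.re⌉₊ : ℂ)]
  exact (hr.iteratedDeriv_mellinIoi (w := p + ⌈-p.re⌉₊) (by simpa using hw) (k - i)).2

/-- All exponents near `p` still have real part above `-1`, where `rieszPlus` is the plain Mellin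
integral; differentiating it brings down the logarithms. -/
theorem logHom_eq_integral {p : ℂ} (hp : -1 < p.re) (k : ℕ) (ψ : 𝓢(ℝ, ℂ)) :
    logHom p k ψ = ∫ x in Set.Ioi (0 : ℝ), logPow logAbs p k x * ψ x := by
  rw [← ((rapidBound_schwartz ψ).iteratedDeriv_mellinIoi (w := p) (by simpa using hp) k).2, logHom]
  refine Filter.EventuallyEq.iteratedDeriv_eq k ?_
  filter_upwards [(isOpen_lt continuous_const Complex.continuous_re).mem_nhds hp] with w hw
  exact rieszPlus_eq_mellinIoi ψ _ hw

theorem integrableOn_logPow_mul_schwartz {p : ℂ} (hp : -1 < p.re) (k : ℕ) (ψ : 𝓢(ℝ, ℂ)) :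
    IntegrableOn (fun x => logPow logAbs p k x * ψ x) (Set.Ioi 0) :=
  ((rapidBound_schwartz ψ).iteratedDeriv_mellinIoi (w := p) (by simpa using hp) k).1

/-! ### Regular distributions on the half-line -/

theorem aestronglyMeasurable_of_integrableOn_mul {h : ℝ → ℂ} {m : ℕ}
    (hh : IntegrableOn (fun x : ℝ => h x * ((1 + x) ^ (-(m : ℝ)) : ℝ)) (Set.Ioi 0)) :
    AEStronglyMeasurable h (volume.restrict (Set.Ioi 0)) := by
  have h1 : AEStronglyMeasurable (fun x : ℝ => (((1 + x) ^ (m : ℝ) : ℝ) : ℂ))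
      (volume.restrict (Set.Ioi 0)) := by
    refine Measurable.aestronglyMeasurable ?_
    fun_prop
  refine (hh.aestronglyMeasurable.mul h1).congr ?_
  filter_upwards [ae_restrict_mem measurableSet_Ioi] with x hx
  have hx : 0 < x := hx
  rw [Pi.mul_apply, mul_assoc, ← Complex.ofReal_mul, ← Real.rpow_add (by linarith)]
  simp

theorem integrableOn_mul_schwartz {h : ℝ → ℂ} {m : ℕ}
    (hh : IntegrableOn (fun x : ℝ => h x * ((1 + x) ^ (-(m : ℝ)) : ℝ)) (Set.Ioi 0)) (ψ : 𝓢(ℝ, ℂ)) :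
    IntegrableOn (fun x => h x * ψ x) (Set.Ioi 0) := by
  refine (hh.norm.const_mul
    (2 ^ m * (Finset.Iic (m, 0)).sup (schwartzSeminormFamily ℂ ℝ ℂ) ψ)).mono'
    ((aestronglyMeasurable_of_integrableOn_mul hh).mul ψ.continuous.aestronglyMeasurable) ?_
  filter_upwards [ae_restrict_mem measurableSet_Ioi] with x hx
  have hx : 0 < x := hx
  rw [norm_mul, norm_mul, Complex.norm_real, Real.norm_of_nonneg (Real.rpow_nonneg (by linarith) _)]
  calc _ ≤ _ := mul_le_mul_of_nonneg_left (norm_schwartz_le ψ m hx) (norm_nonneg _)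
    _ = _ := by ring

/-- The distribution on the half-line given by a locally integrable function of polynomial growth. -/
theorem exists_clm_integral_Ioi {h : ℝ → ℂ} {m : ℕ}
    (hh : IntegrableOn (fun x : ℝ => h x * ((1 + x) ^ (-(m : ℝ)) : ℝ)) (Set.Ioi 0)) :
    ∃ T : 𝓢(ℝ, ℂ) →L[ℂ] ℂ, ∀ ψ : 𝓢(ℝ, ℂ), T ψ = ∫ x in Set.Ioi (0 : ℝ), h x * ψ x := by
  refine ⟨SchwartzMap.mkCLMtoNormedSpace (σ := RingHom.id ℂ)
    (fun ψ => ∫ x in Set.Ioi (0 : ℝ), h x * ψ x) (fun f g => ?_) (fun a f => ?_)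
    ⟨Finset.Iic (m, 0), (∫ x in Set.Ioi (0 : ℝ), ‖h x * ((1 + x) ^ (-(m : ℝ)) : ℝ)‖) * 2 ^ m,
      mul_nonneg (integral_nonneg fun x => norm_nonneg _) (by positivity), fun f => ?_⟩,
    fun ψ => rfl⟩
  · simp only [add_apply, mul_add]
    exact integral_add (integrableOn_mul_schwartz hh f) (integrableOn_mul_schwartz hh g)
  · simp only [smul_apply, smul_eq_mul, RingHom.id_apply, ← integral_const_mul]
    congr 1
    ext x
    ring
  · refine (norm_integral_le_integral_norm _).trans ?_
    rw [mul_assoc, ← integral_mul_const]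
    refine setIntegral_mono_on (integrableOn_mul_schwartz hh f).norm (hh.norm.mul_const _)
      measurableSet_Ioi fun x hx => ?_
    have hx : 0 < x := hx
    rw [norm_mul, norm_mul, Complex.norm_real,
      Real.norm_of_nonneg (Real.rpow_nonneg (by linarith) _)]
    calc _ ≤ _ := mul_le_mul_of_nonneg_left (norm_schwartz_le f m hx) (norm_nonneg _)
      _ = _ := by ring

theorem exists_integrableOn_mul_one_add {h : ℝ → ℂ} {s b : ℝ} (hh : ContinuousOn h (Set.Ioi 0))
    (hs : -1 < s) (hsb : s ≤ b) (h0 : h =O[𝓝[>] 0] fun x => |x| ^ s)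
    (hi : h =O[atTop] fun x => |x| ^ b) : ∃ m : ℕ,
    IntegrableOn (fun x : ℝ => h x * ((1 + x) ^ (-(m : ℝ)) : ℝ)) (Set.Ioi 0) := by
  obtain ⟨C, hC0, hC⟩ := exists_bound_Ioi (g := h) (a := s) (b := b) hh (by
      refine h0.congr' EventuallyEq.rfl ?_
      filter_upwards [self_mem_nhdsWithin] with x hx
      rw [abs_of_pos hx]) (by
      refine hi.congr' EventuallyEq.rfl ?_
      filter_upwards [eventually_gt_atTop 0] with x hx
      rw [abs_of_pos hx])
  obtain ⟨m, hm⟩ := exists_nat_gt (b + 1)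
  refine ⟨m, (((integrableOn_rpow_mul_one_add hs (m := m) (by linarith)).add
    (integrableOn_rpow_mul_one_add (a := b) (m := m) (by linarith)
      (by linarith))).const_mul C).mono' ?_ ?_⟩
  · refine ContinuousOn.aestronglyMeasurable (hh.mul ?_) measurableSet_Ioi
    refine Complex.continuous_ofReal.comp_continuousOn ?_
    refine ContinuousOn.rpow_const (by fun_prop) fun x hx => Or.inl ?_
    have hx : 0 < x := hx
    positivity
  · filter_upwards [ae_restrict_mem measurableSet_Ioi] with x hx
    have hx : 0 < x := hx
    have h1 : 0 ≤ (1 + x) ^ (-(m : ℝ)) := Real.rpow_nonneg (by linarith) _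
    rw [norm_mul, Complex.norm_real, Real.norm_of_nonneg h1]
    refine (mul_le_mul_of_nonneg_right (hC x hx) h1).trans (le_of_eq ?_)
    simp only [Pi.add_apply]
    ring

theorem isLogOn_logAbs_Ioi : IsLogOn logAbs (Set.Ioi 0) :=
  isLogOn_logAbs.mono isOpen_Ioi fun _ hx => ne_of_gt hx

theorem continuousOn_logPow (p : ℂ) (k : ℕ) : ContinuousOn (logPow logAbs p k) (Set.Ioi 0) :=
  fun _ hx => (isLogOn_logAbs_Ioi.contDiffAt_logPow hx p k).continuousAt.continuousWithinAt

theorem isSymbol_logPow_zero {s : ℝ} {p : ℂ} (hs : s < p.re) (k : ℕ) :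
    IsSymbol (𝓝[>] 0) s (logPow logAbs p k) := by
  have := isLogOn_logAbs_Ioi.isSymbol_logPow self_mem_nhdsWithin
    (logBound_nhdsGT (sub_pos.2 hs)) p k
  rwa [neg_sub, add_sub_cancel] at this

theorem isSymbol_logPow_atTop {s : ℝ} {p : ℂ} (hs : p.re < s) (k : ℕ) :
    IsSymbol atTop s (logPow logAbs p k) := by
  have := isLogOn_logAbs_Ioi.isSymbol_logPow (Ioi_mem_atTop 0) (logBound_atTop (sub_pos.2 hs)) p k
  rwa [add_sub_cancel] at this

theorem IsSymbol.isBigO {F : Filter ℝ} {α : ℝ} {g : ℝ → ℂ} (hg : IsSymbol F α g) :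
    g =O[F] fun x => |x| ^ α := by
  simpa using hg.bound 0

theorem integrableOn_logPow_mul_one_add {p : ℂ} (hp : -1 < p.re) (k : ℕ) : ∃ m : ℕ,
    IntegrableOn (fun x : ℝ => logPow logAbs p k x * ((1 + x) ^ (-(m : ℝ)) : ℝ)) (Set.Ioi 0) := by
  obtain ⟨s, hs1, hs2⟩ := exists_between hp
  exact exists_integrableOn_mul_one_add (continuousOn_logPow p k) hs1 (b := p.re + 1)
    (by linarith) (isSymbol_logPow_zero hs2 k).isBigO
    (isSymbol_logPow_atTop (lt_add_one _) k).isBigO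

/-- `x_+^p ln^k x` is a tempered distribution. -/
theorem exists_clm_logHom {p : ℂ} (hp : ∀ n : ℕ, p ≠ -((n : ℂ) + 1)) (k : ℕ) :
    ∃ T : 𝓢(ℝ, ℂ) →L[ℂ] ℂ, ∀ ψ : 𝓢(ℝ, ℂ), T ψ = logHom p k ψ := by
  have hre : -1 < (p + (⌈-p.re⌉₊ : ℂ)).re := by simpa using neg_one_lt_re_add_ceil p
  choose T hT using fun i : ℕ =>
    exists_clm_integral_Ioi (integrableOn_logPow_mul_one_add hre (k - i)).choose_spec
  refine ⟨∑ i ∈ Finset.range (k + 1), ((k.choose i : ℂ) *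
      iteratedDeriv i (rieszCoeff ⌈-p.re⌉₊) p) • (T i).comp (iterDerivS ⌈-p.re⌉₊), fun ψ => ?_⟩
  rw [logHom_eq_sum hp, sum_apply]
  refine Finset.sum_congr rfl fun i _ => ?_
  rw [smul_apply, ContinuousLinearMap.comp_apply, hT, smul_eq_mul]

/-- All derivatives of `φ` vanish on the open half-line, hence so does `rieszPlus` for every
exponent. This gives the support condition for extensions. -/
theorem logHom_eq_zero {p : ℂ} {k : ℕ} {φ : ℝ → ℂ} (hφ : ∀ x, 0 < x → φ x = 0) :
    logHom p k φ = 0 := by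
  have h : ∀ w, rieszPlus ⌈-p.re⌉₊ w φ = 0 := fun w => by
    rw [rieszPlus, setIntegral_eq_zero_of_forall_eq_zero, mul_zero]
    intro x hx
    have : Set.EqOn φ (fun _ => 0) (Set.Ioi 0) := fun x hx => hφ x hx
    rw [this.iteratedDeriv_of_isOpen isOpen_Ioi _ hx, iteratedDeriv_fun_const_zero, mul_zero]
  rw [logHom, show (fun w => rieszPlus ⌈-p.re⌉₊ w φ) = fun _ => 0 from funext h,
    iteratedDeriv_fun_const_zero]

/-! ### The Gamma integral with a complex rate -/

theorem one_add_rpow_neg_mul_exp_le {δ : ℝ} (hδ : 0 < δ) (m : ℕ) {x : ℝ} (hx : 0 < x) :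
    Real.exp (-(δ * x)) ≤ m.factorial * Real.exp δ / δ ^ m * (1 + x) ^ (-(m : ℝ)) := by
  have h := Real.pow_div_factorial_le_exp (δ * (1 + x)) (by positivity) m
  rw [Real.rpow_neg (by positivity), Real.rpow_natCast, ← div_eq_mul_inv,
    le_div_iff₀ (by positivity), le_div_iff₀ (by positivity)]
  rw [div_le_iff₀ (by positivity), mul_pow, mul_add, mul_one, Real.exp_add] at h
  calc Real.exp (-(δ * x)) * (1 + x) ^ m * δ ^ m
      = Real.exp (-(δ * x)) * (δ ^ m * (1 + x) ^ m) := by ring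
    _ ≤ Real.exp (-(δ * x)) * (Real.exp δ * Real.exp (δ * x) * m.factorial) :=
        mul_le_mul_of_nonneg_left h (Real.exp_pos _).le
    _ = m.factorial * Real.exp δ * (Real.exp (-(δ * x)) * Real.exp (δ * x)) := by ring
    _ = _ := by rw [← Real.exp_add, neg_add_cancel, Real.exp_zero, mul_one]

theorem rapidBound_exp {s : ℂ} (hs : 0 < s.re) :
    RapidBound 0 (fun x : ℝ => Complex.exp (-(s * x))) where
  cont := by fun_prop
  bound m := by
    refine ⟨m.factorial * Real.exp s.re / s.re ^ m, by positivity, fun x hx => ?_⟩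
    rw [Real.rpow_zero, one_mul, Complex.norm_exp]
    simpa using one_add_rpow_neg_mul_exp_le hs m hx

theorem differentiableOn_mellinIoi_exp {v : ℂ} (hv : -1 < v.re) :
    DifferentiableOn ℂ (fun s => mellinIoi (fun x : ℝ => Complex.exp (-(s * x))) v)
      {s | 0 < s.re} := by
  intro s hs
  have hs : 0 < s.re := hs
  -- On this smaller half-plane `exp (-(s.re / 2) * x)` dominates all the exponentials.
  have ho : IsOpen {z : ℂ | s.re / 2 < z.re} := isOpen_lt continuous_const Complex.continuous_re
  obtain ⟨bound, hbi, hb⟩ := (rapidBound_exp (s := ((s.re / 2 : ℝ) : ℂ))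
    (by simpa using hs)).exists_dominating (s := v.re) (t := v.re) (by simpa using hv) le_rfl
  have key := differentiableOn_integral_of_holomorphic ho
    (F := fun s x => (x : ℂ) ^ v * Complex.exp (-(s * x))) (μ := volume.restrict (Set.Ioi (0 : ℝ)))
    (fun z hz => (rapidBound_exp (s := z)
      ((half_pos hs).trans hz)).aestronglyMeasurable v)
    (Eventually.of_forall fun x => by fun_prop)
    ((ae_restrict_mem measurableSet_Ioi).mono fun x hx z hz => by
      have hx : 0 < x := hx
      have hz : s.re / 2 < z.re := hz
      refine le_trans ?_ (hb x hx v le_rfl le_rfl)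
      rw [norm_mul, norm_mul]
      refine mul_le_mul_of_nonneg_left ?_ (norm_nonneg _)
      rw [Complex.norm_exp, Complex.norm_exp, Real.exp_le_exp]
      simp only [Complex.neg_re, Complex.mul_re, Complex.ofReal_re, Complex.ofReal_im, mul_zero,
        sub_zero, neg_le_neg_iff]
      exact mul_le_mul_of_nonneg_right hz.le hx.le) hbi
  exact (key.differentiableAt (ho.mem_nhds (half_lt_self hs))).differentiableWithinAt

/-- For real `s > 0` this is the classical Gamma integral. Both sides are holomorphic in the right
half-plane and agree at the points `1 + 1 / (n + 1)`, which accumulate at `1`. -/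
theorem mellinIoi_exp {v s : ℂ} (hv : -1 < v.re) (hs : 0 < s.re) :
    mellinIoi (fun x : ℝ => Complex.exp (-(s * x))) v =
      Complex.Gamma (v + 1) * Complex.exp (-((v + 1) * Complex.log s)) := by
  have ho : IsOpen {s : ℂ | 0 < s.re} := isOpen_lt continuous_const Complex.continuous_re
  have hconv : Convex ℝ {s : ℂ | 0 < s.re} := convex_halfSpace_re_gt 0
  have h1 := (differentiableOn_mellinIoi_exp hv).analyticOnNhd ho
  have h2 : AnalyticOnNhd ℂ (fun s => Complex.Gamma (v + 1) *
      Complex.exp (-((v + 1) * Complex.log s))) {s | 0 < s.re} := by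
    refine DifferentiableOn.analyticOnNhd (fun s hs => ?_) ho
    exact (((((Complex.differentiableAt_log (Or.inl hs)).const_mul
      (v + 1)).neg).cexp).const_mul _).differentiableWithinAt
  refine h1.eqOn_of_preconnected_of_frequently_eq h2 hconv.isPreconnected (z₀ := 1) (by simp) ?_ hs
  have hlim : Tendsto (fun n : ℕ => ((1 + 1 / ((n : ℝ) + 1) : ℝ) : ℂ)) atTop (𝓝[≠] 1) := by
    refine tendsto_nhdsWithin_iff.2 ⟨?_, Eventually.of_forall fun n => ?_⟩
    · have := (tendsto_one_div_add_atTop_nhds_zero_nat (𝕜 := ℝ)).const_add 1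
      rw [add_zero] at this
      simpa [Function.comp_def] using (Complex.continuous_ofReal.tendsto 1).comp this
    · have : (1 + 1 / ((n : ℝ) + 1)) ≠ 1 := by
        have : 0 < 1 / ((n : ℝ) + 1) := by positivity
        linarith
      exact Complex.ofReal_ne_one.2 this
  refine hlim.frequently (Frequently.of_forall fun n => ?_)
  set r : ℝ := 1 + 1 / ((n : ℝ) + 1)
  have hr : 0 < r := by positivity
  have := Complex.integral_cpow_mul_exp_neg_mul_Ioi (a := v + 1) (r := r) (by simp; linarith) hr
  rw [add_sub_cancel_right] at this
  rw [mellinIoi, this, mul_comm, Complex.cpow_def_of_ne_zero (by simpa using hr.ne'), one_div,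
    Complex.log_inv _ (by rw [Complex.arg_ofReal_of_nonneg hr.le]; exact Real.pi_pos.ne)]
  ring_nf

/-! ### Derivatives of `Γ(w) exp (-w L)` in `w` -/

/-- The `l`-th derivative of `w ↦ γ(w) exp (-w L)` at `z`. -/
def derivExp (l : ℕ) (γ : ℂ → ℂ) (z L : ℂ) : ℂ :=
  iteratedDeriv l (fun w => γ w * Complex.exp (-(w * L))) z

theorem derivExp_congr {l : ℕ} {γ γ' : ℂ → ℂ} {z : ℂ} (h : γ =ᶠ[𝓝 z] γ') (L : ℂ) :
    derivExp l γ z L = derivExp l γ' z L :=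
  Filter.EventuallyEq.iteratedDeriv_eq l (h.mono fun w hw => by simp only [hw])

theorem contDiffAt_mul_exp {γ : ℂ → ℂ} {z : ℂ} (h : AnalyticAt ℂ γ z) (L : ℂ) (n : WithTop ℕ∞) :
    ContDiffAt ℂ n (fun w => γ w * Complex.exp (-(w * L))) z :=
  h.contDiffAt.mul (by fun_prop)

theorem derivExp_add {l : ℕ} {γ γ' : ℂ → ℂ} {z : ℂ} (h : AnalyticAt ℂ γ z) (h' : AnalyticAt ℂ γ' z)
    (L : ℂ) : derivExp l (fun w => γ w + γ' w) z L = derivExp l γ z L + derivExp l γ' z L := by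
  simp only [derivExp, add_mul]
  exact iteratedDeriv_fun_add (contDiffAt_mul_exp h L _) (contDiffAt_mul_exp h' L _)

theorem derivExp_succ (l : ℕ) {γ : ℂ → ℂ} {z : ℂ} (h : AnalyticAt ℂ γ z) (L : ℂ) :
    derivExp (l + 1) γ z L = derivExp l (deriv γ) z L - L * derivExp l γ z L := by
  have e : deriv (fun w => γ w * Complex.exp (-(w * L))) =ᶠ[𝓝 z] fun w =>
      deriv γ w * Complex.exp (-(w * L)) + -L * (γ w * Complex.exp (-(w * L))) := by
    filter_upwards [h.eventually_analyticAt] with w hw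
    have := hw.differentiableAt.hasDerivAt.mul (((hasDerivAt_id w).mul_const L).neg.cexp)
    refine this.deriv.trans ?_
    simp only [id, Pi.neg_apply]
    ring
  have h1 := contDiffAt_mul_exp h.deriv L l
  have h2 := contDiffAt_mul_exp h L l
  rw [derivExp, iteratedDeriv_succ', e.iteratedDeriv_eq, iteratedDeriv_fun_add h1
    (contDiffAt_const.mul h2), iteratedDeriv_const_mul_field]
  simp only [derivExp]
  ring

/-- Differentiation in `L` commutes with the `l` derivatives in `w` and brings down `-w`. Induction
on `l` over all `γ`, through `derivExp_succ`, proves this without any theorem on mixed partial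
derivatives. -/
theorem hasDerivAt_derivExp (l : ℕ) : ∀ {γ : ℂ → ℂ} {z : ℂ} (_ : AnalyticAt ℂ γ z) (L : ℂ),
    HasDerivAt (fun L => derivExp l γ z L) (-derivExp l (fun w => w * γ w) z L) L := by
  induction l with
  | zero =>
    intro γ z _ L
    simp only [derivExp, iteratedDeriv_zero]
    refine ((((hasDerivAt_id L).const_mul z).neg.cexp).const_mul (γ z)).congr_deriv ?_
    simp only [id, Pi.neg_apply]
    ring
  | succ l ih =>
    intro γ z h L
    have hid : AnalyticAt ℂ (fun w => w * γ w) z := analyticAt_id.mul h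
    have hid' : AnalyticAt ℂ (fun w => w * deriv γ w) z := analyticAt_id.mul h.deriv
    have e : deriv (fun w => w * γ w) =ᶠ[𝓝 z] fun w => γ w + w * deriv γ w := by
      filter_upwards [h.eventually_analyticAt] with w hw
      have := (hasDerivAt_id w).mul hw.differentiableAt.hasDerivAt
      refine this.deriv.trans ?_
      simp
    rw [derivExp_succ l hid, derivExp_congr e, derivExp_add h hid']
    simp only [derivExp_succ l h]
    refine ((ih h.deriv L).sub ((hasDerivAt_id L).mul (ih h L))).congr_deriv ?_
    simp only [id]
    ring

/-- Leibniz' rule: the exponential contributes powers of `-L`, the derivatives of `γ` at `z` are the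
constants. With `L` a logarithm this is a log-homogeneous function of order at most `l`. -/
theorem derivExp_eq_sum (l : ℕ) {γ : ℂ → ℂ} {z : ℂ} (h : AnalyticAt ℂ γ z) : ∃ c : ℕ → ℂ, ∀ L,
    derivExp l γ z L = ∑ i ∈ Finset.range (l + 1), c i * (Complex.exp (-z * L) * L ^ i) := by
  refine ⟨fun i => l.choose (l - i) * iteratedDeriv (l - i) γ z * (-1) ^ i, fun L => ?_⟩
  have hE : ContDiffAt ℂ l (fun w => Complex.exp (-(w * L))) z := by fun_prop
  rw [derivExp, iteratedDeriv_fun_mul h.contDiffAt hE, ← Finset.sum_range_reflect]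
  refine Finset.sum_congr rfl fun i hi => ?_
  have hi : i ≤ l := Nat.lt_succ_iff.1 (Finset.mem_range.1 hi)
  have := iteratedDeriv_exp_mul_const i (-L) 1 z
  simp only [mul_one, mul_neg] at this
  rw [Nat.add_sub_cancel, Nat.sub_sub_self hi, this, neg_pow L, neg_mul]
  ring

theorem analyticAt_Gamma {z : ℂ} (hz : ∀ n : ℕ, z ≠ -n) : AnalyticAt ℂ Complex.Gamma z := by
  have h1 : AnalyticAt ℂ (fun s => (Complex.Gamma s)⁻¹) z :=
    Complex.differentiable_one_div_Gamma.analyticAt z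
  simpa [Pi.inv_def] using h1.inv (inv_ne_zero (Complex.Gamma_ne_zero hz))

/-- The `l`-th derivative of `w ↦ Γ(w) exp (-w L)` at `z`. -/
def gammaExp (l : ℕ) (z L : ℂ) : ℂ := derivExp l Complex.Gamma z L

theorem ne_neg_nat_add {z : ℂ} (hz : ∀ n : ℕ, z ≠ -n) (k : ℕ) : ∀ n : ℕ, z + k ≠ -n := by
  intro n h
  refine hz (n + k) ?_
  push_cast
  linear_combination h

/-- Near `z` one has `w * Γ(w) = Γ(w + 1)` and `exp (-w * L) = exp L * exp (-(w + 1) * L)`. -/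
theorem gammaExp_add_one (l : ℕ) {z : ℂ} (hz : z ≠ 0) (L : ℂ) :
    derivExp l (fun w => w * Complex.Gamma w) z L = Complex.exp L * gammaExp l (z + 1) L := by
  have e : (fun w => w * Complex.Gamma w * Complex.exp (-(w * L))) =ᶠ[𝓝 z] fun w =>
      Complex.exp L * (fun w => Complex.Gamma w * Complex.exp (-(w * L))) (w + 1) := by
    filter_upwards [isOpen_ne.mem_nhds hz] with w hw
    rw [Complex.Gamma_add_one w hw, add_mul, one_mul, neg_add, Complex.exp_add]
    have : Complex.exp L * Complex.exp (-L) = 1 := by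
      rw [← Complex.exp_add, add_neg_cancel, Complex.exp_zero]
    linear_combination (-(w * Complex.Gamma w * Complex.exp (-(w * L)))) * this
  rw [derivExp, e.iteratedDeriv_eq, iteratedDeriv_const_mul_field,
    iteratedDeriv_comp_add_const l (fun w => Complex.Gamma w * Complex.exp (-(w * L)))]
  rfl

theorem hasDerivAt_gammaExp (l : ℕ) {z : ℂ} (hz : ∀ n : ℕ, z ≠ -n) (L : ℂ) :
    HasDerivAt (fun L => gammaExp l z L) (-(Complex.exp L * gammaExp l (z + 1) L)) L := by
  rw [← gammaExp_add_one l (by simpa using hz 0)]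
  exact hasDerivAt_derivExp l (analyticAt_Gamma hz) L

/-- The factor `exp L = s` cancels the `1 / s` from the derivative of the logarithm. Thus
differentiating `∂_z ^ l [Γ(z) s ^ (-z)]` in `s` only shifts `z` by one and changes the sign. -/
theorem hasDerivAt_gammaExp_log (l : ℕ) {z : ℂ} (hz : ∀ n : ℕ, z ≠ -n) {s : ℝ → ℂ} {s' : ℂ} {t : ℝ}
    (hs : HasDerivAt s s' t) (ht : s t ∈ Complex.slitPlane) :
    HasDerivAt (fun t => gammaExp l z (Complex.log (s t)))
      (-(s' * gammaExp l (z + 1) (Complex.log (s t)))) t := by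
  have h1 := (hasDerivAt_gammaExp l hz (Complex.log (s t))).comp t (hs.clog_real ht)
  refine h1.congr_deriv ?_
  have h0 := Complex.slitPlane_ne_zero ht
  rw [Complex.exp_log h0]
  field_simp

/-! ### The damped symbols and their asymptotics -/

/-- `t + i θ ξ`. -/
def lineC (θ t ξ : ℝ) : ℂ := t + Complex.I * θ * ξ

theorem lineC_re (θ t ξ : ℝ) : (lineC θ t ξ).re = t := by simp [lineC]

theorem lineC_im (θ t ξ : ℝ) : (lineC θ t ξ).im = θ * ξ := by simp [lineC]

theorem lineC_mem_slitPlane {θ t ξ : ℝ} (h : 0 < t ∨ θ * ξ ≠ 0) :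
    lineC θ t ξ ∈ Complex.slitPlane := by
  rw [Complex.mem_slitPlane_iff, lineC_re, lineC_im]
  exact h

theorem hasDerivAt_lineC_left (θ t ξ : ℝ) : HasDerivAt (fun t => lineC θ t ξ) 1 t :=
  (Complex.ofRealCLM.hasDerivAt (x := t)).add_const _

theorem hasDerivAt_lineC_right (θ t ξ : ℝ) :
    HasDerivAt (fun ξ => lineC θ t ξ) (Complex.I * θ) ξ := by
  refine (((Complex.ofRealCLM.hasDerivAt (x := ξ)).const_mul
    (Complex.I * θ)).const_add (t : ℂ)).congr_deriv ?_
  simp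

/-- `∑_{k ≤ K} t ^ k / k! ∂_z ^ l [Γ(z + k) (t + i θ ξ) ^ (-z - k)]`. -/
def dampedSum (θ : ℝ) (l K : ℕ) (z : ℂ) (t ξ : ℝ) : ℂ :=
  ∑ k ∈ Finset.range (K + 1), ((t ^ k / k.factorial : ℝ) : ℂ) *
    gammaExp l (z + k) (Complex.log (lineC θ t ξ))

theorem dampedSum_zero (θ : ℝ) (l K : ℕ) (z : ℂ) (ξ : ℝ) :
    dampedSum θ l K z 0 ξ = gammaExp l z (Complex.log (lineC θ 0 ξ)) := by
  rw [dampedSum, Finset.sum_range_succ']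
  simp

/-- The sum is the Taylor polynomial of degree `K` centred at `t + iθξ` and evaluated at `iθξ`, so
its derivative in the centre telescopes to the last term. -/
theorem hasDerivAt_dampedSum_left (θ : ℝ) (l K : ℕ) {z : ℂ} (hz : ∀ n : ℕ, z ≠ -n) {t ξ : ℝ}
    (h : 0 < t ∨ θ * ξ ≠ 0) : HasDerivAt (fun t => dampedSum θ l K z t ξ)
      (-(((t ^ K / K.factorial : ℝ) : ℂ) * gammaExp l (z + (K + 1 : ℕ))
        (Complex.log (lineC θ t ξ)))) t := by
  have hg : ∀ k : ℕ, HasDerivAt (fun t => gammaExp l (z + k) (Complex.log (lineC θ t ξ)))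
      (-gammaExp l (z + (k + 1 : ℕ)) (Complex.log (lineC θ t ξ))) t := fun k => by
    have := hasDerivAt_gammaExp_log l (ne_neg_nat_add hz k) (hasDerivAt_lineC_left θ t ξ)
      (lineC_mem_slitPlane h)
    rw [one_mul, add_assoc] at this
    exact_mod_cast this
  induction K with
  | zero => simpa [dampedSum] using hg 0
  | succ K ih =>
    have hp : HasDerivAt (fun t : ℝ => ((t ^ (K + 1) / (K + 1).factorial : ℝ) : ℂ))
        ((t ^ K / K.factorial : ℝ) : ℂ) t := by
      have := ((hasDerivAt_pow (K + 1) t).div_const ((K + 1).factorial : ℝ)).ofReal_comp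
      refine this.congr_deriv ?_
      congr 1
      rw [Nat.factorial_succ]
      push_cast
      field_simp
    have := ih.add (hp.mul (hg (K + 1)))
    simp only [dampedSum] at this ⊢
    simp only [Finset.sum_range_succ (n := K + 1)]
    refine this.congr_deriv ?_
    push_cast
    ring

theorem hasDerivAt_dampedSum_right (θ : ℝ) (l K : ℕ) {z : ℂ} (hz : ∀ n : ℕ, z ≠ -n) {t ξ : ℝ}
    (h : 0 < t ∨ θ * ξ ≠ 0) : HasDerivAt (fun ξ => dampedSum θ l K z t ξ)
      (-(Complex.I * θ) * dampedSum θ l K (z + 1) t ξ) ξ := by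
  simp only [dampedSum, Finset.mul_sum]
  refine HasDerivAt.fun_sum fun k _ => ?_
  refine ((hasDerivAt_gammaExp_log l (ne_neg_nat_add hz k) (hasDerivAt_lineC_right θ t ξ)
    (lineC_mem_slitPlane h)).const_mul _).congr_deriv ?_
  rw [add_right_comm z (k : ℂ) 1]
  ring

theorem norm_lineC_bounds {θ t ξ : ℝ} (hθ : |θ| = 1) (ht : t ∈ Set.Icc (0 : ℝ) 1) (hξ : 1 ≤ |ξ|) :
    |ξ| ≤ ‖lineC θ t ξ‖ ∧ ‖lineC θ t ξ‖ ≤ 2 * |ξ| := by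
  constructor
  · have := Complex.abs_im_le_norm (lineC θ t ξ)
    rwa [lineC_im, abs_mul, hθ, one_mul] at this
  · refine (Complex.norm_le_abs_re_add_abs_im _).trans ?_
    rw [lineC_re, lineC_im, abs_mul, hθ, one_mul, abs_of_nonneg ht.1]
    linarith [ht.2]

/-- For `0 ≤ t ≤ 1` the modulus of `t + iθξ` lies between `|ξ|` and `2 * |ξ|` and its argument is at
most `π`, so the bound is uniform in `t`. The factor `2 ^ |z.re|` covers both signs of `z.re`. -/
theorem norm_gammaExp_log_le {θ : ℝ} (hθ : |θ| = 1) (l : ℕ) {z : ℂ} (hz : ∀ n : ℕ, z ≠ -n) :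
    ∃ C : ℝ, 0 ≤ C ∧ ∀ t ∈ Set.Icc (0 : ℝ) 1, ∀ ξ : ℝ, 1 ≤ |ξ| →
      ‖gammaExp l z (Complex.log (lineC θ t ξ))‖ ≤
        C * (|ξ| ^ (-z.re) * (1 + |Real.log ξ|) ^ l) := by
  obtain ⟨c, hc⟩ := derivExp_eq_sum l (analyticAt_Gamma hz)
  have hpi := Real.pi_pos
  refine ⟨∑ i ∈ Finset.range (l + 1), ‖c i‖ *
    ((2 ^ |z.re| * Real.exp (|z.im| * Real.pi)) * (1 + Real.log 2 + Real.pi) ^ l),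
    Finset.sum_nonneg fun i _ => by
      have := Real.log_nonneg one_le_two
      positivity, fun t ht ξ hξ => ?_⟩
  obtain ⟨h1, h2⟩ := norm_lineC_bounds hθ ht hξ
  have hξ0 : 0 < |ξ| := one_pos.trans_le hξ
  set s := lineC θ t ξ
  have hs0 : 0 < ‖s‖ := hξ0.trans_le h1
  have hlog0 : 0 ≤ Real.log |ξ| := Real.log_nonneg hξ
  have hlog2 : 0 ≤ Real.log 2 := Real.log_nonneg one_le_two
  have hL : ‖Complex.log s‖ ≤ (1 + Real.log 2 + Real.pi) * (1 + |Real.log ξ|) := by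
    refine (Complex.norm_le_abs_re_add_abs_im _).trans ?_
    rw [Complex.log_re, Complex.log_im, abs_of_nonneg (Real.log_nonneg (hξ.trans h1))]
    have h3 : Real.log ‖s‖ ≤ Real.log 2 + Real.log |ξ| := by
      rw [← Real.log_mul two_ne_zero hξ0.ne']
      exact Real.log_le_log hs0 h2
    have h4 := Complex.abs_arg_le_pi s
    rw [← Real.log_abs ξ, abs_of_nonneg hlog0]
    nlinarith
  have hexp : ‖Complex.exp (-z * Complex.log s)‖ ≤
      |ξ| ^ (-z.re) * (2 ^ |z.re| * Real.exp (|z.im| * Real.pi)) := by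
    rw [Complex.norm_exp, Complex.mul_re, Complex.log_re, Complex.log_im, Complex.neg_re,
      Complex.neg_im, Real.rpow_def_of_pos hξ0, Real.rpow_def_of_pos two_pos, ← Real.exp_add,
      ← Real.exp_add, Real.exp_le_exp]
    have h3 : Real.log ‖s‖ - Real.log |ξ| ≤ Real.log 2 := by
      rw [sub_le_iff_le_add, ← Real.log_mul two_ne_zero hξ0.ne']
      exact Real.log_le_log hs0 h2
    have h5 : Real.log |ξ| ≤ Real.log ‖s‖ := Real.log_le_log hξ0 h1
    have h6 : -z.re * (Real.log ‖s‖ - Real.log |ξ|) ≤ |z.re| * Real.log 2 :=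
      mul_le_mul (neg_le_abs _) h3 (sub_nonneg.2 h5) (abs_nonneg _)
    have h7 : z.im * s.arg ≤ |z.im| * Real.pi := by
      refine (le_abs_self _).trans ?_
      rw [abs_mul]
      exact mul_le_mul_of_nonneg_left (Complex.abs_arg_le_pi s) (abs_nonneg _)
    nlinarith
  rw [gammaExp, hc, Finset.sum_mul]
  refine (norm_sum_le _ _).trans (Finset.sum_le_sum fun i hi => ?_)
  have hi : i ≤ l := Nat.lt_succ_iff.1 (Finset.mem_range.1 hi)
  have hpow : ‖Complex.log s ^ i‖ ≤ (1 + Real.log 2 + Real.pi) ^ l * (1 + |Real.log ξ|) ^ l := by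
    rw [norm_pow, ← mul_pow]
    refine (pow_le_pow_left₀ (norm_nonneg _) hL i).trans (pow_le_pow_right₀ ?_ hi)
    nlinarith [abs_nonneg (Real.log ξ)]
  rw [norm_mul, norm_mul, mul_assoc]
  refine mul_le_mul_of_nonneg_left ?_ (norm_nonneg _)
  calc _ ≤ _ := mul_le_mul hexp hpow (norm_nonneg _) (by positivity)
    _ = _ := by ring

/-- Mean value inequality in `t` on `[0, 1]`: the telescoped derivative contains only `Γ(z + K + 1)`
and the power `-z - K - 1`. -/
theorem norm_dampedSum_sub_le {θ : ℝ} (hθ : |θ| = 1) (l K : ℕ) {z : ℂ} (hz : ∀ n : ℕ, z ≠ -n) :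
    ∃ C : ℝ, 0 ≤ C ∧ ∀ ξ : ℝ, 1 ≤ |ξ| →
      ‖dampedSum θ l K z 1 ξ - dampedSum θ l K z 0 ξ‖ ≤
        C * (|ξ| ^ (-z.re - (K + 1)) * (1 + |Real.log ξ|) ^ l) := by
  obtain ⟨C, hC0, hC⟩ := norm_gammaExp_log_le hθ l (ne_neg_nat_add hz (K + 1))
  refine ⟨C, hC0, fun ξ hξ => ?_⟩
  have hne : θ * ξ ≠ 0 := by
    rw [← abs_pos, abs_mul, hθ, one_mul]
    linarith
  have := norm_image_sub_le_of_norm_deriv_le_segment_01' (f := fun t => dampedSum θ l K z t ξ)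
    (C := C * (|ξ| ^ (-z.re - (K + 1)) * (1 + |Real.log ξ|) ^ l))
    (fun t _ => (hasDerivAt_dampedSum_left θ l K hz (Or.inr hne)).hasDerivWithinAt)
    (fun t ht => by
      have h := hC t ⟨ht.1, ht.2.le⟩ ξ hξ
      have e : -(z + (K + 1 : ℕ)).re = -z.re - (K + 1) := by simp; ring
      rw [e] at h
      rw [norm_neg, norm_mul]
      refine (mul_le_of_le_one_left (norm_nonneg _) ?_).trans h
      rw [Complex.norm_real, Real.norm_of_nonneg (by have := ht.1; positivity)]
      refine div_le_one_of_le₀ ?_ (by positivity)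
      exact (pow_le_one₀ ht.1 ht.2.le).trans (by exact_mod_cast Nat.succ_le_of_lt K.factorial_pos))
  exact this

theorem iteratedDeriv_dampedSum_sub (θ : ℝ) (hθ : |θ| = 1) (l K k : ℕ) : ∀ {z : ℂ}
    (_ : ∀ n : ℕ, z ≠ -n) {ξ : ℝ} (_ : ξ ≠ 0),
    iteratedDeriv k (fun ξ => dampedSum θ l K z 1 ξ - dampedSum θ l K z 0 ξ) ξ =
      (-(Complex.I * θ)) ^ k *
        (dampedSum θ l K (z + k) 1 ξ - dampedSum θ l K (z + k) 0 ξ) := by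
  have hθ0 : θ ≠ 0 := abs_pos.1 (hθ ▸ one_pos)
  induction k with
  | zero => intro z _ ξ _; simp
  | succ k ih =>
    intro z hz ξ hξ
    have e : iteratedDeriv k (fun ξ => dampedSum θ l K z 1 ξ - dampedSum θ l K z 0 ξ) =ᶠ[𝓝 ξ]
        fun ξ => (-(Complex.I * θ)) ^ k *
          (dampedSum θ l K (z + k) 1 ξ - dampedSum θ l K (z + k) 0 ξ) := by
      filter_upwards [isOpen_ne.mem_nhds hξ] with y hy using ih hz hy
    have hzk := ne_neg_nat_add hz k
    have hd := ((hasDerivAt_dampedSum_right θ l K hzk (t := 1) (ξ := ξ) (Or.inl one_pos)).sub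
      (hasDerivAt_dampedSum_right θ l K hzk (t := 0) (Or.inr (mul_ne_zero hθ0 hξ)))).const_mul
        ((-(Complex.I * θ)) ^ k)
    rw [iteratedDeriv_succ, e.deriv_eq]
    refine hd.deriv.trans ?_
    push_cast
    rw [add_assoc]
    ring

/-- A family closed under differentiation up to a shift of the index is smooth. It is applied to `z
+ n` in the damped sums, to `x ^ n * w` under the Fourier integral, and to successive derivatives
extended by zero. -/
theorem contDiff_of_hasDerivAt_shift {f : ℕ → ℝ → ℂ} {c : ℂ} {S : Set ℝ} (hS : IsOpen S)
    (h : ∀ n, ∀ x ∈ S, HasDerivAt (f n) (c * f (n + 1) x) x) (n : ℕ) : ContDiffOn ℝ ∞ (f n) S := by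
  rw [contDiffOn_infty]
  intro m
  induction m generalizing n with
  | zero =>
    rw [Nat.cast_zero, contDiffOn_zero]
    exact fun x hx => (h n x hx).continuousAt.continuousWithinAt
  | succ m ih =>
    push_cast
    rw [contDiffOn_succ_iff_deriv_of_isOpen hS]
    refine ⟨fun x hx => (h n x hx).differentiableAt.differentiableWithinAt, by simp, ?_⟩
    exact (contDiffOn_const.mul (ih (n + 1))).congr fun x hx => (h n x hx).deriv

theorem contDiff_dampedSum_one (θ : ℝ) (l K : ℕ) {z : ℂ} (hz : ∀ n : ℕ, z ≠ -n) :
    ContDiff ℝ ∞ (dampedSum θ l K z 1) := by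
  rw [← contDiffOn_univ]
  have := contDiff_of_hasDerivAt_shift (f := fun n => dampedSum θ l K (z + n) 1)
    (c := -(Complex.I * θ)) isOpen_univ (fun n x _ => by
      have := hasDerivAt_dampedSum_right θ l K (ne_neg_nat_add hz n) (t := 1) (ξ := x)
        (Or.inl one_pos)
      rw [add_assoc] at this
      exact_mod_cast this) 0
  simpa using this

theorem contDiffOn_dampedSum_zero {θ : ℝ} (hθ : θ ≠ 0) (l K : ℕ) {z : ℂ} (hz : ∀ n : ℕ, z ≠ -n) :
    ContDiffOn ℝ ∞ (dampedSum θ l K z 0) {0}ᶜ := by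
  have := contDiff_of_hasDerivAt_shift (f := fun n => dampedSum θ l K (z + n) 0)
    (c := -(Complex.I * θ)) isOpen_compl_singleton (fun n x hx => by
      have := hasDerivAt_dampedSum_right θ l K (ne_neg_nat_add hz n) (t := 0) (ξ := x)
        (Or.inr (mul_ne_zero hθ hx))
      rw [add_assoc] at this
      exact_mod_cast this) 0
  simpa using this

theorem isSymbol_dampedSum_sub {θ : ℝ} (hθ : |θ| = 1) (l K : ℕ) {z : ℂ} (hz : ∀ n : ℕ, z ≠ -n)
    {F : Filter ℝ} (hF : ∀ᶠ ξ in F, 1 ≤ |ξ|) (hη : LogBound F 1) :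
    IsSymbol F (-z.re - K) (fun ξ => dampedSum θ l K z 1 ξ - dampedSum θ l K z 0 ξ) where
  smooth := by
    have hθ0 : θ ≠ 0 := abs_pos.1 (hθ ▸ one_pos)
    filter_upwards [hF] with ξ hξ
    have h0 : ξ ≠ 0 := abs_pos.1 (one_pos.trans_le hξ)
    exact ⟨h0, (contDiff_dampedSum_one θ l K hz).contDiffAt.sub
      ((contDiffOn_dampedSum_zero hθ0 l K hz).contDiffAt (isOpen_compl_singleton.mem_nhds h0))⟩
  bound k := by
    obtain ⟨C, hC0, hC⟩ := norm_dampedSum_sub_le hθ l K (ne_neg_nat_add hz k)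
    -- The estimate gains one power more than the order `-z.re - K` claimed; that power pays for the
    -- logarithms.
    have h1 : iteratedDeriv k (fun ξ => dampedSum θ l K z 1 ξ - dampedSum θ l K z 0 ξ) =O[F]
        fun ξ => |ξ| ^ (-z.re - K - k - 1) * (1 + |Real.log ξ|) ^ l := by
      refine IsBigO.of_bound C ?_
      filter_upwards [hF] with ξ hξ
      have h0 : ξ ≠ 0 := abs_pos.1 (one_pos.trans_le hξ)
      rw [iteratedDeriv_dampedSum_sub θ hθ l K k hz h0, norm_mul, norm_pow, norm_neg, norm_mul,
        Complex.norm_I, Complex.norm_real, Real.norm_eq_abs, hθ, one_mul, one_pow, one_mul,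
        Real.norm_of_nonneg (by positivity)]
      refine (hC ξ hξ).trans (le_of_eq ?_)
      congr 3
      simp
      ring
    refine h1.trans (((isBigO_refl (fun ξ : ℝ => |ξ| ^ (-z.re - K - k - 1)) F).mul
      (hη l)).congr' EventuallyEq.rfl ?_)
    filter_upwards [hF] with ξ hξ
    rw [← Real.rpow_add (one_pos.trans_le hξ)]
    congr 1
    ring

/-! ### The exponential cutoff -/

/-- `exp (-x) ∑_{k ≤ K} x ^ k / k!`. -/
def cutoff (K : ℕ) (x : ℝ) : ℂ :=
  Complex.exp (-x) * ∑ k ∈ Finset.range (K + 1), (x : ℂ) ^ k / k.factorial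

theorem hasDerivAt_cutoff (K : ℕ) (x : ℝ) :
    HasDerivAt (cutoff K) (-(Complex.exp (-x) * ((x : ℂ) ^ K / K.factorial))) x := by
  have he : HasDerivAt (fun x : ℝ => Complex.exp (-x)) (-Complex.exp (-x)) x := by
    refine (Complex.ofRealCLM.hasDerivAt (x := x)).neg.cexp.congr_deriv ?_
    simp
  induction K with
  | zero =>
    have : cutoff 0 = fun x : ℝ => Complex.exp (-x) := by ext x; simp [cutoff]
    rw [this]
    simpa using he
  | succ K ih =>
    have hp : HasDerivAt (fun x : ℝ => (x : ℂ) ^ (K + 1) / (K + 1).factorial)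
        ((x : ℂ) ^ K / K.factorial) x := by
      refine (((Complex.ofRealCLM.hasDerivAt (x := x)).pow (K + 1)).div_const _).congr_deriv ?_
      rw [Nat.factorial_succ]
      have : (K.factorial : ℂ) ≠ 0 := by exact_mod_cast K.factorial_ne_zero
      have : (K : ℂ) + 1 ≠ 0 := by exact_mod_cast K.succ_ne_zero
      push_cast
      simp only [Complex.ofRealCLM_apply]
      field_simp
      simp
    have e : cutoff (K + 1) = fun x : ℝ => cutoff K x +
        Complex.exp (-x) * ((x : ℂ) ^ (K + 1) / (K + 1).factorial) := by
      ext x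
      simp only [cutoff, Finset.sum_range_succ (n := K + 1), mul_add]
    rw [e]
    refine (ih.add (he.mul hp)).congr_deriv ?_
    ring

theorem contDiff_cutoff (K : ℕ) : ContDiff ℝ ∞ (cutoff K) := by
  have h : ContDiff ℝ ∞ (fun x : ℝ => (x : ℂ)) := Complex.ofRealCLM.contDiff
  exact (h.neg.cexp).mul (ContDiff.sum fun k _ => (h.pow k).div_const _)

/-- The derivative of the cutoff telescopes to `-exp (-y) * y ^ K / K!`, which is at most `x ^ K` in
modulus on `[0, x]`; integrate from `cutoff K 0 = 1`. -/
theorem norm_one_sub_cutoff_le (K : ℕ) {x : ℝ} (hx : 0 ≤ x) : ‖1 - cutoff K x‖ ≤ x ^ (K + 1) := by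
  have h0 : cutoff K 0 = 1 := by
    rw [cutoff, Finset.sum_range_succ']
    simp
  have h := (convex_Icc (0 : ℝ) x).norm_image_sub_le_of_norm_hasDerivWithin_le (f := cutoff K)
    (f' := fun x : ℝ => -(Complex.exp (-x) * ((x : ℂ) ^ K / K.factorial))) (C := x ^ K)
    (fun y _ => (hasDerivAt_cutoff K y).hasDerivWithinAt) (fun y hy => by
      rw [norm_neg, norm_mul, Complex.norm_exp, norm_div, norm_pow, Complex.norm_real,
        Complex.norm_natCast, Real.norm_of_nonneg hy.1]
      have h1 : Real.exp (-(y : ℂ)).re ≤ 1 := by simpa using hy.1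
      have h2 : y ^ K / K.factorial ≤ x ^ K := by
        refine (div_le_self (pow_nonneg hy.1 K) ?_).trans (pow_le_pow_left₀ hy.1 hy.2 K)
        exact_mod_cast Nat.succ_le_of_lt K.factorial_pos
      calc _ ≤ 1 * x ^ K := mul_le_mul h1 h2 (by have := hy.1; positivity) zero_le_one
        _ = _ := one_mul _) (Set.right_mem_Icc.2 hx) (Set.left_mem_Icc.2 hx)
  rw [h0, zero_sub, norm_neg, Real.norm_of_nonneg hx] at h
  rwa [pow_succ]

theorem rapidBound_one_sub_cutoff_mul (K : ℕ) (ψ : 𝓢(ℝ, ℂ)) :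
    RapidBound (K + 1) (fun x => (1 - cutoff K x) * ψ x) where
  cont := ((contDiff_const.sub (contDiff_cutoff K)).continuous.mul ψ.continuous).continuousOn
  bound m := by
    obtain ⟨C, hC0, hC⟩ := (rapidBound_schwartz ψ).bound m
    refine ⟨C, hC0, fun x hx => ?_⟩
    have h := hC x hx
    rw [Real.rpow_zero, one_mul] at h
    rw [norm_mul]
    calc _ ≤ x ^ (K + 1) * (C * (1 + x) ^ (-(m : ℝ))) :=
          mul_le_mul (norm_one_sub_cutoff_le K hx.le) h (norm_nonneg _) (by positivity)
      _ = _ := by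
        rw [← Real.rpow_natCast]
        push_cast
        ring

theorem rapidBound_cutoff (K : ℕ) : RapidBound 0 (cutoff K) where
  cont := (contDiff_cutoff K).continuous.continuousOn
  bound m := by
    refine ⟨∑ k ∈ Finset.range (K + 1),
      (m + k).factorial * Real.exp 1, by positivity, fun x hx => ?_⟩
    rw [Real.rpow_zero, one_mul, cutoff, norm_mul, Complex.norm_exp, Finset.sum_mul]
    have h1 : Real.exp (-(x : ℂ)).re = Real.exp (-(1 * x)) := by simp
    rw [h1]
    refine (mul_le_mul_of_nonneg_left (norm_sum_le _ _) (Real.exp_pos _).le).trans ?_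
    rw [Finset.mul_sum]
    refine Finset.sum_le_sum fun k _ => ?_
    have h2 := one_add_rpow_neg_mul_exp_le one_pos (m + k) hx
    rw [one_pow, div_one] at h2
    have h3 : ‖(x : ℂ) ^ k / k.factorial‖ ≤ (1 + x) ^ (k : ℝ) := by
      rw [norm_div, norm_pow, Complex.norm_real, Complex.norm_natCast, Real.norm_of_nonneg hx.le,
        Real.rpow_natCast]
      refine (div_le_self (by positivity) ?_).trans (pow_le_pow_left₀ hx.le (by linarith) k)
      exact_mod_cast Nat.succ_le_of_lt k.factorial_pos
    calc _ ≤ _ := mul_le_mul h2 h3 (norm_nonneg _) (by positivity)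
      _ = _ := by
        rw [mul_assoc, ← Real.rpow_add (by linarith)]
        push_cast
        ring_nf

/-! ### Fourier integrals over the half-line -/

/-- `(2π)^(-1/2)`. -/
def fourierConst : ℂ := (((√(2 * Real.pi))⁻¹ : ℝ) : ℂ)

/-- `(2π)^(-1/2) ∫_0^∞ exp (-i θ ξ x) g(x) dx`. -/
def halfFourier (θ : ℝ) (g : ℝ → ℂ) (ξ : ℝ) : ℂ :=
  fourierConst * ∫ x in Set.Ioi (0 : ℝ), Complex.exp (-(Complex.I * θ * ξ * x)) * g x

theorem norm_exp_I_mul (a b c : ℝ) : ‖Complex.exp (-(Complex.I * a * b * c))‖ = 1 := by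
  rw [Complex.norm_exp]
  simp

theorem reflect_fourierS (σ : ℤˣ) (φ : 𝓢(ℝ, ℂ)) (x : ℝ) : reflect σ (fourierS φ) x =
    fourierConst * ∫ ξ : ℝ, Complex.exp (-(Complex.I * ((σ : ℤ) : ℝ) * ξ * x)) * φ ξ := by
  rw [reflect, fourierS_apply, fourierConst]
  congr 2
  ext ξ
  congr 3
  push_cast
  ring

theorem integral_mul_reflect_fourierS (σ : ℤˣ) {g : ℝ → ℂ} (hg : IntegrableOn g (Set.Ioi 0))
    (φ : 𝓢(ℝ, ℂ)) :
    ∫ x in Set.Ioi (0 : ℝ), g x * reflect σ (fourierS φ) x =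
      ∫ ξ : ℝ, φ ξ * halfFourier ((σ : ℤ) : ℝ) g ξ := by
  set θ : ℝ := ((σ : ℤ) : ℝ) with hθ
  have hint : Integrable (fun z : ℝ × ℝ => Complex.exp (-(Complex.I * θ * z.2 * z.1)) *
      (g z.1 * φ z.2)) ((volume.restrict (Set.Ioi 0)).prod volume) := by
    refine (Integrable.mul_prod (μ := volume.restrict (Set.Ioi (0 : ℝ))) (ν := volume) hg
      φ.integrable).bdd_mul (c := 1) ?_ (Eventually.of_forall fun z => ?_)
    · exact Continuous.aestronglyMeasurable (by fun_prop)
    · exact (norm_exp_I_mul _ _ _).le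
  calc _ = ∫ x in Set.Ioi (0 : ℝ), ∫ ξ : ℝ, fourierConst *
        (Complex.exp (-(Complex.I * θ * ξ * x)) * (g x * φ ξ)) := by
        refine integral_congr_ae (Eventually.of_forall fun x => ?_)
        simp only
        rw [reflect_fourierS, ← hθ, integral_const_mul, mul_left_comm, ← integral_const_mul]
        congr 2
        ext ξ
        ring
    _ = ∫ ξ : ℝ, ∫ x in Set.Ioi (0 : ℝ), fourierConst *
        (Complex.exp (-(Complex.I * θ * ξ * x)) * (g x * φ ξ)) :=
        integral_integral_swap (hint.const_mul fourierConst)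
    _ = _ := by
        refine integral_congr_ae (Eventually.of_forall fun ξ => ?_)
        simp only
        rw [halfFourier, integral_const_mul, mul_left_comm, ← integral_const_mul (φ ξ)]
        congr 2
        ext x
        ring

/-- The damping `exp (-x)` turns the oscillating factor into `exp (-(1 + iθξ) * x)`, and each power
of `x` gives a Gamma integral with complex rate. -/
theorem integral_cpow_cutoff (θ : ℝ) (K : ℕ) {w : ℂ} (hw : -1 < w.re) (ξ : ℝ) :
    halfFourier θ (fun x => (x : ℂ) ^ w * cutoff K x) ξ =
      fourierConst * ∑ k ∈ Finset.range (K + 1), (k.factorial : ℂ)⁻¹ *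
        (Complex.Gamma (w + k + 1) *
          Complex.exp (-((w + k + 1) * Complex.log (lineC θ 1 ξ)))) := by
  have hs : 0 < (lineC θ 1 ξ).re := by rw [lineC_re]; exact one_pos
  have hwk : ∀ k : ℕ, -1 < (w + k).re := fun k => by
    have := (Nat.cast_nonneg k : (0 : ℝ) ≤ k)
    simp; linarith
  rw [halfFourier]
  congr 1
  have e : ∀ k : ℕ, (k.factorial : ℂ)⁻¹ * (Complex.Gamma (w + k + 1) *
      Complex.exp (-((w + k + 1) * Complex.log (lineC θ 1 ξ)))) =
      ∫ x in Set.Ioi (0 : ℝ), (k.factorial : ℂ)⁻¹ *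
        ((x : ℂ) ^ (w + k) * Complex.exp (-(lineC θ 1 ξ * x))) := fun k => by
    rw [integral_const_mul, ← mellinIoi_exp (hwk k) hs, mellinIoi]
  simp only [e]
  rw [← integral_finsetSum]
  · refine setIntegral_congr_fun measurableSet_Ioi fun x hx => ?_
    have hx : 0 < x := hx
    have hx0 : (x : ℂ) ≠ 0 := by exact_mod_cast hx.ne'
    simp only [cutoff, Finset.mul_sum]
    refine Finset.sum_congr rfl fun k _ => ?_
    have h1 : Complex.exp (-(lineC θ 1 ξ * x)) =
        Complex.exp (-(Complex.I * θ * ξ * x)) * Complex.exp (-x) := by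
      rw [← Complex.exp_add]
      congr 1
      simp only [lineC]
      push_cast
      ring
    rw [h1, Complex.cpow_add _ _ hx0, Complex.cpow_natCast]
    ring
  · intro k _
    exact ((rapidBound_exp hs).integrableOn_cpow_mul (w := w + k)
      (by simpa using hwk k)).const_mul _

/-! ### Holomorphic families of Fourier integrals -/

theorem integrable_one_add_pow_mul (φ : 𝓢(ℝ, ℂ)) (m : ℕ) :
    Integrable (fun ξ : ℝ => (1 + |ξ|) ^ m * ‖φ ξ‖) := by
  have h := ((φ.integrable_pow_mul volume 0).add (φ.integrable_pow_mul volume m)).const_mul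
    ((2 : ℝ) ^ (m - 1))
  refine h.mono' (Continuous.aestronglyMeasurable (by fun_prop)) (Eventually.of_forall fun ξ => ?_)
  rw [Real.norm_of_nonneg (by positivity)]
  have := add_pow_le (zero_le_one (α := ℝ)) (abs_nonneg ξ) m
  simp only [Pi.add_apply, pow_zero, one_mul, one_pow, Real.norm_eq_abs] at this ⊢
  nlinarith [norm_nonneg (φ ξ)]

theorem norm_exp_mul_log_le {θ : ℝ} (hθ : |θ| = 1) {B : ℝ} {m : ℕ} (hm : B ≤ m) {z : ℂ}
    (hz : ‖z‖ ≤ B) (ξ : ℝ) : ‖Complex.exp (-(z * Complex.log (lineC θ 1 ξ)))‖ ≤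
      Real.exp (B * Real.pi) * (1 + |ξ|) ^ m := by
  set s := lineC θ 1 ξ
  have hs1 : 1 ≤ ‖s‖ := by
    have := Complex.abs_re_le_norm s
    rwa [lineC_re, abs_one] at this
  have hs2 : ‖s‖ ≤ 1 + |ξ| := by
    refine (Complex.norm_le_abs_re_add_abs_im _).trans ?_
    rw [lineC_re, lineC_im, abs_mul, hθ, one_mul, abs_one]
  have hB : 0 ≤ B := (norm_nonneg z).trans hz
  have hlog : 0 ≤ Real.log ‖s‖ := Real.log_nonneg hs1
  have hL : ‖Complex.log s‖ ≤ Real.log (1 + |ξ|) + Real.pi := by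
    refine (Complex.norm_le_abs_re_add_abs_im _).trans ?_
    rw [Complex.log_re, Complex.log_im, abs_of_nonneg hlog]
    exact add_le_add (Real.log_le_log (one_pos.trans_le hs1) hs2) (Complex.abs_arg_le_pi s)
  have hl0 : 0 ≤ Real.log (1 + |ξ|) := Real.log_nonneg (by linarith [abs_nonneg ξ])
  refine (Complex.norm_exp_le_exp_norm _).trans ?_
  rw [norm_neg, norm_mul, ← Real.rpow_natCast, Real.rpow_def_of_pos (by positivity), ← Real.exp_add,
    Real.exp_le_exp]
  calc ‖z‖ * ‖Complex.log s‖ ≤ B * (Real.log (1 + |ξ|) + Real.pi) :=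
        mul_le_mul hz hL (norm_nonneg _) hB
    _ ≤ _ := by nlinarith

theorem continuous_log_lineC_one (θ : ℝ) : Continuous fun ξ => Complex.log (lineC θ 1 ξ) := by
  refine Continuous.clog ?_ fun ξ => lineC_mem_slitPlane (Or.inl one_pos)
  unfold lineC
  fun_prop

theorem iteratedDeriv_integral_mul_exp {θ : ℝ} (hθ : |θ| = 1) (φ : 𝓢(ℝ, ℂ)) {A : ℂ → ℂ} {z : ℂ}
    (hA : AnalyticAt ℂ A z) :
    AnalyticAt ℂ (fun z => ∫ ξ : ℝ, φ ξ *
      (A z * Complex.exp (-(z * Complex.log (lineC θ 1 ξ))))) z ∧ ∀ l : ℕ,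
    Integrable (fun ξ => φ ξ * derivExp l A z (Complex.log (lineC θ 1 ξ))) ∧
      iteratedDeriv l (fun z => ∫ ξ : ℝ, φ ξ *
        (A z * Complex.exp (-(z * Complex.log (lineC θ 1 ξ))))) z =
        ∫ ξ : ℝ, φ ξ * derivExp l A z (Complex.log (lineC θ 1 ξ)) := by
  -- A ball on which `A` is analytic and bounded by `‖A z‖ + 1`; there the power of `1 + iθξ` grows
  -- at most like `(1 + |ξ|) ^ m`, which `φ` absorbs.
  obtain ⟨r, hr, hball⟩ := Metric.eventually_nhds_iff_ball.1
    (hA.eventually_analyticAt.and (hA.continuousAt.norm.eventually_lt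
      (continuousAt_const (y := ‖A z‖ + 1)) (lt_add_one _)))
  set B := ‖z‖ + r
  obtain ⟨m, hm⟩ := exists_nat_ge B
  have hm' : ∀ w ∈ Metric.ball z r, AEStronglyMeasurable (fun ξ : ℝ => φ ξ *
      (A w * Complex.exp (-(w * Complex.log (lineC θ 1 ξ))))) volume := fun w _ => by
    refine Continuous.aestronglyMeasurable ?_
    have := continuous_log_lineC_one θ
    fun_prop
  have hd : ∀ᵐ ξ : ℝ, DifferentiableOn ℂ (fun w => φ ξ *
      (A w * Complex.exp (-(w * Complex.log (lineC θ 1 ξ))))) (Metric.ball z r) := by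
    refine Eventually.of_forall fun ξ w hw => ?_
    exact (((hball w hw).1.differentiableAt.mul (by fun_prop)).const_mul _).differentiableWithinAt
  have hb : ∀ᵐ ξ : ℝ, ∀ w ∈ Metric.ball z r, ‖φ ξ *
      (A w * Complex.exp (-(w * Complex.log (lineC θ 1 ξ))))‖ ≤
      ((‖A z‖ + 1) * Real.exp (B * Real.pi)) * ((1 + |ξ|) ^ m * ‖φ ξ‖) := by
    refine Eventually.of_forall fun ξ w hw => ?_
    have hwB : ‖w‖ ≤ B := by
      have := norm_le_norm_add_norm_sub' w z
      rw [← dist_eq_norm] at this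
      have := Metric.mem_ball.1 hw
      simp only [B]
      linarith
    rw [norm_mul, norm_mul]
    have := mul_le_mul (hball w hw).2.le (norm_exp_mul_log_le hθ hm hwB ξ) (norm_nonneg _)
      (by positivity)
    calc _ ≤ _ := mul_le_mul_of_nonneg_left this (norm_nonneg _)
      _ = _ := by ring
  have hbi := (integrable_one_add_pow_mul φ m).const_mul ((‖A z‖ + 1) * Real.exp (B * Real.pi))
  refine ⟨(differentiableOn_integral_of_holomorphic Metric.isOpen_ball hm' hd hb hbi).analyticAt
    (Metric.ball_mem_nhds z hr), fun l => ?_⟩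
  have key := iteratedDeriv_integral_of_holomorphic l Metric.isOpen_ball hm' hd hb hbi
    (Metric.mem_ball_self hr)
  simpa only [iteratedDeriv_const_mul_field] using! key

/-! ### The homogeneous distributions on Fourier transforms -/

/-- Composition with `x ↦ σ x` on Schwartz functions. -/
def reflectS (σ : ℤˣ) : 𝓢(ℝ, ℂ) →L[ℂ] 𝓢(ℝ, ℂ) :=
  SchwartzMap.compCLMOfContinuousLinearEquiv ℂ
    (ContinuousLinearEquiv.unitsEquivAut ℝ (Units.map (Int.castRingHom ℝ).toMonoidHom σ))

theorem reflectS_coe (σ : ℤˣ) (φ : 𝓢(ℝ, ℂ)) : ⇑(reflectS σ φ) = reflect σ φ := by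
  ext x
  simp [reflectS, reflect, mul_comm]

theorem abs_units_cast (σ : ℤˣ) : |((σ : ℤ) : ℝ)| = 1 := by
  rcases Int.units_eq_one_or σ with rfl | rfl <;> simp

theorem Gamma_add_nat {w : ℂ} (hw : ∀ n : ℕ, w ≠ -((n : ℂ) + 1)) (k : ℕ) :
    Complex.Gamma (w + k + 1) =
      Complex.Gamma (w + 1) * ∏ i ∈ Finset.range k, (w + (i + 1 : ℂ)) := by
  induction k with
  | zero => simp
  | succ k ih =>
    have hne : w + k + 1 ≠ 0 := fun h => hw k (by linear_combination h)
    rw [Finset.prod_range_succ, ← mul_assoc, ← ih]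
    push_cast
    rw [← add_assoc w, Complex.Gamma_add_one _ hne]
    ring

/-- Split `1 = cutoff + (1 - cutoff)`. The damped part is integrable, so Fubini moves the Fourier
transform onto it. The other part is kept: it converges further to the left in `w`, and it cancels
in `extForm_fourier`. -/
theorem mellinIoi_fourier_eq {σ : ℤˣ} (K : ℕ) (φ : 𝓢(ℝ, ℂ)) {w : ℂ} (hw : -1 < w.re) :
    mellinIoi (reflectS σ (fourierS φ)) w =
      ∑ k ∈ Finset.range (K + 1), (fourierConst * (k.factorial : ℂ)⁻¹) *
        (Complex.Gamma (w + k + 1) * ∫ ξ : ℝ, φ ξ *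
          (1 * Complex.exp (-((w + k + 1) * Complex.log (lineC ((σ : ℤ) : ℝ) 1 ξ))))) +
      mellinIoi (fun x => (1 - cutoff K x) * reflectS σ (fourierS φ) x) w := by
  set θ : ℝ := ((σ : ℤ) : ℝ) with hθ
  set ψ := reflectS σ (fourierS φ) with hψ
  have h1 := (rapidBound_one_sub_cutoff_mul K ψ).integrableOn_cpow_mul (w := w)
    (by have := (Nat.cast_nonneg K : (0 : ℝ) ≤ K); linarith)
  have h2 := (rapidBound_cutoff K).integrableOn_cpow_mul (w := w) (by linarith)
  have h3 := (rapidBound_schwartz ψ).integrableOn_cpow_mul (w := w) (by linarith)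
  have hint : ∀ k : ℕ, Integrable (fun ξ => φ ξ * (1 * Complex.exp (-((w + k + 1) *
      Complex.log (lineC θ 1 ξ))))) := fun k => by
    have := ((iteratedDeriv_integral_mul_exp (abs_units_cast σ) φ (A := fun _ => 1)
      (z := w + k + 1) analyticAt_const).2 0).1
    simpa only [derivExp, iteratedDeriv_zero] using this
  have e : mellinIoi (fun x => cutoff K x * ψ x) w = ∑ k ∈ Finset.range (K + 1),
      (fourierConst * (k.factorial : ℂ)⁻¹) * (Complex.Gamma (w + k + 1) * ∫ ξ : ℝ, φ ξ *
          (1 * Complex.exp (-((w + k + 1) * Complex.log (lineC θ 1 ξ))))) := by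
    have := integral_mul_reflect_fourierS σ h2 φ
    simp only [← hθ, integral_cpow_cutoff θ K hw] at this
    rw [mellinIoi]
    simp only [← mul_assoc]
    rw [hψ, reflectS_coe, this]
    simp only [Finset.mul_sum, ← integral_const_mul]
    rw [integral_finsetSum]
    · refine Finset.sum_congr rfl fun k _ => ?_
      congr 1
      ext ξ
      ring
    · intro k _
      have := (hint k).const_mul (fourierConst * (k.factorial : ℂ)⁻¹ * Complex.Gamma (w + k + 1))
      refine this.congr (Eventually.of_forall fun ξ => ?_)
      simp only
      ring
  have hsub : IntegrableOn (fun x : ℝ => (x : ℂ) ^ w * (cutoff K x * ψ x)) (Set.Ioi 0) := by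
    refine (h3.sub h1).congr (Eventually.of_forall fun x => ?_)
    simp only [Pi.sub_apply]
    ring
  rw [← e, mellinIoi, mellinIoi, mellinIoi, ← integral_add hsub h1]
  congr 1
  ext x
  ring

/-- Analytic continuation of `mellinIoi_fourier_eq` to `Re w > -1 - n`. The condition `n ≤ K` makes
the Mellin integral of `(1 - cutoff K) * ψ` holomorphic there. -/
theorem rieszPlus_fourier_eq {σ : ℤˣ} {n K : ℕ} (hK : n ≤ K) (φ : 𝓢(ℝ, ℂ)) {w : ℂ}
    (hw : -1 < w.re + n) (hw' : ∀ n : ℕ, w ≠ -((n : ℂ) + 1)) :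
    rieszPlus n w (reflectS σ (fourierS φ)) =
      ∑ k ∈ Finset.range (K + 1), (fourierConst * (k.factorial : ℂ)⁻¹) *
        (∫ ξ : ℝ, φ ξ * (Complex.Gamma (w + k + 1) *
          Complex.exp (-((w + k + 1) * Complex.log (lineC ((σ : ℤ) : ℝ) 1 ξ))))) +
      mellinIoi (fun x => (1 - cutoff K x) * reflectS σ (fourierS φ) x) w := by
  set θ : ℝ := ((σ : ℤ) : ℝ) with hθ
  set ψ := reflectS σ (fourierS φ) with hψ
  -- `D` clears the poles: `D w * Γ(w + k + 1) = Γ(w + n + 1) * ∏_{i < k} (w + i + 1)`, and `Γ(w + n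
  -- + 1)` is holomorphic on `H`. The identity theorem then applies on a whole half-plane with no
  -- points removed.
  set D : ℂ → ℂ := fun w => ∏ i ∈ Finset.range n, (w + (i + 1 : ℂ)) with hD
  set H : Set ℂ := {w : ℂ | -1 - n < w.re} with hH
  have hHo : IsOpen H := isOpen_lt continuous_const Complex.continuous_re
  have hHc : IsPreconnected H := (convex_halfSpace_re_gt _).isPreconnected
  set f : ℂ → ℂ := fun w => (-1) ^ n * mellinIoi (iteratedDeriv n ψ) (w + n) with hf
  set g : ℂ → ℂ := fun w => ∑ k ∈ Finset.range (K + 1), (fourierConst * (k.factorial : ℂ)⁻¹) *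
      (Complex.Gamma (w + n + 1) * (∏ i ∈ Finset.range k, (w + (i + 1 : ℂ))) * ∫ ξ : ℝ, φ ξ *
        (1 * Complex.exp (-((w + k + 1) * Complex.log (lineC θ 1 ξ))))) +
      D w * mellinIoi (fun x => (1 - cutoff K x) * ψ x) w with hg
  have hDne : ∀ w : ℂ, (∀ n : ℕ, w ≠ -((n : ℂ) + 1)) → D w ≠ 0 := fun w h =>
    rieszCoeff_den_ne_zero h n
  have hfR : ∀ w : ℂ, (∀ n : ℕ, w ≠ -((n : ℂ) + 1)) → rieszPlus n w ψ = f w / D w := fun w _ => by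
    rw [rieszPlus_eq, rieszCoeff]
    simp only [hf, hD]
    ring
  have hGam : ∀ w : ℂ, (∀ n : ℕ, w ≠ -((n : ℂ) + 1)) → ∀ k : ℕ,
      Complex.Gamma (w + n + 1) * (∏ i ∈ Finset.range k, (w + (i + 1 : ℂ))) =
        D w * Complex.Gamma (w + k + 1) := fun w h k => by
    rw [Gamma_add_nat h n, Gamma_add_nat h k]
    ring
  have hfa : AnalyticOnNhd ℂ f H := by
    refine DifferentiableOn.analyticOnNhd (fun w hw => ?_) hHo
    have hw : -1 - n < w.re := hw
    exact ((((rapidBound_iteratedDeriv ψ n).contDiffAt_mellinIoi_add (n := n) (by linarith)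
      1).differentiableAt one_ne_zero).const_mul _).differentiableWithinAt
  have hga : AnalyticOnNhd ℂ g H := by
    refine DifferentiableOn.analyticOnNhd (fun w hw => ?_) hHo
    have hw : -1 - n < w.re := hw
    refine DifferentiableAt.differentiableWithinAt ?_
    have hprod : ∀ k : ℕ, DifferentiableAt ℂ
        (fun w => ∏ i ∈ Finset.range k, (w + (i + 1 : ℂ))) w := fun k => by fun_prop
    refine DifferentiableAt.add (DifferentiableAt.fun_sum fun k _ => ?_) ((hprod n).mul ?_)
    · refine DifferentiableAt.const_mul (DifferentiableAt.mul (DifferentiableAt.mul ?_ (hprod k))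
        ?_) _
      · have : DifferentiableAt ℂ Complex.Gamma (w + n + 1) :=
          Complex.differentiableAt_Gamma _ fun m h => by
            have := congrArg Complex.re h
            simp at this
            linarith [(Nat.cast_nonneg m : (0 : ℝ) ≤ m)]
        exact DifferentiableAt.comp (f := fun w : ℂ => w + n + 1) w this (by fun_prop)
      · have := (iteratedDeriv_integral_mul_exp (abs_units_cast σ) φ (A := fun _ => 1)
          (z := w + k + 1) analyticAt_const).1.differentiableAt
        exact DifferentiableAt.comp (f := fun w : ℂ => w + k + 1) w this (by fun_prop)
    · refine ((rapidBound_one_sub_cutoff_mul K ψ).contDiffAt_mellinIoi ?_ 1).differentiableAt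
        one_ne_zero
      have : (n : ℝ) ≤ K := by exact_mod_cast hK
      linarith
  have hev : f =ᶠ[𝓝 0] g := by
    have : {w : ℂ | -1 < w.re} ∈ 𝓝 (0 : ℂ) :=
      (isOpen_lt continuous_const Complex.continuous_re).mem_nhds (by simp)
    filter_upwards [this] with w hw
    have hw : -1 < w.re := hw
    have hne : ∀ n : ℕ, w ≠ -((n : ℂ) + 1) := fun m h => by
      have := congrArg Complex.re h
      simp at this
      linarith [(Nat.cast_nonneg m : (0 : ℝ) ≤ m)]
    have h1 := rieszPlus_eq_mellinIoi ψ n hw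
    rw [hfR w hne, div_eq_iff (hDne w hne), mellinIoi_fourier_eq K φ hw] at h1
    rw [h1]
    simp only [hg]
    rw [add_mul, Finset.sum_mul, mul_comm (mellinIoi _ _)]
    congr 1
    refine Finset.sum_congr rfl fun k _ => ?_
    rw [hGam w hne k]
    ring
  have key := hfa.eqOn_of_preconnected_of_eventuallyEq hga hHc (z₀ := 0)
    (by simp only [hH]; simp; linarith [(Nat.cast_nonneg n : (0 : ℝ) ≤ n)]) hev
    (show w ∈ H by simp only [hH, Set.mem_ofPred_eq]; linarith)
  rw [hfR w hw', key, div_eq_iff (hDne w hw')]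
  simp only [hg]
  rw [add_mul, Finset.sum_mul, mul_comm (mellinIoi _ _)]
  congr 1
  refine Finset.sum_congr rfl fun k _ => ?_
  rw [hGam w hw' k]
  have : ∫ ξ : ℝ, φ ξ * (Complex.Gamma (w + k + 1) * Complex.exp (-((w + k + 1) *
      Complex.log (lineC θ 1 ξ)))) = Complex.Gamma (w + k + 1) * ∫ ξ : ℝ, φ ξ *
        (1 * Complex.exp (-((w + k + 1) * Complex.log (lineC θ 1 ξ)))) := by
    rw [← integral_const_mul]
    congr 1
    ext ξ
    ring
  rw [this]
  ring

theorem add_one_ne_neg_nat {p : ℂ} (hp : ∀ n : ℕ, p ≠ -((n : ℂ) + 1)) : ∀ n : ℕ, p + 1 ≠ -n :=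
  fun n h => hp n (by linear_combination h)

theorem eventually_ne_neg_nat {p : ℂ} (hp : ∀ n : ℕ, p ≠ -((n : ℂ) + 1)) :
    ∀ᶠ w in 𝓝 p, ∀ n : ℕ, w ≠ -((n : ℂ) + 1) := by
  -- `1 / Γ(w + 1)` is entire and nonzero at `p`, hence nonzero nearby. At the negative integers it
  -- is zero because `Complex.Gamma` takes the value zero at its poles.
  have h := Complex.differentiable_one_div_Gamma.continuous.continuousAt.eventually_ne
    (x := p + 1) (inv_ne_zero (Complex.Gamma_ne_zero (add_one_ne_neg_nat hp)))
  have h2 : Tendsto (fun w : ℂ => w + 1) (𝓝 p) (𝓝 (p + 1)) := (continuous_add_const 1).tendsto p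
  filter_upwards [h2.eventually h] with w hw n hn
  refine hw ?_
  rw [hn, neg_add, neg_add_cancel_right, Complex.Gamma_neg_nat_eq_zero, inv_zero]

theorem logHom_fourier_eq {σ : ℤˣ} {p : ℂ} (hp : ∀ n : ℕ, p ≠ -((n : ℂ) + 1)) (l : ℕ) {K : ℕ}
    (hK : ⌈-p.re⌉₊ ≤ K) (φ : 𝓢(ℝ, ℂ)) :
    Integrable (fun ξ => φ ξ * dampedSum ((σ : ℤ) : ℝ) l K (p + 1) 1 ξ) ∧
    IntegrableOn (fun x => logPow logAbs p l x * ((1 - cutoff K x) * reflectS σ (fourierS φ) x))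
      (Set.Ioi 0) ∧
    logHom p l (reflectS σ (fourierS φ)) =
      (∫ ξ : ℝ, φ ξ * (fourierConst * dampedSum ((σ : ℤ) : ℝ) l K (p + 1) 1 ξ)) +
      ∫ x in Set.Ioi (0 : ℝ),
        logPow logAbs p l x * ((1 - cutoff K x) * reflectS σ (fourierS φ) x) := by
  set θ : ℝ := ((σ : ℤ) : ℝ) with hθ
  set ψ := reflectS σ (fourierS φ) with hψ
  set n := ⌈-p.re⌉₊ with hn
  have hre : -1 < p.re + n := neg_one_lt_re_add_ceil p
  have hp1 := add_one_ne_neg_nat hp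
  set E : ℕ → ℂ → ℂ := fun k z => ∫ ξ : ℝ, φ ξ *
    (Complex.Gamma z * Complex.exp (-(z * Complex.log (lineC θ 1 ξ)))) with hE
  have hz : ∀ k : ℕ, ∀ m : ℕ, p + (k + 1 : ℂ) ≠ -m := fun k => by
    have := ne_neg_nat_add hp1 k
    rwa [add_assoc, add_comm 1 (k : ℂ)] at this
  have hEk := fun k => iteratedDeriv_integral_mul_exp (abs_units_cast σ) φ
    (analyticAt_Gamma (hz k))
  have hM := rapidBound_one_sub_cutoff_mul K ψ
  have hnK : (n : ℝ) ≤ K := by exact_mod_cast hK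
  have hMl := hM.iteratedDeriv_mellinIoi (w := p) (by linarith) l
  have hCE : ∀ k : ℕ, ContDiffAt ℂ l (fun w => E k (w + (k + 1))) p := fun k =>
    ContDiffAt.comp (g := E k) (f := fun w : ℂ => w + (k + 1)) p (hEk k).1.contDiffAt
      (contDiffAt_id.add contDiffAt_const)
  have heq : (fun w => rieszPlus n w ψ) =ᶠ[𝓝 p] fun w => ∑ k ∈ Finset.range (K + 1),
      (fourierConst * (k.factorial : ℂ)⁻¹) * E k (w + (k + 1)) +
        mellinIoi (fun x => (1 - cutoff K x) * ψ x) w := by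
    have ho : {w : ℂ | -1 - n < w.re} ∈ 𝓝 p :=
      (isOpen_lt continuous_const Complex.continuous_re).mem_nhds
        (show -1 - (n : ℝ) < p.re by linarith)
    filter_upwards [ho, eventually_ne_neg_nat hp] with w hw1 hw2
    have hw1 : -1 - n < w.re := hw1
    rw [rieszPlus_fourier_eq hK φ (by linarith) hw2]
    simp only [add_assoc, hE, hθ]
    rfl
  have hgs : ∀ ξ, φ ξ * dampedSum θ l K (p + 1) 1 ξ = ∑ k ∈ Finset.range (K + 1),
      (k.factorial : ℂ)⁻¹ * (φ ξ * derivExp l Complex.Gamma (p + (k + 1))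
        (Complex.log (lineC θ 1 ξ))) := fun ξ => by
    rw [dampedSum, Finset.mul_sum]
    refine Finset.sum_congr rfl fun k _ => ?_
    rw [gammaExp, add_assoc, add_comm (1 : ℂ)]
    push_cast
    rw [one_pow]
    ring
  have hint := integrable_finsetSum (Finset.range (K + 1)) fun k _ =>
    (((hEk k).2 l).1).const_mul ((k.factorial : ℂ)⁻¹)
  refine ⟨hint.congr (Eventually.of_forall fun ξ => (hgs ξ).symm), hMl.1, ?_⟩
  rw [logHom, ← hn, heq.iteratedDeriv_eq, iteratedDeriv_fun_add
    (ContDiffAt.sum fun k _ => contDiffAt_const.mul (hCE k))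
    (hM.contDiffAt_mellinIoi (by linarith) _), hMl.2, iteratedDeriv_fun_sum
    fun k _ => contDiffAt_const.mul (hCE k)]
  congr 1
  have hr : ∀ ξ, φ ξ * (fourierConst * dampedSum θ l K (p + 1) 1 ξ) =
      ∑ k ∈ Finset.range (K + 1), (fourierConst * (k.factorial : ℂ)⁻¹) * (φ ξ *
        derivExp l Complex.Gamma (p + (k + 1)) (Complex.log (lineC θ 1 ξ))) := fun ξ => by
    rw [mul_left_comm, hgs, Finset.mul_sum]
    simp only [mul_assoc]
  simp only [hr]
  rw [integral_finsetSum _ fun k _ => (((hEk k).2 l).1).const_mul _]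
  refine Finset.sum_congr rfl fun k _ => ?_
  rw [iteratedDeriv_const_mul_field, iteratedDeriv_comp_add_const l (E k), integral_const_mul]
  congr 1
  exact ((hEk k).2 l).2

/-! ### Comparison of powers and smooth symbols -/

theorem eventually_ne_nhdsGT : ∀ᶠ x : ℝ in 𝓝[>] 0, x ≠ 0 := by
  filter_upwards [self_mem_nhdsWithin] with x hx using ne_of_gt hx

theorem rpow_isBigO_nhdsGT {α β : ℝ} (h : β ≤ α) :
    (fun x : ℝ => |x| ^ α) =O[𝓝[>] 0] fun x => |x| ^ β := by
  refine IsBigO.of_bound 1 ?_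
  filter_upwards [Ioo_mem_nhdsGT (one_pos (α := ℝ))] with x hx
  rw [abs_of_pos hx.1, one_mul, Real.norm_of_nonneg (Real.rpow_nonneg hx.1.le _),
    Real.norm_of_nonneg (Real.rpow_nonneg hx.1.le _)]
  exact Real.rpow_le_rpow_of_exponent_ge hx.1 hx.2.le h

theorem rpow_isBigO_infty {F : Filter ℝ} (hF : ∀ᶠ x in F, 1 ≤ |x|) {α β : ℝ} (h : α ≤ β) :
    (fun x : ℝ => |x| ^ α) =O[F] fun x => |x| ^ β := by
  refine IsBigO.of_bound 1 ?_
  filter_upwards [hF] with x hx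
  have h0 : 0 ≤ |x| := abs_nonneg x
  rw [one_mul, Real.norm_of_nonneg (Real.rpow_nonneg h0 _),
    Real.norm_of_nonneg (Real.rpow_nonneg h0 _)]
  exact Real.rpow_le_rpow_of_exponent_le hx h

theorem eventually_one_le_abs_atTop : ∀ᶠ x : ℝ in atTop, 1 ≤ |x| :=
  (eventually_ge_atTop 1).mono fun x hx => hx.trans (le_abs_self x)

theorem eventually_one_le_abs_atBot : ∀ᶠ x : ℝ in atBot, 1 ≤ |x| :=
  (eventually_le_atBot (-1)).mono fun x hx => by
    rw [le_abs]
    right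
    linarith

theorem isSymbol_of_contDiff {g : ℝ → ℂ} (hg : ContDiff ℝ ∞ g) : IsSymbol (𝓝[>] 0) 0 g where
  smooth := eventually_ne_nhdsGT.mono fun x hx => ⟨hx, hg.contDiffAt⟩
  bound k := by
    have h1 : iteratedDeriv k g =O[𝓝[>] 0] fun _ => (1 : ℝ) :=
      (((hg.continuous_iteratedDeriv k (mod_cast le_top)).tendsto 0).isBigO_one ℝ).mono
        nhdsWithin_le_nhds
    have h2 := rpow_isBigO_nhdsGT (α := 0) (β := 0 - k) (by simp)
    simp only [Real.rpow_zero] at h2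
    exact h1.trans h2

theorem isSymbol_of_deriv {F : Filter ℝ} {α : ℝ} {g g' : ℝ → ℂ} (hg : g =O[F] fun x => |x| ^ α)
    (hc : ContDiff ℝ ∞ g) (hd : deriv g = g') (hg' : IsSymbol F (α - 1) g') :
    IsSymbol F α g where
  smooth := hg'.ne_zero.mono fun x hx => ⟨hx, hc.contDiffAt⟩
  bound k := by
    rcases k with _ | k
    · simpa using hg
    · rw [iteratedDeriv_succ', hd]
      refine (hg'.bound k).congr_right fun x => ?_
      congr 1
      push_cast
      ring

theorem contDiff_exp_neg : ContDiff ℝ ∞ (fun x : ℝ => Complex.exp (-x)) := by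
  have h : ContDiff ℝ ∞ (fun x : ℝ => (x : ℂ)) := Complex.ofRealCLM.contDiff
  exact h.neg.cexp

/-- The derivative is exactly `exp (-x) * x ^ K / K!`, a symbol of order `K`, so only the function
itself needs the mean value bound. -/
theorem isSymbol_one_sub_cutoff (K : ℕ) :
    IsSymbol (𝓝[>] 0) (K + 1) (fun x => 1 - cutoff K x) := by
  refine isSymbol_of_deriv (g' := fun x : ℝ => Complex.exp (-x) * ((x : ℂ) ^ K / K.factorial))
    ?_ (contDiff_const.sub (contDiff_cutoff K)) ?_ ?_
  · refine IsBigO.of_bound 1 ?_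
    filter_upwards [self_mem_nhdsWithin] with x hx
    have hx : 0 < x := hx
    rw [one_mul, abs_of_pos hx, Real.norm_of_nonneg (Real.rpow_nonneg hx.le _)]
    exact_mod_cast norm_one_sub_cutoff_le K hx.le
  · ext x
    have := ((hasDerivAt_cutoff K x).const_sub 1).deriv
    rw [neg_neg] at this
    exact this
  · have h := (isSymbol_of_contDiff contDiff_exp_neg).mul
      ((IsSymbol.pow eventually_ne_nhdsGT K).const_mul ((K.factorial : ℂ)⁻¹))
    rw [zero_add] at h
    rw [add_sub_cancel_right]
    simpa only [div_eq_inv_mul] using h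

theorem isSymbol_exp_neg (M : ℝ) : IsSymbol atTop M (fun x : ℝ => Complex.exp (-x)) where
  smooth := (eventually_ne_atTop 0).mono fun x hx => ⟨hx, contDiff_exp_neg.contDiffAt⟩
  bound k := by
    have e : iteratedDeriv k (fun x : ℝ => Complex.exp (-x)) =
        fun x : ℝ => (-1) ^ k * Complex.exp (-x) := by
      induction k with
      | zero => simp
      | succ k ih =>
        rw [iteratedDeriv_succ, ih]
        ext x
        have := ((Complex.ofRealCLM.hasDerivAt (x := x)).neg.cexp).const_mul ((-1 : ℂ) ^ k)
        refine this.deriv.trans ?_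
        simp [pow_succ]
    rw [e]
    have h1 := (isLittleO_exp_neg_mul_rpow_atTop one_pos (M - k)).isBigO
    refine IsBigO.trans (IsBigO.of_bound 1 (Eventually.of_forall fun x => ?_))
      (h1.congr' EventuallyEq.rfl ?_)
    · rw [norm_mul, norm_pow, norm_neg, norm_one, one_pow, Complex.norm_exp]
      simp
    · filter_upwards [eventually_gt_atTop 0] with x hx
      rw [abs_of_pos hx]

theorem isSymbol_cutoff_atTop (K : ℕ) (M : ℝ) : IsSymbol atTop M (cutoff K) := by
  have h0 := eventually_ne_atTop (0 : ℝ)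
  have e : cutoff K = fun x : ℝ => ∑ k ∈ Finset.range (K + 1),
      (k.factorial : ℂ)⁻¹ * (Complex.exp (-x) * (x : ℂ) ^ k) := by
    ext x
    rw [cutoff, Finset.mul_sum]
    refine Finset.sum_congr rfl fun k _ => ?_
    ring
  rw [e]
  refine IsSymbol.sum h0 fun k _ => IsSymbol.const_mul ?_ _
  have := (isSymbol_exp_neg (M - k)).mul (IsSymbol.pow h0 k)
  rwa [sub_add_cancel] at this

/-! ### Functions on the half-line that are flat at zero -/

/-- `w` is smooth on `(0, ∞)`, a symbol of order `α` at `0` and rapidly decreasing at infinity with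
all derivatives. -/
structure FlatRapid (α : ℝ) (w : ℝ → ℂ) : Prop where
  smooth : ContDiffOn ℝ ∞ w (Set.Ioi 0)
  zero : IsSymbol (𝓝[>] 0) α w
  top : ∀ M : ℝ, IsSymbol atTop M w

namespace FlatRapid

variable {α : ℝ} {w : ℝ → ℂ}

theorem contDiffAt (hw : FlatRapid α w) {x : ℝ} (hx : 0 < x) : ContDiffAt ℝ ∞ w x :=
  hw.smooth.contDiffAt (isOpen_Ioi.mem_nhds hx)

theorem deriv (hw : FlatRapid α w) : FlatRapid (α - 1) (deriv w) := by
  have hn : ∀ x : ℝ, 0 < x → ∀ᶠ y in 𝓝 x, ContDiffAt ℝ ∞ w y := fun x hx => by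
    filter_upwards [isOpen_Ioi.mem_nhds hx] with y hy using hw.contDiffAt hy
  refine ⟨((contDiffOn_infty_iff_deriv_of_isOpen isOpen_Ioi).1 hw.smooth).2, ?_, fun M => ?_⟩
  · have := hw.zero.iteratedDeriv_symbol (by
      filter_upwards [self_mem_nhdsWithin] with x hx using hn x hx) 1
    rwa [iteratedDeriv_one, Nat.cast_one] at this
  · have := (hw.top (M + 1)).iteratedDeriv_symbol (by
      filter_upwards [eventually_gt_atTop 0] with x hx using hn x hx) 1
    rwa [iteratedDeriv_one, Nat.cast_one, add_sub_cancel_right] at this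

theorem pow_mul (hw : FlatRapid α w) (k : ℕ) : FlatRapid (α + k) (fun x => (x : ℂ) ^ k * w x) where
  smooth := ((Complex.ofRealCLM.contDiff.contDiffOn).pow k).mul hw.smooth
  zero := by
    rw [add_comm]
    exact (IsSymbol.pow eventually_ne_nhdsGT k).mul hw.zero
  top M := by
    have := (IsSymbol.pow (eventually_ne_atTop 0) k).mul (hw.top (M - k))
    rwa [add_sub_cancel] at this

theorem rapidBound (hw : FlatRapid α w) : RapidBound α w where
  cont := hw.smooth.continuousOn
  bound m := by
    have hpos : ∀ x : ℝ, 0 < x → ‖(((1 + x) ^ m : ℝ) : ℂ)‖ = (1 + x) ^ m := fun x hx => by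
      rw [Complex.norm_real, Real.norm_of_nonneg (by positivity)]
    obtain ⟨C, hC0, hC⟩ := exists_bound_Ioi (g := fun x => (((1 + x) ^ m : ℝ) : ℂ) * w x)
      (a := α) (b := α) (ContinuousOn.mul (by fun_prop) hw.smooth.continuousOn) (by
        have h1 : (fun x : ℝ => (((1 + x) ^ m : ℝ) : ℂ)) =O[𝓝[>] 0] fun _ => (1 : ℝ) := by
          refine IsBigO.mono ?_ nhdsWithin_le_nhds
          exact (Continuous.tendsto (by fun_prop) 0).isBigO_one ℝ
        refine (h1.mul hw.zero.isBigO).congr' EventuallyEq.rfl ?_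
        filter_upwards [self_mem_nhdsWithin] with x hx
        rw [one_mul, abs_of_pos hx]) (by
        have h1 : (fun x : ℝ => (((1 + x) ^ m : ℝ) : ℂ)) =O[atTop] fun x => |x| ^ (m : ℝ) := by
          refine IsBigO.of_bound (2 ^ m) ?_
          filter_upwards [eventually_ge_atTop 1] with x hx
          rw [hpos x (by linarith), abs_of_pos (by linarith), Real.rpow_natCast,
            Real.norm_of_nonneg (by positivity), ← mul_pow]
          exact pow_le_pow_left₀ (by linarith) (by linarith) m
        refine (h1.mul (hw.top (α - m)).isBigO).congr' EventuallyEq.rfl ?_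
        filter_upwards [eventually_gt_atTop 0] with x hx
        rw [abs_of_pos hx, ← Real.rpow_add hx, add_sub_cancel])
    refine ⟨C * 2, by positivity, fun x hx => ?_⟩
    have := hC x hx
    rw [norm_mul, hpos x hx] at this
    rw [Real.rpow_neg (by positivity), Real.rpow_natCast, ← mul_assoc, ← div_eq_mul_inv,
      le_div_iff₀ (by positivity)]
    linarith

theorem integrableOn (hw : FlatRapid α w) (hα : -1 < α) : IntegrableOn w (Set.Ioi 0) := by
  simpa using hw.rapidBound.integrableOn_cpow_mul (w := 0) (by simpa using hα)

/-- Integration by parts; positivity of `α` kills the boundary term at zero and makes the derivative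
integrable. -/
theorem halfFourier_deriv (hw : FlatRapid α w) (hα : 0 < α) (θ ξ : ℝ) :
    halfFourier θ (_root_.deriv w) ξ = Complex.I * θ * ξ * halfFourier θ w ξ := by
  have hbdd : ∀ {g : ℝ → ℂ}, IntegrableOn g (Set.Ioi 0) →
      IntegrableOn (fun x : ℝ => Complex.exp (-(Complex.I * θ * ξ * x)) * g x) (Set.Ioi 0) :=
    fun hg => hg.bdd_mul (c := 1) (Continuous.aestronglyMeasurable (by fun_prop))
      (Eventually.of_forall fun x => (norm_exp_I_mul _ _ _).le)
  have hu : ∀ x ∈ Set.Ioi (0 : ℝ), HasDerivAt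
      (fun x : ℝ => Complex.exp (-(Complex.I * θ * ξ * x)))
      (-(Complex.I * θ * ξ) * Complex.exp (-(Complex.I * θ * ξ * x))) x := fun x _ => by
    refine (((Complex.ofRealCLM.hasDerivAt (x := x)).const_mul
      (Complex.I * θ * ξ)).neg.cexp).congr_deriv ?_
    simp
    ring
  have hnorm : ∀ x : ℝ, ‖((fun x : ℝ => Complex.exp (-(Complex.I * θ * ξ * x))) * w) x‖ =
      ‖w x‖ := fun x => by
    rw [Pi.mul_apply, norm_mul, norm_exp_I_mul, one_mul]
  have h := integral_Ioi_mul_deriv_eq_deriv_mul hu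
    (fun x hx => ((hw.contDiffAt hx).differentiableAt (by simp)).hasDerivAt)
    (hbdd (hw.deriv.integrableOn (by linarith)))
    (by
      have := (hbdd (hw.integrableOn (by linarith))).const_mul (-(Complex.I * θ * ξ))
      simpa only [Pi.mul_def, mul_assoc] using! this)
    (a' := 0) (b' := 0) (by
      rw [tendsto_zero_iff_norm_tendsto_zero]
      simp only [hnorm]
      have := hw.rapidBound.tendsto_cpow_mul_zero (w := 0) (by simpa using hα)
      simpa using this.norm) (by
      rw [tendsto_zero_iff_norm_tendsto_zero]
      simp only [hnorm]
      have := hw.rapidBound.tendsto_cpow_mul_atTop 0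
      simpa using this.norm)
  rw [halfFourier, h, halfFourier, sub_zero, zero_sub, mul_left_comm, ← integral_const_mul,
    ← integral_neg]
  congr 2
  ext x
  ring

/-- Each factor `|ξ|` costs one derivative and one order of flatness. The condition `m < α + 1`
leaves an integrable function after `m` steps. -/
theorem norm_halfFourier_le (θ : ℝ) (hθ : |θ| = 1) (m : ℕ) : ∀ {α : ℝ} {w : ℝ → ℂ}
    (_ : FlatRapid α w) (_ : m < α + 1),
    ∃ C : ℝ, 0 ≤ C ∧ ∀ ξ : ℝ, |ξ| ^ m * ‖halfFourier θ w ξ‖ ≤ C := by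
  induction m with
  | zero =>
    intro α w hw hα
    refine ⟨‖fourierConst‖ * ∫ x in Set.Ioi (0 : ℝ), ‖w x‖,
      mul_nonneg (norm_nonneg _) (integral_nonneg fun x => norm_nonneg _), fun ξ => ?_⟩
    rw [pow_zero, one_mul, halfFourier, norm_mul]
    refine mul_le_mul_of_nonneg_left ((norm_integral_le_integral_norm _).trans (le_of_eq ?_))
      (norm_nonneg _)
    simp only [norm_mul, norm_exp_I_mul, one_mul]
  | succ m ih =>
    intro α w hw hα
    push_cast at hα
    obtain ⟨C, hC0, hC⟩ := ih hw.deriv (by linarith)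
    refine ⟨C, hC0, fun ξ => ?_⟩
    have := hC ξ
    rw [hw.halfFourier_deriv (by linarith [(Nat.cast_nonneg m : (0 : ℝ) ≤ m)]), norm_mul, norm_mul,
      norm_mul, Complex.norm_I, Complex.norm_real, Complex.norm_real, Real.norm_eq_abs,
      Real.norm_eq_abs, hθ, one_mul, one_mul] at this
    rwa [pow_succ, mul_assoc]

theorem hasDerivAt_halfFourier (hw : FlatRapid α w) (hα : -1 < α) (θ ξ : ℝ) :
    HasDerivAt (halfFourier θ w)
      (-(Complex.I * θ) * halfFourier θ (fun x : ℝ => (x : ℂ) ^ 1 * w x) ξ) ξ := by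
  have h1 := (hw.pow_mul 1).integrableOn (by push_cast; linarith)
  have h0 := hw.integrableOn hα
  have key := hasDerivAt_integral_of_dominated_loc_of_deriv_le (μ := volume.restrict (Set.Ioi 0))
    (F := fun ξ x : ℝ => Complex.exp (-(Complex.I * θ * ξ * x)) * w x)
    (F' := fun ξ x : ℝ => -(Complex.I * θ) * (Complex.exp (-(Complex.I * θ * ξ * x)) *
      ((x : ℂ) ^ 1 * w x))) (bound := fun x : ℝ => |θ| * ‖(x : ℂ) ^ 1 * w x‖) (x₀ := ξ)
    (s := Set.univ) univ_mem
    (Eventually.of_forall fun ξ => (Continuous.aestronglyMeasurable (by fun_prop)).mul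
      h0.aestronglyMeasurable)
    (h0.bdd_mul (c := 1) (Continuous.aestronglyMeasurable (by fun_prop))
      (Eventually.of_forall fun x => (norm_exp_I_mul _ _ _).le))
    (((Continuous.aestronglyMeasurable (by fun_prop)).mul h1.aestronglyMeasurable).const_mul _)
    (Eventually.of_forall fun x ξ _ => by
      rw [norm_mul, norm_mul, norm_exp_I_mul, norm_neg, norm_mul, Complex.norm_I,
        Complex.norm_real, one_mul, one_mul, Real.norm_eq_abs])
    (h1.norm.const_mul _)
    (Eventually.of_forall fun x ξ _ => by
      have := (((((Complex.ofRealCLM.hasDerivAt (x := ξ)).const_mul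
        (Complex.I * θ)).mul_const (x : ℂ)).neg.cexp).mul_const (w x))
      refine this.congr_deriv ?_
      simp
      ring)
  refine (key.2.const_mul fourierConst).congr_deriv ?_
  rw [integral_const_mul, halfFourier]
  ring

theorem hasDerivAt_halfFourier_pow (hw : FlatRapid α w) (hα : -1 < α) (θ : ℝ) (n : ℕ) (ξ : ℝ) :
    HasDerivAt (halfFourier θ (fun x : ℝ => (x : ℂ) ^ n * w x))
      (-(Complex.I * θ) * halfFourier θ (fun x : ℝ => (x : ℂ) ^ (n + 1) * w x) ξ) ξ := by
  have := (hw.pow_mul n).hasDerivAt_halfFourier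
    (by linarith [(Nat.cast_nonneg n : (0 : ℝ) ≤ n)]) θ ξ
  simpa only [← mul_assoc, ← pow_add, add_comm 1 n] using this

theorem contDiff_halfFourier (hw : FlatRapid α w) (hα : -1 < α) (θ : ℝ) :
    ContDiff ℝ ∞ (halfFourier θ w) := by
  rw [← contDiffOn_univ]
  have := contDiff_of_hasDerivAt_shift (f := fun n => halfFourier θ (fun x : ℝ => (x : ℂ) ^ n * w x))
    isOpen_univ (fun n ξ _ => hw.hasDerivAt_halfFourier_pow hα θ n ξ) 0
  simpa using this

theorem iteratedDeriv_halfFourier (hw : FlatRapid α w) (hα : -1 < α) (θ : ℝ) (k : ℕ) :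
    iteratedDeriv k (halfFourier θ w) =
      fun ξ => (-(Complex.I * θ)) ^ k * halfFourier θ (fun x : ℝ => (x : ℂ) ^ k * w x) ξ := by
  induction k with
  | zero => simp
  | succ k ih =>
    ext ξ
    rw [iteratedDeriv_succ, ih, ((hw.hasDerivAt_halfFourier_pow hα θ k ξ).const_mul _).deriv]
    ring

/-- Differentiating `k` times in `ξ` multiplies `w` by `x ^ k`. The order at zero rises to `α + k`,
which allows `m + k` integrations by parts. -/
theorem isSymbol_halfFourier (hw : FlatRapid α w) {θ : ℝ} (hθ : |θ| = 1) {m : ℕ} (hm : m < α + 1)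
    {F : Filter ℝ} (hF : ∀ᶠ ξ in F, 1 ≤ |ξ|) : IsSymbol F (-m) (halfFourier θ w) where
  smooth := by
    have hα : -1 < α := by linarith [(Nat.cast_nonneg m : (0 : ℝ) ≤ m)]
    filter_upwards [hF] with ξ hξ
    exact ⟨abs_pos.1 (one_pos.trans_le hξ), (hw.contDiff_halfFourier hα θ).contDiffAt⟩
  bound k := by
    have hα : -1 < α := by linarith [(Nat.cast_nonneg m : (0 : ℝ) ≤ m)]
    obtain ⟨C, hC0, hC⟩ := norm_halfFourier_le θ hθ (m + k) (hw.pow_mul k)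
      (by push_cast; linarith)
    rw [hw.iteratedDeriv_halfFourier hα]
    refine IsBigO.of_bound C ?_
    filter_upwards [hF] with ξ hξ
    have hpos : 0 < |ξ| := one_pos.trans_le hξ
    have e : |ξ| ^ (-(m : ℝ) - k) = (|ξ| ^ (m + k))⁻¹ := by
      rw [← neg_add', Real.rpow_neg hpos.le]
      exact_mod_cast rfl
    rw [e, Real.norm_of_nonneg (by positivity), ← div_eq_mul_inv, le_div_iff₀ (by positivity),
      mul_comm, norm_mul, norm_pow, norm_neg, norm_mul, Complex.norm_I, Complex.norm_real,
      Real.norm_eq_abs, hθ, one_mul, one_pow, one_mul]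
    exact hC ξ

end FlatRapid

/-! ### Expansions at zero as symbol estimates -/

/-- The indices `(j, k)` of the terms of the `N`-th partial sum. -/
def termSet (P : PowerSeq) (N : ℕ) : Finset (Σ _ : ℕ, ℕ) :=
  (Finset.range N).sigma fun j => Finset.range ((P j).2 + 1)

theorem lt_of_mem_termSet {P : PowerSeq} {N : ℕ} {t : Σ _ : ℕ, ℕ} (ht : t ∈ termSet P N) :
    t.1 < N :=
  Finset.mem_range.1 (Finset.mem_sigma.1 ht).1

theorem partialSum_eq_sum_termSet (ℓ : ℝ → ℂ) (P : PowerSeq) (a : ℕ → ℕ → ℂ) (N : ℕ) (x : ℝ) :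
    partialSum ℓ P a N x = ∑ t ∈ termSet P N, a t.1 t.2 * logPow ℓ (P t.1).1 t.2 x := by
  rw [partialSum_eq_logPow, termSet, Finset.sum_sigma']

theorem IsPowerSetZero.monotone {P : PowerSeq} (hP : IsPowerSetZero P) :
    Monotone fun j => (P j).1.re :=
  monotone_nat_of_le_succ hP.mono

theorem contDiffOn_logPow_logAbs (p : ℂ) (k : ℕ) :
    ContDiffOn ℝ ∞ (logPow logAbs p k) (Set.Ioi 0) := fun _ hx =>
  (isLogOn_logAbs_Ioi.contDiffAt_logPow hx p k).contDiffWithinAt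

theorem contDiffOn_partialSum (P : PowerSeq) (a : ℕ → ℕ → ℂ) (N : ℕ) :
    ContDiffOn ℝ ∞ (partialSum logAbs P a N) (Set.Ioi 0) := by
  have e : partialSum logAbs P a N = fun x => ∑ t ∈ termSet P N,
      a t.1 t.2 * logPow logAbs (P t.1).1 t.2 x :=
    funext (partialSum_eq_sum_termSet logAbs P a N)
  rw [e]
  exact ContDiffOn.sum fun t _ => contDiffOn_const.mul (contDiffOn_logPow_logAbs _ _)

theorem IsSmoothRapid.isSymbol_atTop {u : ℝ → ℂ} (hu : IsSmoothRapid u) (M : ℝ) :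
    IsSymbol atTop M u where
  smooth := by
    filter_upwards [eventually_gt_atTop 0] with x hx
    exact ⟨hx.ne', hu.smooth.contDiffAt (isOpen_Ioi.mem_nhds hx)⟩
  bound k := by
    obtain ⟨C, hC⟩ := hu.decay ⌈k - M⌉₊ k
    refine IsBigO.of_bound C ?_
    filter_upwards [eventually_ge_atTop 1] with x hx
    have h0 : 0 < x := by linarith
    have h1 : (0 : ℝ) < x ^ ⌈k - M⌉₊ := by positivity
    have hC0 : 0 ≤ C := le_trans (by positivity) (hC 1 le_rfl)
    calc ‖iteratedDeriv k u x‖ ≤ C / x ^ ⌈k - M⌉₊ := by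
          rw [le_div_iff₀ h1, mul_comm]
          exact hC x hx
      _ = C * x ^ (-(⌈k - M⌉₊ : ℝ)) := by
          rw [Real.rpow_neg h0.le, Real.rpow_natCast, div_eq_mul_inv]
      _ ≤ C * ‖|x| ^ (M - k)‖ := by
          rw [abs_of_pos h0, Real.norm_of_nonneg (by positivity)]
          refine mul_le_mul_of_nonneg_left (Real.rpow_le_rpow_of_exponent_le hx ?_) hC0
          linarith [Nat.le_ceil (k - M)]

theorem InSchwartzP.isSymbol_remainder {P : PowerSeq} {a : ℕ → ℕ → ℂ} {u : ℝ → ℂ}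
    (h : InSchwartzP P a u) {N : ℕ} {s : ℝ} (hs : s < (P N).1.re) :
    IsSymbol (𝓝[>] 0) s (fun x => u x - partialSum logAbs P a N x) where
  smooth := by
    filter_upwards [self_mem_nhdsWithin] with x hx
    exact ⟨ne_of_gt hx, (h.1.smooth.sub (contDiffOn_partialSum P a N)).contDiffAt
      (isOpen_Ioi.mem_nhds hx)⟩
  bound k := by
    refine (h.2 N k ((P N).1.re - s) (by linarith)).congr' EventuallyEq.rfl ?_
    filter_upwards [self_mem_nhdsWithin] with x hx
    rw [abs_of_pos hx, sub_sub_cancel]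

theorem isBigO_partialSum_atTop {P : PowerSeq} (hP : IsPowerSetZero P) (a : ℕ → ℕ → ℂ) {N : ℕ}
    {b : ℝ} (hb : (P N).1.re < b) : partialSum logAbs P a N =O[atTop] fun x => |x| ^ b := by
  have e : partialSum logAbs P a N = fun x => ∑ t ∈ termSet P N,
      a t.1 t.2 * logPow logAbs (P t.1).1 t.2 x :=
    funext (partialSum_eq_sum_termSet logAbs P a N)
  rw [e]
  refine IsBigO.fun_sum fun t ht => IsBigO.const_mul_left (IsSymbol.isBigO ?_) _
  exact isSymbol_logPow_atTop
    ((hP.monotone (lt_of_mem_termSet ht).le).trans_lt hb) _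

theorem InSchwartzP.exists_integrableOn_remainder {P : PowerSeq} (hP : IsPowerSetZero P)
    {a : ℕ → ℕ → ℂ} {u : ℝ → ℂ} (h : InSchwartzP P a u) {N : ℕ} (hN : -1 < (P N).1.re) :
    ∃ m : ℕ, IntegrableOn (fun x : ℝ => (u x - partialSum logAbs P a N x) *
      ((1 + x) ^ (-(m : ℝ)) : ℝ)) (Set.Ioi 0) := by
  obtain ⟨s, hs1, hs2⟩ := exists_between hN
  refine exists_integrableOn_mul_one_add (s := s) (b := (P N).1.re + 1)
    (h.1.smooth.sub (contDiffOn_partialSum P a N)).continuousOn hs1 (by linarith)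
    (h.isSymbol_remainder hs2).isBigO ?_
  exact (h.1.isSymbol_atTop _).isBigO.sub (isBigO_partialSum_atTop hP a (by linarith))

theorem InSchwartzP.integrableOn_remainder_mul {P : PowerSeq} (hP : IsPowerSetZero P)
    {a : ℕ → ℕ → ℂ} {u : ℝ → ℂ} (h : InSchwartzP P a u) {N : ℕ} (hN : -1 < (P N).1.re)
    (ψ : 𝓢(ℝ, ℂ)) :
    IntegrableOn (fun x => (u x - partialSum logAbs P a N x) * ψ x) (Set.Ioi 0) := by
  obtain ⟨m, hm⟩ := h.exists_integrableOn_remainder hP hN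
  exact integrableOn_mul_schwartz hm ψ

/-! ### The extension by zero -/

/-- The extension by zero of `u`, defined with the first `N` terms of the expansion. -/
def extForm (P : PowerSeq) (a : ℕ → ℕ → ℂ) (u : ℝ → ℂ) (N : ℕ) (ψ : ℝ → ℂ) : ℂ :=
  (∑ t ∈ termSet P N, a t.1 t.2 * logHom (P t.1).1 t.2 ψ) +
    ∫ x in Set.Ioi (0 : ℝ), (u x - partialSum logAbs P a N x) * ψ x

theorem isExtension_iff {σ : ℤˣ} {P : PowerSeq} {u : ℝ → ℂ} {T : 𝓢'(ℝ, ℂ)} :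
    IsExtension σ P u T ↔ ∃ (a : ℕ → ℕ → ℂ) (N : ℕ), InSchwartzP P a (reflect σ u) ∧
      -1 < (P N).1.re ∧ ∀ φ : 𝓢(ℝ, ℂ), T φ = extForm P a (reflect σ u) N (reflect σ φ) := by
  simp only [IsExtension, extForm, termSet, Finset.sum_sigma]

/-- The term that changes place has `Re p N > -1`, so as a homogeneous distribution it is an
ordinary integral. -/
theorem extForm_eq_sum_add {P : PowerSeq} (hP : IsPowerSetZero P)
    {a : ℕ → ℕ → ℂ} {u : ℝ → ℂ} (h : InSchwartzP P a u) {N : ℕ} (hN : -1 < (P N).1.re)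
    (ψ : 𝓢(ℝ, ℂ)) : extForm P a u N ψ = extForm P a u (N + 1) ψ := by
  have hN1 : -1 < (P (N + 1)).1.re := hN.trans_le (hP.mono N)
  have e : ∀ x, partialSum logAbs P a (N + 1) x = partialSum logAbs P a N x +
      ∑ k ∈ Finset.range ((P N).2 + 1), a N k * logPow logAbs (P N).1 k x := fun x => by
    rw [partialSum_eq_logPow, partialSum_eq_logPow, Finset.sum_range_succ]
  have hI : ∀ k, IntegrableOn (fun x => a N k * (logPow logAbs (P N).1 k x * ψ x)) (Set.Ioi 0) :=
    fun k => (integrableOn_logPow_mul_schwartz hN k ψ).const_mul _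
  have h1 : (∫ x in Set.Ioi (0 : ℝ), (u x - partialSum logAbs P a N x) * ψ x) =
      (∫ x in Set.Ioi (0 : ℝ), (u x - partialSum logAbs P a (N + 1) x) * ψ x) +
        ∑ k ∈ Finset.range ((P N).2 + 1), a N k * logHom (P N).1 k ψ := by
    simp_rw [logHom_eq_integral hN, ← integral_const_mul]
    rw [← integral_finsetSum _ fun k _ => hI k, ← integral_add
      (h.integrableOn_remainder_mul hP hN1 ψ) (integrable_finsetSum _ fun k _ => hI k)]
    congr 1
    ext x
    simp only [e, ← mul_assoc, ← Finset.sum_mul]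
    ring
  rw [extForm, extForm, h1]
  simp only [termSet, Finset.sum_sigma]
  rw [Finset.sum_range_succ _ N]
  ring

theorem extForm_eq_of_le {P : PowerSeq} (hP : IsPowerSetZero P)
    {a : ℕ → ℕ → ℂ} {u : ℝ → ℂ} (h : InSchwartzP P a u) {N N' : ℕ} (hN : -1 < (P N).1.re)
    (hNN : N ≤ N') (ψ : 𝓢(ℝ, ℂ)) : extForm P a u N ψ = extForm P a u N' ψ := by
  induction N', hNN using Nat.le_induction with
  | base => rfl
  | succ n hn ih => rw [ih, extForm_eq_sum_add hP h (hN.trans_le (hP.monotone hn))]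

theorem extForm_eq {P : PowerSeq} (hP : IsPowerSetZero P)
    {a : ℕ → ℕ → ℂ} {u : ℝ → ℂ} (h : InSchwartzP P a u) {N N' : ℕ} (hN : -1 < (P N).1.re)
    (hN' : -1 < (P N').1.re) (ψ : 𝓢(ℝ, ℂ)) : extForm P a u N ψ = extForm P a u N' ψ :=
  (extForm_eq_of_le hP h hN (le_max_left N N') ψ).trans
    (extForm_eq_of_le hP h hN' (le_max_right N N') ψ).symm

/-! ### The Fourier transform of an extension -/

/-- `u` minus the first `N` terms of its expansion, each cut off at infinity. -/
def dampedRemainder (P : PowerSeq) (a : ℕ → ℕ → ℂ) (u : ℝ → ℂ) (N K : ℕ) (x : ℝ) : ℂ :=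
  u x - ∑ t ∈ termSet P N, a t.1 t.2 * (logPow logAbs (P t.1).1 t.2 x * cutoff K x)

theorem dampedRemainder_eq (P : PowerSeq) (a : ℕ → ℕ → ℂ) (u : ℝ → ℂ) (N K : ℕ) (x : ℝ) :
    dampedRemainder P a u N K x = (u x - partialSum logAbs P a N x) +
      ∑ t ∈ termSet P N, a t.1 t.2 * (logPow logAbs (P t.1).1 t.2 x * (1 - cutoff K x)) := by
  simp only [dampedRemainder, partialSum_eq_sum_termSet, mul_sub, mul_one, Finset.sum_sub_distrib]
  ring

/-- At zero the true remainder has any order below `Re p N`, and each error `x ^ (p j) * ln x ^ k *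
(1 - cutoff)` has any order below `Re p j + K + 1`, with `Re p j ≥ Re p 0`. At infinity the cutoff
removes the growth of the partial sum. -/
theorem InSchwartzP.flatRapid {P : PowerSeq} (hP : IsPowerSetZero P)
    {a : ℕ → ℕ → ℂ} {u : ℝ → ℂ} (h : InSchwartzP P a u) {N K : ℕ} {α : ℝ} (hα : α < (P N).1.re)
    (hα' : α < (P 0).1.re + K + 1) : FlatRapid α (dampedRemainder P a u N K) where
  smooth := h.1.smooth.sub (ContDiffOn.sum fun t _ => contDiffOn_const.mul
    ((contDiffOn_logPow_logAbs _ _).mul (contDiff_cutoff K).contDiffOn))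
  zero := by
    rw [funext (dampedRemainder_eq P a u N K)]
    refine (h.isSymbol_remainder hα).add (IsSymbol.sum eventually_ne_nhdsGT fun t _ =>
      IsSymbol.const_mul ?_ _)
    have h0 := hP.monotone (Nat.zero_le t.1)
    have := (isSymbol_logPow_zero (s := α - (K + 1)) (p := (P t.1).1)
      (by dsimp only at h0; linarith) t.2).mul (isSymbol_one_sub_cutoff K)
    rwa [sub_add_cancel] at this
  top M := by
    refine (h.1.isSymbol_atTop M).sub (IsSymbol.sum (eventually_ne_atTop 0) fun t _ =>
      IsSymbol.const_mul ?_ _)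
    have := (isSymbol_logPow_atTop (s := (P t.1).1.re + 1) (p := (P t.1).1)
      (by linarith) t.2).mul (isSymbol_cutoff_atTop K (M - ((P t.1).1.re + 1)))
    rwa [add_sub_cancel] at this

theorem FlatRapid.integrable_mul_halfFourier {α : ℝ} {w : ℝ → ℂ} (hw : FlatRapid α w)
    (hα : -1 < α) {θ : ℝ} (hθ : |θ| = 1) (φ : 𝓢(ℝ, ℂ)) :
    Integrable (fun ξ => φ ξ * halfFourier θ w ξ) := by
  obtain ⟨C, -, hC⟩ := norm_halfFourier_le θ hθ 0 hw (by simpa using neg_lt_iff_pos_add.1 hα)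
  refine φ.integrable.mul_bdd (c := C)
    (hw.contDiff_halfFourier hα θ).continuous.aestronglyMeasurable
    (Eventually.of_forall fun ξ => ?_)
  simpa using hC ξ

/-- The function that represents the Fourier transform of an extension by zero. -/
def transformFun (θ : ℝ) (P : PowerSeq) (a : ℕ → ℕ → ℂ) (u : ℝ → ℂ) (N K : ℕ) (ξ : ℝ) : ℂ :=
  (∑ t ∈ termSet P N, a t.1 t.2 * (fourierConst * dampedSum θ t.2 K ((P t.1).1 + 1) 1 ξ)) +
    halfFourier θ (dampedRemainder P a u N K) ξ

/-- The integrals with `1 - cutoff` left over by `logHom_fourier_eq` are exactly those by which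
`dampedRemainder` exceeds the undamped remainder. -/
theorem extForm_fourier {P : PowerSeq} (hP : IsAppropriate P) {a : ℕ → ℕ → ℂ} {u : ℝ → ℂ}
    (h : InSchwartzP P a u) {N K : ℕ} (hN : -1 < (P N).1.re) (hK : -(P 0).1.re ≤ K) (σ : ℤˣ)
    (φ : 𝓢(ℝ, ℂ)) :
    Integrable (fun ξ => φ ξ * transformFun ((σ : ℤ) : ℝ) P a u N K ξ) ∧
    extForm P a u N (reflectS σ (fourierS φ)) =
      ∫ ξ : ℝ, φ ξ * transformFun ((σ : ℤ) : ℝ) P a u N K ξ := by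
  obtain ⟨α, hα1, hα2⟩ := exists_between (lt_min hN (show -1 < (P 0).1.re + K + 1 by linarith))
  have hw := h.flatRapid hP.isPowerSet (K := K) (hα2.trans_le (min_le_left _ _))
    (hα2.trans_le (min_le_right _ _))
  have hKj : ∀ j, ⌈-(P j).1.re⌉₊ ≤ K := fun j => Nat.ceil_le.2 (by
    have := hP.isPowerSet.monotone (Nat.zero_le j)
    dsimp only at this
    linarith)
  have hl := fun t : (Σ _ : ℕ, ℕ) =>
    logHom_fourier_eq (σ := σ) (hP.not_neg_int t.1) t.2 (hKj t.1) φ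
  have hwi := hw.integrable_mul_halfFourier hα1 (abs_units_cast σ) φ
  have hdi : ∀ t : (Σ _ : ℕ, ℕ), Integrable (fun ξ => a t.1 t.2 *
      (φ ξ * (fourierConst * dampedSum ((σ : ℤ) : ℝ) t.2 K ((P t.1).1 + 1) 1 ξ))) := fun t => by
    refine Integrable.const_mul ?_ _
    simpa only [mul_left_comm] using (hl t).1.const_mul fourierConst
  have hri := h.integrableOn_remainder_mul hP.isPowerSet hN (reflectS σ (fourierS φ))
  have hci : ∀ t : (Σ _ : ℕ, ℕ), IntegrableOn (fun x => a t.1 t.2 *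
      (logPow logAbs (P t.1).1 t.2 x * ((1 - cutoff K x) * reflectS σ (fourierS φ) x)))
      (Set.Ioi 0) := fun t => (hl t).2.1.const_mul _
  have e : (fun ξ => φ ξ * transformFun ((σ : ℤ) : ℝ) P a u N K ξ) = fun ξ =>
      (∑ t ∈ termSet P N, a t.1 t.2 *
        (φ ξ * (fourierConst * dampedSum ((σ : ℤ) : ℝ) t.2 K ((P t.1).1 + 1) 1 ξ))) +
      φ ξ * halfFourier ((σ : ℤ) : ℝ) (dampedRemainder P a u N K) ξ := by
    ext ξ
    simp only [transformFun, mul_add, Finset.mul_sum, mul_left_comm (φ ξ) (a _ _)]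
  have hsi := integrable_finsetSum (termSet P N) fun t _ => hdi t
  rw [e]
  refine ⟨hsi.add hwi, ?_⟩
  rw [integral_add hsi hwi, integral_finsetSum _ fun t _ => hdi t,
    ← integral_mul_reflect_fourierS σ (hw.integrableOn hα1) φ, ← reflectS_coe]
  have h2 : (∫ x in Set.Ioi (0 : ℝ), dampedRemainder P a u N K x * reflectS σ (fourierS φ) x) =
      (∫ x in Set.Ioi (0 : ℝ), (u x - partialSum logAbs P a N x) * reflectS σ (fourierS φ) x) +
      ∑ t ∈ termSet P N, a t.1 t.2 * ∫ x in Set.Ioi (0 : ℝ),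
        logPow logAbs (P t.1).1 t.2 x * ((1 - cutoff K x) * reflectS σ (fourierS φ) x) := by
    simp_rw [← integral_const_mul]
    rw [← integral_finsetSum _ fun t _ => hci t,
      ← integral_add hri (integrable_finsetSum _ fun t _ => hci t)]
    congr 1
    ext x
    rw [dampedRemainder_eq, add_mul, Finset.sum_mul]
    simp only [mul_assoc]
  rw [h2, extForm]
  simp_rw [fun t : (Σ _ : ℕ, ℕ) => (hl t).2.2, integral_const_mul, mul_add,
    Finset.sum_add_distrib]
  ring

theorem contDiff_transformFun {P : PowerSeq} (hP : IsAppropriate P) {a : ℕ → ℕ → ℂ} {u : ℝ → ℂ}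
    (h : InSchwartzP P a u) {N K : ℕ} (hN : -1 < (P N).1.re) (hK : -(P 0).1.re ≤ K) (θ : ℝ) :
    ContDiff ℝ ∞ (transformFun θ P a u N K) := by
  obtain ⟨α, hα1, hα2⟩ := exists_between (lt_min hN (show -1 < (P 0).1.re + K + 1 by linarith))
  have hw := h.flatRapid hP.isPowerSet (K := K) (hα2.trans_le (min_le_left _ _))
    (hα2.trans_le (min_le_right _ _))
  exact (ContDiff.sum fun t _ => contDiff_const.mul (contDiff_const.mul
    (contDiff_dampedSum_one θ _ K (add_one_ne_neg_nat (hP.not_neg_int t.1))))).add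
    (hw.contDiff_halfFourier hα1 θ)

theorem eq_of_integral_schwartz_mul_eq {f g : ℝ → ℂ} (hf : Continuous f) (hg : Continuous g)
    (h : ∀ φ : 𝓢(ℝ, ℂ), ∫ x, φ x * f x = ∫ x, φ x * g x) : f = g := by
  refine (Continuous.ae_eq_iff_eq volume hf hg).1 ?_
  refine ae_eq_of_integral_contDiff_smul_eq hf.locallyIntegrable hg.locallyIntegrable
    fun χ hχ hc => ?_
  have hc' : HasCompactSupport fun x => (χ x : ℂ) := hc.comp_left Complex.ofReal_zero
  simp only [Complex.real_smul]
  exact h (hc'.toSchwartzMap (Complex.ofRealCLM.contDiff.comp hχ))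

/-- The `(j, k)`-term in the expansion at infinity of the Fourier transform. -/
def transformTerm (θ : ℝ) (P : PowerSeq) (t : Σ _ : ℕ, ℕ) (ξ : ℝ) : ℂ :=
  fourierConst * gammaExp t.2 ((P t.1).1 + 1) (Complex.log (lineC θ 0 ξ))

theorem isSymbol_transformFun_sub {P : PowerSeq} (hP : IsAppropriate P) {a : ℕ → ℕ → ℂ}
    {u : ℝ → ℂ} (h : InSchwartzP P a u) {N K m : ℕ} (hN : m - 1 < (P N).1.re)
    (hK : m - (P 0).1.re ≤ K) {θ : ℝ} (hθ : |θ| = 1) {F : Filter ℝ} (hF : ∀ᶠ ξ in F, 1 ≤ |ξ|)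
    (hη : LogBound F 1) : IsSymbol F (-m) (fun ξ => transformFun θ P a u N K ξ -
      ∑ t ∈ termSet P N, a t.1 t.2 * transformTerm θ P t ξ) := by
  obtain ⟨α, hα1, hα2⟩ := exists_between
    (lt_min hN (show (m : ℝ) - 1 < (P 0).1.re + K + 1 by linarith))
  have hw := h.flatRapid hP.isPowerSet (K := K) (hα2.trans_le (min_le_left _ _))
    (hα2.trans_le (min_le_right _ _))
  have hF0 : ∀ᶠ ξ in F, ξ ≠ 0 := hF.mono fun ξ hξ => abs_pos.1 (one_pos.trans_le hξ)
  have e : (fun ξ => transformFun θ P a u N K ξ -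
      ∑ t ∈ termSet P N, a t.1 t.2 * transformTerm θ P t ξ) = fun ξ =>
      (∑ t ∈ termSet P N, a t.1 t.2 * (fourierConst *
        (dampedSum θ t.2 K ((P t.1).1 + 1) 1 ξ - dampedSum θ t.2 K ((P t.1).1 + 1) 0 ξ))) +
      halfFourier θ (dampedRemainder P a u N K) ξ := by
    ext ξ
    simp only [transformFun, transformTerm, dampedSum_zero, mul_sub, Finset.sum_sub_distrib]
    ring
  rw [e]
  refine (IsSymbol.sum hF0 fun t _ => IsSymbol.const_mul (IsSymbol.const_mul ?_ _) _).add
    (hw.isSymbol_halfFourier hθ (by linarith) hF)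
  refine (isSymbol_dampedSum_sub hθ t.2 K (add_one_ne_neg_nat (hP.not_neg_int t.1)) hF hη).mono
    (rpow_isBigO_infty hF ?_)
  have := hP.isPowerSet.monotone (Nat.zero_le t.1)
  rw [Complex.add_re, Complex.one_re]
  dsimp only at this
  linarith

theorem exists_transform {P : PowerSeq} (hP : IsAppropriate P) {a : ℕ → ℕ → ℂ} {u : ℝ → ℂ}
    (h : InSchwartzP P a u) (σ : ℤˣ) : ∃ f : ℝ → ℂ, ContDiff ℝ ∞ f ∧
      (∀ N, -1 < (P N).1.re → ∀ φ : 𝓢(ℝ, ℂ), Integrable (fun ξ => φ ξ * f ξ) ∧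
        extForm P a u N (reflectS σ (fourierS φ)) = ∫ ξ : ℝ, φ ξ * f ξ) ∧
      ∀ m : ℕ, ∃ N₀, ∀ N ≥ N₀, ∀ F : Filter ℝ, (∀ᶠ ξ in F, 1 ≤ |ξ|) → LogBound F 1 →
        IsSymbol F (-m) (fun ξ => f ξ - ∑ t ∈ termSet P N,
          a t.1 t.2 * transformTerm ((σ : ℤ) : ℝ) P t ξ) := by
  have hev : ∀ r : ℝ, ∃ N₀, ∀ N ≥ N₀, r < (P N).1.re := fun r =>
    eventually_atTop.1 (hP.isPowerSet.tendsto.eventually_gt_atTop r)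
  obtain ⟨N₁, hN₁⟩ := hev (-1)
  have hN₁ := hN₁ N₁ le_rfl
  have hK₁ := Nat.le_ceil (-(P 0).1.re)
  -- All these continuous functions represent the same distribution, hence coincide. So the fixed
  -- function inherits the estimates available for arbitrarily large `N` and `K`.
  have heq : ∀ N K : ℕ, -1 < (P N).1.re → -(P 0).1.re ≤ K →
      transformFun ((σ : ℤ) : ℝ) P a u N₁ ⌈-(P 0).1.re⌉₊ =
        transformFun ((σ : ℤ) : ℝ) P a u N K := fun N K hN hK => by
    refine eq_of_integral_schwartz_mul_eq (contDiff_transformFun hP h hN₁ hK₁ _).continuous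
      (contDiff_transformFun hP h hN hK _).continuous fun φ => ?_
    rw [← (extForm_fourier hP h hN₁ hK₁ σ φ).2, ← (extForm_fourier hP h hN hK σ φ).2,
      extForm_eq hP.isPowerSet h hN₁ hN]
  refine ⟨transformFun ((σ : ℤ) : ℝ) P a u N₁ ⌈-(P 0).1.re⌉₊,
    contDiff_transformFun hP h hN₁ hK₁ _, fun N hN φ => ?_, fun m => ?_⟩
  · rw [heq N _ hN hK₁]
    exact extForm_fourier hP h hN hK₁ σ φ
  · obtain ⟨N₀, hN₀⟩ := hev (m - 1)
    refine ⟨N₀, fun N hN F hF hη => ?_⟩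
    have hm : (0 : ℝ) ≤ m := Nat.cast_nonneg m
    have hK := Nat.le_ceil ((m : ℝ) - (P 0).1.re)
    rw [heq N ⌈(m : ℝ) - (P 0).1.re⌉₊ (by linarith [hN₀ N hN]) (by linarith)]
    exact isSymbol_transformFun_sub hP h (hN₀ N hN) hK (abs_units_cast σ) hF hη

/-! ### Change of the branch of the logarithm -/

open Polynomial in
theorem exists_polynomial_gammaExp (k : ℕ) {z : ℂ} (hz : ∀ n : ℕ, z ≠ -n) :
    ∃ p : ℂ[X], p.natDegree ≤ k ∧ ∀ L, gammaExp k z L = Complex.exp (-z * L) * p.eval L := by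
  obtain ⟨c, hc⟩ := derivExp_eq_sum k (analyticAt_Gamma hz)
  refine ⟨∑ i ∈ Finset.range (k + 1), C (c i) * X ^ i,
    natDegree_sum_le_of_forall_le _ _ fun i hi => (natDegree_C_mul_X_pow_le _ _).trans
      (Nat.lt_succ_iff.1 (Finset.mem_range.1 hi)), fun L => ?_⟩
  rw [gammaExp, hc, eval_finsetSum, Finset.mul_sum]
  refine Finset.sum_congr rfl fun i _ => ?_
  simp only [eval_mul, eval_C, eval_pow, eval_X]
  ring

open Polynomial in
-- Adding a constant to the logarithm keeps the exponent `q` and the degree bound of the polynomial,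
-- so changing the branch only changes coefficients.
theorem exists_coeff_shift (q c : ℂ) {m : ℕ} {p : ℂ[X]} (hp : p.natDegree ≤ m) :
    ∃ d : ℕ → ℂ, ∀ L, Complex.exp (q * (L + c)) * p.eval (L + c) =
      ∑ i ∈ Finset.range (m + 1), d i * (Complex.exp (q * L) * L ^ i) := by
  refine ⟨fun i => Complex.exp (q * c) * (p.comp (X + C c)).coeff i, fun L => ?_⟩
  have h : (p.comp (X + C c)).natDegree < m + 1 := by
    rw [natDegree_comp, natDegree_X_add_C, mul_one]
    omega
  have e : p.eval (L + c) = (p.comp (X + C c)).eval L := by simp [eval_comp]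
  rw [e, eval_eq_sum_range' h, mul_add, Complex.exp_add, Finset.mul_sum]
  refine Finset.sum_congr rfl fun i _ => ?_
  ring

/-- The argument of `iσξ` is `±π/2`, while that of `ξ - σ i0` is `0` or `-σπ`; the difference is
`σπ/2` on both half-lines. This common constant is why one sequence of coefficients serves both
ends. -/
theorem log_lineC_zero (σ : ℤˣ) {ξ : ℝ} (hξ : ξ ≠ 0) :
    Complex.log (lineC ((σ : ℤ) : ℝ) 0 ξ) =
      logBoundary (-σ) ξ + ((σ : ℤ) : ℂ) * (Real.pi / 2 * Complex.I) := by
  have key : ∀ z : ℂ, z ≠ 0 → lineC ((σ : ℤ) : ℝ) 0 ξ = ((|ξ| : ℝ) : ℂ) * z →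
      Complex.log (lineC ((σ : ℤ) : ℝ) 0 ξ) = (Real.log |ξ| : ℝ) + Complex.log z :=
    fun z hz h => by rw [h, Complex.log_ofReal_mul (abs_pos.2 hξ) hz]
  have hI := Complex.I_ne_zero
  rcases lt_or_gt_of_ne hξ with h | h
  · rw [logBoundary, if_neg h.not_gt]
    rcases Int.units_eq_one_or σ with rfl | rfl
    · rw [key (-Complex.I) (neg_ne_zero.2 hI) (by rw [abs_of_neg h]; simp [lineC, mul_comm]),
        Complex.log_neg_I]
      simp
      ring
    · rw [key Complex.I hI (by rw [abs_of_neg h]; simp [lineC, mul_comm]), Complex.log_I]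
      simp
      ring
  · rw [logBoundary, if_pos h]
    rcases Int.units_eq_one_or σ with rfl | rfl
    · rw [key Complex.I hI (by rw [abs_of_pos h]; simp [lineC, mul_comm]), Complex.log_I]
      simp
    · rw [key (-Complex.I) (neg_ne_zero.2 hI) (by rw [abs_of_pos h]; simp [lineC, mul_comm]),
        Complex.log_neg_I]
      simp

open Polynomial in
theorem exists_coeff_transformTerm {P : PowerSeq} (hP : IsAppropriate P) (a : ℕ → ℕ → ℂ)
    (σ : ℤˣ) : ∃ b : ℕ → ℕ → ℂ, ∀ j, ∀ ξ : ℝ, ξ ≠ 0 →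
      ∑ k ∈ Finset.range ((P j).2 + 1), a j k * transformTerm ((σ : ℤ) : ℝ) P ⟨j, k⟩ ξ =
        ∑ i ∈ Finset.range ((P j).2 + 1),
          b j i * logPow (logBoundary (-σ)) (-(P j).1 - 1) i ξ := by
  suffices h : ∀ j, ∃ b : ℕ → ℂ, ∀ ξ : ℝ, ξ ≠ 0 →
      ∑ k ∈ Finset.range ((P j).2 + 1), a j k * transformTerm ((σ : ℤ) : ℝ) P ⟨j, k⟩ ξ =
        ∑ i ∈ Finset.range ((P j).2 + 1),
          b i * logPow (logBoundary (-σ)) (-(P j).1 - 1) i ξ by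
    choose b hb using h
    exact ⟨b, hb⟩
  intro j
  choose p hp hpe using fun k => exists_polynomial_gammaExp k
    (add_one_ne_neg_nat (hP.not_neg_int j))
  obtain ⟨d, hd⟩ := exists_coeff_shift (-((P j).1 + 1)) (((σ : ℤ) : ℂ) * (Real.pi / 2 * Complex.I))
    (m := (P j).2) (p := ∑ k ∈ Finset.range ((P j).2 + 1), C (a j k * fourierConst) * p k)
    (natDegree_sum_le_of_forall_le _ _ fun k hk => (natDegree_C_mul_le _ _).trans
      ((hp k).trans (Nat.lt_succ_iff.1 (Finset.mem_range.1 hk))))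
  refine ⟨d, fun ξ hξ => ?_⟩
  simp only [transformTerm, log_lineC_zero σ hξ, hpe]
  refine Eq.trans ?_ ((hd (logBoundary (-σ) ξ)).trans ?_)
  · rw [eval_finsetSum, Finset.mul_sum]
    refine Finset.sum_congr rfl fun k _ => ?_
    rw [eval_mul, eval_C]
    ring
  · simp only [logPow, neg_add']

/-! ### Expansions at infinity -/

/-- Rearrangement of an expansion into the order of `P'`. The map `idx` need not be injective, so
coefficients are summed over its finite fibres; entries of `P'` outside its range get coefficient
zero. -/
theorem HasExpansionInfty.of_symbols {ℓ : ℝ → ℂ} {S : Set ℝ} (hℓ : IsLogOn ℓ S) {F : Filter ℝ}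
    (hS : S ∈ F) (hF : ∀ᶠ ξ in F, 1 ≤ |ξ|) (hη : ∀ ε > 0, LogBound F ε) {P' : PowerSeq}
    (hP' : IsPowerSetInfty P') {p : ℕ → ℂ} {m idx : ℕ → ℕ} (hidx : ∀ j, P' (idx j) = (p j, m j))
    (hfin : ∀ n, {j | idx j = n}.Finite) {b : ℕ → ℕ → ℂ} {f : ℝ → ℂ}
    (hf : ∀ B : ℕ, ∃ N₀, ∀ N ≥ N₀, IsSymbol F (-B) (fun ξ => f ξ - ∑ j ∈ Finset.range N,
      ∑ i ∈ Finset.range (m j + 1), b j i * logPow ℓ (p j) i ξ)) :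
    HasExpansionInfty ℓ F P' (fun n i => ∑ j ∈ (hfin n).toFinset, b j i) f := by
  intro N' k ε hε
  have hF0 : ∀ᶠ ξ in F, ξ ≠ 0 := hF.mono fun ξ hξ => abs_pos.1 (one_pos.trans_le hξ)
  set g : ℕ → ℝ → ℂ := fun j ξ => ∑ i ∈ Finset.range (m j + 1), b j i * logPow ℓ (p j) i ξ with hg
  set J := (Finset.range N').biUnion fun n => (hfin n).toFinset with hJ
  have hmem : ∀ j, j ∈ J ↔ idx j < N' := fun j => by simp [hJ]
  have hsum : ∀ ξ, partialSum ℓ P' (fun n i => ∑ j ∈ (hfin n).toFinset, b j i) N' ξ =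
      ∑ j ∈ J, g j ξ := fun ξ => by
    rw [partialSum_eq_logPow, hJ, Finset.sum_biUnion]
    · refine Finset.sum_congr rfl fun n _ => ?_
      simp only [Finset.sum_mul]
      rw [Finset.sum_comm]
      refine Finset.sum_congr rfl fun j hj => ?_
      have hj : idx j = n := by simpa using hj
      simp only [hg, ← hj, hidx]
    · intro n _ n' _ hn
      rw [Function.onFun, Finset.disjoint_left]
      intro j hj hj'
      simp only [Set.Finite.mem_toFinset, Set.mem_ofPred_eq] at hj hj'
      exact hn (hj.symm.trans hj')
  obtain ⟨B, hB⟩ := exists_nat_ge (-(P' N').1.re)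
  obtain ⟨N₀, hN₀⟩ := hf B
  -- Large enough for an error of order `-B ≤ Re (P' N')` and for all `j` with `idx j < N'` to
  -- occur. The other terms have `idx j ≥ N'`, hence an admissible order.
  set N := max N₀ (J.sup id + 1)
  have hJN : J ⊆ Finset.range N := fun j hj => Finset.mem_range.2
    (lt_of_lt_of_le (Nat.lt_succ_of_le (Finset.le_sup (f := id) hj)) (le_max_right _ _))
  have e : (fun ξ => f ξ - partialSum ℓ P' (fun n i => ∑ j ∈ (hfin n).toFinset, b j i) N' ξ) =
      fun ξ => (f ξ - ∑ j ∈ Finset.range N, g j ξ) + ∑ j ∈ Finset.range N \ J, g j ξ := by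
    ext ξ
    rw [hsum, ← Finset.sum_sdiff hJN]
    ring
  rw [e]
  refine IsSymbol.bound (IsSymbol.add (α := (P' N').1.re + ε) ?_ ?_) k
  · exact (hN₀ N (le_max_left _ _)).mono (rpow_isBigO_infty hF (by linarith))
  · refine IsSymbol.sum hF0 fun j hj => IsSymbol.sum hF0 fun i _ => IsSymbol.const_mul ?_ _
    refine (hℓ.isSymbol_logPow hS (hη ε hε) (p j) i).mono (rpow_isBigO_infty hF ?_)
    have hj : N' ≤ idx j := not_lt.1 fun h => (Finset.mem_sdiff.1 hj).2 ((hmem j).2 h)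
    have := antitone_nat_of_succ_le (f := fun j => (P' j).1.re) hP'.anti hj
    dsimp only at this
    rw [hidx] at this
    linarith

open Polynomial in
theorem HasExpansionInfty.exists_of_eqOn {ℓ ℓ' : ℝ → ℂ} {S : Set ℝ} (hS : IsOpen S)
    {F : Filter ℝ} (hSF : S ∈ F) {c : ℂ} (hℓ : ∀ x ∈ S, ℓ x = ℓ' x + c) {P : PowerSeq}
    {a : ℕ → ℕ → ℂ} {f : ℝ → ℂ} (h : HasExpansionInfty ℓ F P a f) :
    ∃ b, HasExpansionInfty ℓ' F P b f := by
  choose b hb using fun j => exists_coeff_shift (P j).1 c (m := (P j).2)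
    (p := ∑ k ∈ Finset.range ((P j).2 + 1), C (a j k) * X ^ k)
    (natDegree_sum_le_of_forall_le _ _ fun k hk => (natDegree_C_mul_X_pow_le _ _).trans
      (Nat.lt_succ_iff.1 (Finset.mem_range.1 hk)))
  have e : ∀ N, Set.EqOn (fun y => f y - partialSum ℓ P a N y)
      (fun y => f y - partialSum ℓ' P b N y) S := fun N x hx => by
    simp only [partialSum, hℓ x hx, ← hb, eval_finsetSum, eval_mul, eval_C, eval_pow, eval_X,
      Finset.mul_sum]
    congr 1
    refine Finset.sum_congr rfl fun j _ => Finset.sum_congr rfl fun k _ => ?_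
    ring
  refine ⟨b, fun N k ε hε => (h N k ε hε).congr' ?_ EventuallyEq.rfl⟩
  filter_upwards [hSF] with x hx
  exact (e N).iteratedDeriv_of_isOpen hS k hx

theorem smoothBoundaryP_subset (τ : ℤˣ) (P : PowerSeq) : smoothBoundaryP τ P ⊆ smoothP P := by
  rintro f ⟨hf, a, h1, h2⟩
  refine ⟨hf, h1.exists_of_eqOn (c := 0) isOpen_Ioi (Ioi_mem_atTop 0) fun x hx => ?_,
    h2.exists_of_eqOn (c := ((τ : ℤ) : ℂ) * (Real.pi : ℂ) * Complex.I) isOpen_Iio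
      (Iio_mem_atBot 0) fun x hx => ?_⟩
  · rw [logBoundary, if_pos (Set.mem_Ioi.1 hx), logAbs, add_zero]
  · rw [logBoundary, if_neg (not_lt.2 (le_of_lt (Set.mem_Iio.1 hx))), logAbs]

theorem asDistributions_mono {A B : Set (ℝ → ℂ)} (h : A ⊆ B) :
    asDistributions A ⊆ asDistributions B :=
  fun _ ⟨f, hf, hH⟩ => ⟨f, h hf, hH⟩

theorem hardyP_subset_smoothBoundaryP {P P' : PowerSeq} (hP : IsAppropriate P)
    (hP' : IsPowerSetInfty P') (hPP' : ContainsDual P P') (σ : ℤˣ) :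
    hardyP σ P ⊆ asDistributions (smoothBoundaryP (-σ) P') := by
  rintro H ⟨u, -, T, hT, rfl⟩
  obtain ⟨a, N, hu, hN, hT⟩ := isExtension_iff.1 hT
  obtain ⟨f, hf, hfT, hfs⟩ := exists_transform hP hu σ
  -- The pair with `i = 0` has logarithmic order `m j` and takes the whole polynomial in the
  -- logarithm belonging to `p j`.
  choose idx hidx using fun j => hPP' j 0 (Nat.zero_le _)
  -- On a fibre `Re p j` is constant, whereas `Re p j → +∞`.
  have hfin : ∀ n, {j | idx j = n}.Finite := fun n => by
    have h1 : ∀ᶠ j in atTop, -(P' n).1.re - 1 < (P j).1.re :=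
      hP.isPowerSet.tendsto.eventually_gt_atTop _
    rw [← Nat.cofinite_eq_atTop, eventually_cofinite] at h1
    refine h1.subset fun j hj => ?_
    have hj : idx j = n := hj
    have := hidx j
    rw [hj] at this
    simp [this]
  obtain ⟨b, hb⟩ := exists_coeff_transformTerm hP a σ
  have hsym : ∀ F : Filter ℝ, (∀ᶠ ξ in F, 1 ≤ |ξ|) → (∀ ε > 0, LogBound F ε) →
      HasExpansionInfty (logBoundary (-σ)) F P'
        (fun n i => ∑ j ∈ (hfin n).toFinset, b j i) f := fun F hF hη => by
    have h0 : ({0}ᶜ : Set ℝ) ∈ F := by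
      filter_upwards [hF] with ξ hξ
      exact abs_pos.1 (one_pos.trans_le hξ)
    refine HasExpansionInfty.of_symbols (isLogOn_logBoundary (-σ)) h0 hF hη hP'
      (p := fun j => -(P j).1 - 1) (m := fun j => (P j).2) (fun j => by simpa using hidx j) hfin
      fun B => ?_
    obtain ⟨N₀, hN₀⟩ := hfs B
    refine ⟨N₀, fun N hN => (hN₀ N hN F hF (hη 1 one_pos)).congr_on
      isOpen_compl_singleton h0 fun ξ hξ => ?_⟩
    simp only [termSet, Finset.sum_sigma]
    congr 1
    exact Finset.sum_congr rfl fun j _ => hb j ξ hξ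
  refine ⟨f, ⟨hf, _, hsym atTop eventually_one_le_abs_atTop fun ε hε => logBound_atTop hε,
    hsym atBot eventually_one_le_abs_atBot fun ε hε => logBound_atBot hε⟩, fun φ => ?_⟩
  simp only [mul_comm (f _)]
  refine ⟨(hfT N hN φ).1, ?_⟩
  rw [fourierD_apply, hT, ← reflectS_coe]
  exact (hfT N hN φ).2

/-- With `M` a bound for the `m j`, list each exponent in a block of length `M + 1`; place `j * (M +
1) + i` carries the order `m j - i`. For `i > m j` truncated subtraction repeats the order zero,
which is harmless. -/
theorem exists_containsDual {P : PowerSeq} (hP : IsPowerSetZero P) :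
    ∃ P' : PowerSeq, IsPowerSetInfty P' ∧ ContainsDual P P' := by
  obtain ⟨M, hM⟩ := hP.bounded
  have hmono : Antitone fun n : ℕ => (-(P (n / (M + 1))).1 - 1).re := fun n n' h => by
    have := hP.monotone (Nat.div_le_div_right (c := M + 1) h)
    simpa using this
  refine ⟨fun n => (-(P (n / (M + 1))).1 - 1, (P (n / (M + 1))).2 - n % (M + 1)),
    ⟨fun j => hmono (Nat.le_succ j), ?_⟩, fun j i hi => ⟨j * (M + 1) + i, ?_⟩⟩
  · have h1 : Tendsto (fun n : ℕ => n / (M + 1)) atTop atTop :=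
      Nat.tendsto_div_const_atTop (Nat.succ_ne_zero M)
    have h2 := tendsto_neg_atTop_atBot.comp (hP.tendsto.comp h1)
    have h3 := tendsto_atBot_add_const_right atTop (-1) h2
    refine h3.congr fun n => ?_
    simp [sub_eq_add_neg]
  · have hlt : i < M + 1 := by linarith [hM j]
    have h1 : (j * (M + 1) + i) / (M + 1) = j := by
      rw [mul_comm, Nat.mul_add_div (Nat.succ_pos M), Nat.div_eq_of_lt hlt, add_zero]
    have h2 : (j * (M + 1) + i) % (M + 1) = i := by
      rw [mul_comm, Nat.mul_add_mod, Nat.mod_eq_of_lt hlt]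
    simp only [h1, h2]

/-! ### Extensions by zero as tempered distributions -/

theorem units_cast_mul_self (σ : ℤˣ) (x : ℝ) : ((σ : ℤ) : ℝ) * (((σ : ℤ) : ℝ) * x) = x := by
  rcases Int.units_eq_one_or σ with rfl | rfl <;> simp

theorem exists_clm_extForm {P : PowerSeq} (hP : IsAppropriate P) {a : ℕ → ℕ → ℂ} {u : ℝ → ℂ}
    (h : InSchwartzP P a u) {N : ℕ} (hN : -1 < (P N).1.re) :
    ∃ L : 𝓢(ℝ, ℂ) →L[ℂ] ℂ, ∀ ψ : 𝓢(ℝ, ℂ), L ψ = extForm P a u N ψ := by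
  choose S hS using fun t : (Σ _ : ℕ, ℕ) => exists_clm_logHom (hP.not_neg_int t.1) t.2
  obtain ⟨m, hm⟩ := h.exists_integrableOn_remainder hP.isPowerSet hN
  obtain ⟨R, hR⟩ := exists_clm_integral_Ioi hm
  refine ⟨(∑ t ∈ termSet P N, a t.1 t.2 • S t) + R, fun ψ => ?_⟩
  simp [extForm, hS, hR]

theorem exists_isExtension {P : PowerSeq} (hP : IsAppropriate P) {σ : ℤˣ} {u : ℝ → ℂ}
    (hu : u ∈ schwartzP σ P) : ∃ T : 𝓢'(ℝ, ℂ), IsExtension σ P u T := by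
  obtain ⟨a, h⟩ := hu
  obtain ⟨N, hN⟩ := (hP.isPowerSet.tendsto.eventually_gt_atTop (-1)).exists
  obtain ⟨L, hL⟩ := exists_clm_extForm hP h hN
  refine ⟨ContinuousLinearMap.toPointwiseConvergenceCLM _ _ _ _ (L.comp (reflectS σ)),
    isExtension_iff.2 ⟨a, N, h, hN, fun φ => ?_⟩⟩
  rw [← reflectS_coe, ← hL]
  rfl

theorem IsExtension.mem_temperedHalf {σ : ℤˣ} {P : PowerSeq} {u : ℝ → ℂ} {T : 𝓢'(ℝ, ℂ)}
    (hT : IsExtension σ P u T) : T ∈ temperedHalf σ := by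
  obtain ⟨a, N, -, -, hT⟩ := isExtension_iff.1 hT
  intro x hx
  by_contra hx'
  refine (Distribution.notMem_dsupport_iff x).2
    ⟨{y : ℝ | ((σ : ℤ) : ℝ) * y < 0}, fun φ hφ => ?_,
      isOpen_lt (by fun_prop) continuous_const, by
        rw [Set.mem_ofPred_eq]
        exact lt_of_not_ge hx'⟩ hx
  have h0 : ∀ y : ℝ, 0 < y → reflect σ φ y = 0 := fun y hy => by
    refine image_eq_zero_of_notMem_tsupport (f := φ) fun h => ?_
    have h := hφ h
    rw [Set.mem_ofPred_eq, units_cast_mul_self] at h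
    exact lt_asymm h hy
  rw [hT, extForm, Finset.sum_eq_zero fun t _ => by rw [logHom_eq_zero h0, mul_zero], zero_add]
  refine setIntegral_eq_zero_of_forall_eq_zero fun y hy => ?_
  rw [h0 y hy, mul_zero]

theorem hardyP_subset_hardyD (σ : ℤˣ) (P : PowerSeq) : hardyP σ P ⊆ hardyD σ := by
  rintro H ⟨u, -, T, hT, rfl⟩
  exact ⟨T, hT.mem_temperedHalf, rfl⟩

theorem extForm_eq_integral {P : PowerSeq} (hP : IsPowerSetZero P) {a : ℕ → ℕ → ℂ}
    {u : ℝ → ℂ} (h : InSchwartzP P a u) {N : ℕ} (hN : -1 < (P N).1.re)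
    (ha : ∀ j k, a j k = 0 ∨ -1 < (P j).1.re) (ψ : 𝓢(ℝ, ℂ)) :
    extForm P a u N ψ = ∫ x in Set.Ioi (0 : ℝ), u x * ψ x := by
  have hI : ∀ t : (Σ _ : ℕ, ℕ), IntegrableOn
      (fun x => a t.1 t.2 * (logPow logAbs (P t.1).1 t.2 x * ψ x)) (Set.Ioi 0) := fun t => by
    rcases ha t.1 t.2 with h0 | h0
    · simp [h0]
    · exact (integrableOn_logPow_mul_schwartz h0 t.2 ψ).const_mul _
  have e : ∀ t : (Σ _ : ℕ, ℕ), a t.1 t.2 * logHom (P t.1).1 t.2 ψ =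
      ∫ x in Set.Ioi (0 : ℝ), a t.1 t.2 * (logPow logAbs (P t.1).1 t.2 x * ψ x) := fun t => by
    rcases ha t.1 t.2 with h0 | h0
    · simp [h0]
    · rw [logHom_eq_integral h0, integral_const_mul]
  rw [extForm, Finset.sum_congr rfl fun t _ => e t, ← integral_finsetSum _ fun t _ => hI t,
    ← integral_add (integrable_finsetSum _ fun t _ => hI t) (h.integrableOn_remainder_mul hP hN ψ)]
  congr 1
  ext x
  rw [partialSum_eq_sum_termSet, sub_mul, Finset.sum_mul]
  simp only [mul_assoc]
  ring

theorem setIntegral_half_eq (σ : ℤˣ) (f : ℝ → ℂ) :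
    ∫ x in {x : ℝ | 0 < ((σ : ℤ) : ℝ) * x}, f x = ∫ x in Set.Ioi (0 : ℝ), reflect σ f x := by
  rcases Int.units_eq_one_or σ with rfl | rfl
  · simp only [reflect, Units.val_one, Int.cast_one, one_mul]
    rfl
  · simp only [reflect, Units.val_neg, Units.val_one, Int.cast_neg, Int.cast_one, neg_mul, one_mul,
      Left.neg_pos_iff]
    rw [integral_comp_neg_Ioi, neg_zero, integral_Iic_eq_integral_Iio]
    rfl

theorem isZeroExtension_iff {σ : ℤˣ} {u : ℝ → ℂ} {T : 𝓢'(ℝ, ℂ)} :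
    IsZeroExtension σ u T ↔ ∀ φ : 𝓢(ℝ, ℂ),
      T φ = ∫ x in Set.Ioi (0 : ℝ), reflect σ u x * reflectS σ φ x := by
  refine forall_congr' fun φ => ?_
  rw [setIntegral_half_eq, reflectS_coe]
  rfl

/-! ### The Taylor power set -/

theorem isPowerSetZero_P₀ : IsPowerSetZero P₀ where
  mono j := by simp [P₀]
  tendsto := by simpa [P₀] using tendsto_natCast_atTop_atTop
  bounded := ⟨0, fun j => le_rfl⟩

theorem neg_one_lt_P₀_re (j : ℕ) : -1 < (P₀ j).1.re := by
  have : (0 : ℝ) ≤ j := Nat.cast_nonneg j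
  simp only [P₀, Complex.natCast_re]
  linarith

theorem logPow_natCast (n : ℕ) {x : ℝ} (hx : 0 < x) : logPow logAbs (n : ℂ) 0 x = (x : ℂ) ^ n := by
  rw [logPow, pow_zero, mul_one, ← cpow_eq_exp_logAbs hx, Complex.cpow_natCast]

theorem IsExtension.isZeroExtension {σ : ℤˣ} {u : ℝ → ℂ} {T : 𝓢'(ℝ, ℂ)}
    (hT : IsExtension σ P₀ u T) : IsZeroExtension σ u T := by
  obtain ⟨a, N, h, hN, hT⟩ := isExtension_iff.1 hT
  refine isZeroExtension_iff.2 fun φ => ?_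
  rw [hT, ← reflectS_coe, extForm_eq_integral isPowerSetZero_P₀ h hN
    fun j _ => Or.inr (neg_one_lt_P₀_re j)]

theorem IsZeroExtension.isExtension {P : PowerSeq} (hP : IsPowerSetZero P) {σ : ℤˣ} {u : ℝ → ℂ}
    {T : 𝓢'(ℝ, ℂ)} (hT : IsZeroExtension σ u T) {a : ℕ → ℕ → ℂ}
    (h : InSchwartzP P a (reflect σ u)) (ha : ∀ j k, a j k = 0 ∨ -1 < (P j).1.re) :
    IsExtension σ P u T := by
  obtain ⟨N, hN⟩ := (hP.tendsto.eventually_gt_atTop (-1)).exists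
  refine isExtension_iff.2 ⟨a, N, h, hN, fun φ => ?_⟩
  rw [isZeroExtension_iff.1 hT, ← reflectS_coe, extForm_eq_integral hP h hN ha]

/-- The Taylor coefficients go to the places `idx n` and all other coefficients are zero. They may
be constant in the logarithmic index, since `P (idx n)` has logarithmic order zero. -/
theorem InSchwartzP.of_P₀ {P : PowerSeq} (hP : IsPowerSetZero P) {a : ℕ → ℕ → ℂ} {u : ℝ → ℂ}
    (h : InSchwartzP P₀ a u) {idx : ℕ → ℕ} (hidx : ∀ n, P (idx n) = P₀ n) :
    InSchwartzP P (fun j _ => Function.extend idx (fun n => a n 0) 0 j) u := by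
  have hinj : Function.Injective idx := fun n n' hn => by
    have := (hidx n).symm.trans ((congrArg P hn).trans (hidx n'))
    simpa [P₀] using this
  refine ⟨h.1, fun N k ε hε => ?_⟩
  set J := (Finset.range N).preimage idx hinj.injOn with hJ
  obtain ⟨M₁, hM₁⟩ := exists_nat_ge (P N).1.re
  -- The Taylor remainder of order `M` is admissible and all `n` with `idx n < N` occur. A leftover
  -- term has `idx n ≥ N`, hence order at least `Re p N`.
  set M := max M₁ (J.sup id + 1)
  have hJM : J ⊆ Finset.range M := fun j hj => Finset.mem_range.2
    (lt_of_lt_of_le (Nat.lt_succ_of_le (Finset.le_sup (f := id) hj)) (le_max_right _ _))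
  have hsum : ∀ x, partialSum logAbs P (fun j _ => Function.extend idx (fun n => a n 0) 0 j) N x =
      ∑ n ∈ J, a n 0 * logPow logAbs n 0 x := fun x => by
    rw [partialSum_eq_logPow, ← Finset.sum_preimage idx (Finset.range N) hinj.injOn _
      fun j _ hj => ?_]
    · refine Finset.sum_congr rfl fun n _ => ?_
      rw [hinj.extend_apply, hidx]
      simp [P₀]
    · rw [Function.extend_apply' _ _ _ hj]
      simp
  have hsum₀ : ∀ x, partialSum logAbs P₀ a M x =
      ∑ n ∈ Finset.range M, a n 0 * logPow logAbs n 0 x := fun x => by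
    rw [partialSum_eq_logPow]
    simp [P₀]
  have e : (fun x => u x -
      partialSum logAbs P (fun j _ => Function.extend idx (fun n => a n 0) 0 j) N x) =
      fun x => (u x - partialSum logAbs P₀ a M x) +
        ∑ n ∈ Finset.range M \ J, a n 0 * logPow logAbs n 0 x := by
    ext x
    rw [hsum, hsum₀, ← Finset.sum_sdiff hJM]
    ring
  have hM : (P N).1.re ≤ (P₀ M).1.re := by
    simp only [P₀, Complex.natCast_re]
    exact hM₁.trans (mod_cast le_max_left _ _)
  have hsym : IsSymbol (𝓝[>] 0) ((P N).1.re - ε) (fun x => u x -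
      partialSum logAbs P (fun j _ => Function.extend idx (fun n => a n 0) 0 j) N x) := by
    rw [e]
    refine (h.isSymbol_remainder (by linarith)).add (IsSymbol.sum eventually_ne_nhdsGT
      fun n hn => IsSymbol.const_mul (isSymbol_logPow_zero ?_ _) _)
    have hn : N ≤ idx n := not_lt.1 fun hlt =>
      (Finset.mem_sdiff.1 hn).2 (Finset.mem_preimage.2 (Finset.mem_range.2 hlt))
    have := hP.monotone hn
    simp only [hidx, P₀] at this
    linarith
  refine (hsym.bound k).congr' EventuallyEq.rfl ?_
  filter_upwards [self_mem_nhdsWithin] with x hx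
  rw [abs_of_pos hx]

theorem hardyP_P₀_subset {P : PowerSeq} (hP : IsAppropriate P) (σ : ℤˣ) :
    hardyP σ P₀ ⊆ hardyP σ P := by
  rintro H ⟨u, ⟨a, h⟩, T, hT, rfl⟩
  choose idx hidx using fun n => hP.contains ⟨n, rfl⟩
  have h' := h.of_P₀ hP.isPowerSet hidx
  refine ⟨u, ⟨_, h'⟩, T, hT.isZeroExtension.isExtension hP.isPowerSet h' fun j k => ?_, rfl⟩
  by_cases hj : ∃ n, idx n = j
  · obtain ⟨n, rfl⟩ := hj
    right
    rw [hidx]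
    exact neg_one_lt_P₀_re n
  · left
    rw [Function.extend_apply' _ _ _ hj, Pi.zero_apply]

/-! ### Taylor expansions -/

theorem isBigO_pow_of_iteratedDeriv_eq_zero {h : ℝ → ℂ} (hh : ContDiff ℝ ∞ h) {n : ℕ}
    (h0 : ∀ i < n, iteratedDeriv i h 0 = 0) : h =O[𝓝 0] fun x => x ^ n := by
  have h1 := (taylor_isLittleO_univ (x₀ := 0) (n := n) (hh.of_le (mod_cast le_top))).isBigO
  have h2 : taylorWithinEval h n Set.univ 0 =O[𝓝 0] fun x => (x - 0) ^ n := by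
    have e : taylorWithinEval h n Set.univ 0 =
        fun x => ((n.factorial : ℝ)⁻¹ * (x - 0) ^ n) • iteratedDeriv n h 0 := by
      ext x
      rw [taylor_within_apply, Finset.sum_range_succ, Finset.sum_eq_zero, zero_add,
        iteratedDerivWithin_univ]
      intro k hk
      rw [iteratedDerivWithin_univ, h0 k (Finset.mem_range.1 hk), smul_zero]
    rw [e]
    refine IsBigO.of_bound (‖(n.factorial : ℝ)⁻¹‖ * ‖iteratedDeriv n h 0‖)
      (Eventually.of_forall fun x => ?_)
    rw [norm_smul, norm_mul]
    exact le_of_eq (by ring)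
  simpa using h1.add h2

theorem iteratedDeriv_ofReal_pow (n k : ℕ) : iteratedDeriv k (fun x : ℝ => (x : ℂ) ^ n) =
    fun x : ℝ => (n.descFactorial k : ℂ) * (x : ℂ) ^ (n - k) := by
  induction k with
  | zero => simp
  | succ k ih =>
    rw [iteratedDeriv_succ, ih]
    ext x
    have := (((Complex.ofRealCLM.hasDerivAt (x := x)).pow (n - k)).const_mul
      (n.descFactorial k : ℂ))
    refine this.deriv.trans ?_
    rw [Nat.descFactorial_succ, Nat.sub_sub]
    simp
    ring

theorem iteratedDeriv_ofReal_pow_zero (n k : ℕ) :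
    iteratedDeriv k (fun x : ℝ => (x : ℂ) ^ n) 0 = if k = n then (n.factorial : ℂ) else 0 := by
  rw [iteratedDeriv_ofReal_pow]
  rcases lt_trichotomy n k with h | rfl | h
  · simp [Nat.descFactorial_of_lt h, h.ne']
  · simp [Nat.descFactorial_self]
  · simp [h.ne, Nat.sub_ne_zero_of_lt h]

theorem contDiff_ofReal_pow (n : ℕ) : ContDiff ℝ ∞ fun x : ℝ => (x : ℂ) ^ n :=
  Complex.ofRealCLM.contDiff.pow n

theorem ContDiff.iteratedDeriv_infty {g : ℝ → ℂ} (hg : ContDiff ℝ ∞ g) (k : ℕ) :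
    ContDiff ℝ ∞ (iteratedDeriv k g) := by
  rw [iteratedDeriv_eq_iterate]
  exact hg.iterate_deriv k

theorem hasExpansionZero_of_contDiff {w : ℝ → ℂ} (hw : ContDiff ℝ ∞ w) {a : ℕ → ℕ → ℂ}
    (ha : ∀ n, iteratedDeriv n w 0 = n.factorial * a n 0) : HasExpansionZero P₀ a w := by
  intro N k ε hε
  have hs : ContDiff ℝ ∞ fun x : ℝ => ∑ n ∈ Finset.range N, a n 0 * (x : ℂ) ^ n :=
    ContDiff.sum fun n _ => contDiff_const.mul (contDiff_ofReal_pow n)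
  set g : ℝ → ℂ := fun x => w x - ∑ n ∈ Finset.range N, a n 0 * (x : ℂ) ^ n with hg
  have hgs : ContDiff ℝ ∞ g := hw.sub hs
  have hg0 : ∀ i < N, iteratedDeriv i g 0 = 0 := fun i hi => by
    have hle : ((i : ℕ∞) : WithTop ℕ∞) ≤ ∞ := mod_cast le_top
    rw [hg, iteratedDeriv_fun_sub (hw.contDiffAt.of_le hle) (hs.contDiffAt.of_le hle),
      iteratedDeriv_fun_sum fun n _ => (contDiffAt_const.mul
        ((contDiff_ofReal_pow n).contDiffAt.of_le hle))]
    have : ∀ n ∈ Finset.range N, iteratedDeriv i (fun x : ℝ => a n 0 * (x : ℂ) ^ n) 0 =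
        if i = n then (n.factorial : ℂ) * a n 0 else 0 := fun n _ => by
      rw [iteratedDeriv_const_mul_field, iteratedDeriv_ofReal_pow_zero]
      split_ifs <;> ring
    rw [Finset.sum_congr rfl this, Finset.sum_ite_eq, if_pos (Finset.mem_range.2 hi), ha, sub_self]
  -- Truncated subtraction is right here: for `k ≥ N` only boundedness is asserted, and the exponent
  -- `N - ε - k` is then negative.
  have hO : iteratedDeriv k g =O[𝓝 0] fun x => x ^ (N - k) :=
    isBigO_pow_of_iteratedDeriv_eq_zero (ContDiff.iteratedDeriv_infty hgs k) fun i hi => by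
      have : iteratedDeriv i (iteratedDeriv k g) = iteratedDeriv (i + k) g := by
        simp only [iteratedDeriv_eq_iterate, Function.iterate_add, Function.comp_apply]
      rw [this]
      exact hg0 _ (by omega)
  have hpow : (fun x : ℝ => x ^ (N - k)) =O[𝓝[>] 0] fun x => |x| ^ ((N : ℝ) - ε - k) := by
    have h1 : (N : ℝ) - ε - k ≤ ((N - k : ℕ) : ℝ) := by
      have : (N : ℝ) ≤ ((N - k : ℕ) : ℝ) + k := mod_cast (by omega : N ≤ N - k + k)
      linarith
    refine (rpow_isBigO_nhdsGT h1).congr' ?_ EventuallyEq.rfl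
    filter_upwards [self_mem_nhdsWithin] with x hx
    rw [abs_of_pos hx, Real.rpow_natCast]
  have hEq : Set.EqOn (fun y => w y - partialSum logAbs P₀ a N y) g (Set.Ioi 0) := fun x hx => by
    simp only [hg, partialSum_eq_logPow, P₀, zero_add, Finset.sum_range_one,
      logPow_natCast _ (Set.mem_Ioi.1 hx)]
  refine ((hO.mono nhdsWithin_le_nhds).trans hpow).congr' ?_ ?_
  · filter_upwards [self_mem_nhdsWithin] with x hx
    exact (hEq.iteratedDeriv_of_isOpen isOpen_Ioi k hx).symm
  · filter_upwards [self_mem_nhdsWithin] with x hx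
    rw [abs_of_pos hx]
    simp [P₀]

theorem inSchwartzP_of_schwartz (w : 𝓢(ℝ, ℂ)) {a : ℕ → ℕ → ℂ}
    (ha : ∀ n, iteratedDeriv n w 0 = n.factorial * a n 0) : InSchwartzP P₀ a w := by
  refine ⟨⟨(w.smooth ⊤).contDiffOn, fun n k => ?_⟩, hasExpansionZero_of_contDiff (w.smooth ⊤) ha⟩
  obtain ⟨C, hC⟩ := w.decay' n k
  refine ⟨C, fun x hx => ?_⟩
  have := hC x
  rwa [norm_iteratedFDeriv_eq_norm_iteratedDeriv, Real.norm_of_nonneg (by linarith)] at this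

theorem IsSmoothRapid.congr {u v : ℝ → ℂ} (hu : IsSmoothRapid u) (h : Set.EqOn u v (Set.Ioi 0)) :
    IsSmoothRapid v where
  smooth := hu.smooth.congr fun x hx => (h hx).symm
  decay n k := by
    obtain ⟨C, hC⟩ := hu.decay n k
    refine ⟨C, fun x hx => ?_⟩
    rw [← h.iteratedDeriv_of_isOpen isOpen_Ioi k (Set.mem_Ioi.2 (by linarith))]
    exact hC x hx

theorem InSchwartzP.congr {P : PowerSeq} {a : ℕ → ℕ → ℂ} {u v : ℝ → ℂ} (hu : InSchwartzP P a u)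
    (h : Set.EqOn u v (Set.Ioi 0)) : InSchwartzP P a v := by
  refine ⟨hu.1.congr h, fun N k ε hε => (hu.2 N k ε hε).congr' ?_ EventuallyEq.rfl⟩
  have : Set.EqOn (fun y => u y - partialSum logAbs P a N y)
      (fun y => v y - partialSum logAbs P a N y) (Set.Ioi 0) := fun x hx => by
    simp only [h hx]
  filter_upwards [self_mem_nhdsWithin] with x hx
  exact this.iteratedDeriv_of_isOpen isOpen_Ioi k hx

theorem hardyS_subset (σ : ℤˣ) : hardyS σ ⊆ hardyP σ P₀ := by
  rintro H ⟨u, ⟨v, hv⟩, T, hT, rfl⟩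
  have h1 := inSchwartzP_of_schwartz (reflectS σ v)
    (a := fun n _ => iteratedDeriv n (reflectS σ v) 0 / n.factorial) fun n => by
      have : (n.factorial : ℂ) ≠ 0 := mod_cast n.factorial_ne_zero
      field_simp
  have h2 := h1.congr (v := reflect σ u) fun x hx => by
    rw [reflectS_coe]
    exact (hv _ (by rwa [units_cast_mul_self])).symm
  exact ⟨u, ⟨_, h2⟩, T, hT.isExtension isPowerSetZero_P₀ h2
    fun j _ => Or.inr (neg_one_lt_P₀_re j), rfl⟩

/-! ### Borel's lemma and smooth extension -/

/-- Borel's lemma. The monomial `b n * x ^ n / n!` is multiplied by a bump of width proportional to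
`1 / l n`. Its `k`-th derivative scales like `l n ^ (k - n)`, so large `l n` makes the series
converge with all derivatives. -/
theorem exists_contDiff_iteratedDeriv_eq (b : ℕ → ℂ) : ∃ g : ℝ → ℂ, ContDiff ℝ ∞ g ∧
    HasCompactSupport g ∧ ∀ n, iteratedDeriv n g 0 = b n := by
  obtain ⟨χ⟩ : Nonempty (ContDiffBump (0 : ℝ)) := inferInstance
  set h : ℕ → ℝ → ℂ := fun n x => (x : ℂ) ^ n * (χ x : ℂ) with hh
  have hs : ∀ n, ContDiff ℝ ∞ (h n) := fun n =>
    (contDiff_ofReal_pow n).mul (Complex.ofRealCLM.contDiff.comp χ.contDiff)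
  have hc : ∀ n, HasCompactSupport (h n) := fun n =>
    (χ.hasCompactSupport.comp_left (g := Complex.ofReal) Complex.ofReal_zero).mul_left
  have hC : ∀ n k, ∃ C : ℝ, ∀ x, ‖iteratedDeriv k (h n) x‖ ≤ C := fun n k => by
    obtain ⟨C, hC⟩ := ((hc n).toSchwartzMap (hs n)).decay' 0 k
    refine ⟨C, fun x => ?_⟩
    have := hC x
    rwa [pow_zero, one_mul, norm_iteratedFDeriv_eq_norm_iteratedDeriv] at this
  choose C hC using hC
  have hC0 : ∀ n k, 0 ≤ C n k := fun n k => (norm_nonneg _).trans (hC n k 0)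
  set c : ℕ → ℂ := fun n => b n / n.factorial with hcdef
  -- Chosen so that for every `k < n` the `k`-th derivative of the `n`-th summand is at most `2 ^
  -- (-n)`; `l n ≥ 1` keeps all supports in one ball.
  set l : ℕ → ℝ := fun n => 1 + 2 ^ n * (‖c n‖ * ∑ k ∈ Finset.range n, C n k) with hl
  have hl1 : ∀ n, 1 ≤ l n := fun n => le_add_of_nonneg_right
    (mul_nonneg (by positivity) (mul_nonneg (norm_nonneg _) (Finset.sum_nonneg fun k _ => hC0 n k)))
  have hl0 : ∀ n, 0 < l n := fun n => one_pos.trans_le (hl1 n)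
  set f : ℕ → ℝ → ℂ := fun n x => (c n * ((l n ^ n : ℝ) : ℂ)⁻¹) * h n (l n * x) with hf
  have hfs : ∀ n, ContDiff ℝ ∞ (f n) := fun n =>
    contDiff_const.mul ((hs n).comp (contDiff_const.mul contDiff_id))
  have hfd : ∀ n k x, iteratedDeriv k (f n) x =
      (c n * ((l n ^ n : ℝ) : ℂ)⁻¹) * (l n ^ k • iteratedDeriv k (h n) (l n * x)) := fun n k x => by
    rw [hf]
    simp only
    rw [iteratedDeriv_const_mul_field,
      iteratedDeriv_comp_const_smul ((hs n).of_le (mod_cast le_top))]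
  set v : ℕ → ℕ → ℝ := fun k n => ‖c n‖ * (l n ^ n)⁻¹ * (l n ^ k * C n k) with hv
  have hfv : ∀ (k n : ℕ) (x : ℝ), ‖iteratedFDeriv ℝ k (f n) x‖ ≤ v k n := fun k n x => by
    rw [norm_iteratedFDeriv_eq_norm_iteratedDeriv, hfd, norm_mul, norm_mul, norm_inv, norm_smul,
      Complex.norm_real, Real.norm_of_nonneg (pow_nonneg (hl0 n).le _),
      Real.norm_of_nonneg (pow_nonneg (hl0 n).le _)]
    have := hC n k (l n * x)
    have h1 := pow_nonneg (hl0 n).le k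
    have h2 := pow_nonneg (hl0 n).le n
    exact mul_le_mul_of_nonneg_left (mul_le_mul_of_nonneg_left this h1)
      (mul_nonneg (norm_nonneg _) (inv_nonneg.2 h2))
  have hv0 : ∀ k n, 0 ≤ v k n := fun k n => (norm_nonneg _).trans (hfv k n 0)
  have hvs : ∀ k, Summable (v k) := fun k => by
    refine Summable.of_norm_bounded_eventually_nat summable_geometric_two ?_
    filter_upwards [eventually_gt_atTop k] with n hn
    have h1 : C n k ≤ ∑ k ∈ Finset.range n, C n k :=
      Finset.single_le_sum (fun k _ => hC0 n k) (Finset.mem_range.2 hn)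
    have h2 : ‖c n‖ * C n k * 2 ^ n ≤ l n := by
      have := mul_le_mul_of_nonneg_left h1 (norm_nonneg (c n))
      have h3 := mul_le_mul_of_nonneg_left this (pow_nonneg (zero_le_two (α := ℝ)) n)
      simp only [hl]
      linarith
    have h4 : l n ^ k * l n ≤ l n ^ n := by
      rw [← pow_succ]
      exact pow_le_pow_right₀ (hl1 n) hn
    have hp : 0 < l n ^ n := pow_pos (hl0 n) n
    rw [Real.norm_of_nonneg (hv0 k n), one_div, inv_pow, ← one_div, le_div_iff₀ (by positivity)]
    have e : v k n * 2 ^ n = l n ^ k * (‖c n‖ * C n k * 2 ^ n) / l n ^ n := by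
      simp only [hv]
      ring
    rw [e, div_le_one hp]
    exact (mul_le_mul_of_nonneg_left h2 (pow_nonneg (hl0 n).le k)).trans h4
  have hf0 : ∀ n k, iteratedDeriv k (f n) 0 = if k = n then b n else 0 := fun n k => by
    have h1 : h n =ᶠ[𝓝 0] fun x : ℝ => (x : ℂ) ^ n := by
      filter_upwards [χ.eventuallyEq_one] with x hx
      simp only [hh, hx, Pi.one_apply, Complex.ofReal_one, mul_one]
    rw [hfd, mul_zero, h1.iteratedDeriv_eq, iteratedDeriv_ofReal_pow_zero]
    split_ifs with hk
    · have h2 : ((l n ^ n : ℝ) : ℂ) ≠ 0 := mod_cast (pow_pos (hl0 n) n).ne'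
      have h3 : (n.factorial : ℂ) ≠ 0 := mod_cast n.factorial_ne_zero
      rw [hk, Complex.real_smul, hcdef]
      field_simp
    · simp
  have hle : ∀ k : ℕ, ((k : ℕ∞) : ℕ∞) ≤ (⊤ : ℕ∞) := fun k => le_top
  refine ⟨fun x => ∑' n, f n x,
    contDiff_tsum (N := ⊤) hfs (fun k _ => hvs k) fun k n x _ => hfv k n x, ?_, fun k => ?_⟩
  · refine HasCompactSupport.intro (isCompact_closedBall (0 : ℝ) χ.rOut) fun x hx => ?_
    have hx : χ.rOut < |x| := by simpa using hx
    refine (tsum_congr fun n => ?_).trans tsum_zero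
    have : χ (l n * x) = 0 := χ.zero_of_le_dist (by
      rw [dist_zero_right, Real.norm_eq_abs, abs_mul, abs_of_pos (hl0 n)]
      nlinarith [hl1 n, abs_nonneg x])
    simp [hf, hh, this]
  · rw [iteratedDeriv_eq_iteratedFDeriv,
      iteratedFDeriv_tsum_apply (N := ⊤) hfs (fun k _ => hvs k) (fun k n x _ => hfv k n x) (hle k),
      tsum_eq_single k, ← iteratedDeriv_eq_iteratedFDeriv, hf0, if_pos rfl]
    intro n hn
    rw [← norm_eq_zero, norm_iteratedFDeriv_eq_norm_iteratedDeriv, hf0, if_neg hn.symm, norm_zero]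

/-- A function that is `O(x ^ 2)` at zero is differentiable there with derivative zero, so every
derivative extended by zero has the next one as its derivative. -/
theorem contDiff_indicator_Ioi {r : ℝ → ℂ} (hr : ContDiffOn ℝ ∞ r (Set.Ioi 0))
    (h0 : ∀ k, iteratedDeriv k r =O[𝓝[>] 0] fun x => x ^ 2) :
    ContDiff ℝ ∞ ((Set.Ioi 0).indicator r) := by
  have hd : ∀ k, ∀ x : ℝ, HasDerivAt ((Set.Ioi 0).indicator (iteratedDeriv k r))
      (1 * (Set.Ioi 0).indicator (iteratedDeriv (k + 1) r) x) x := fun k x => by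
    rw [one_mul]
    rcases lt_trichotomy x 0 with hx | rfl | hx
    · rw [Set.indicator_of_notMem (by simpa using hx.le)]
      refine (hasDerivAt_const x (0 : ℂ)).congr_of_eventuallyEq ?_
      filter_upwards [isOpen_Iio.mem_nhds hx] with y hy
      exact Set.indicator_of_notMem (by simpa using le_of_lt hy) _
    · rw [Set.indicator_of_notMem (by simp), hasDerivAt_iff_isLittleO]
      have h1 : (Set.Ioi 0).indicator (iteratedDeriv k r) =O[𝓝 0] fun x : ℝ => x ^ 2 := by
        obtain ⟨C, hC⟩ := (h0 k).bound
        refine IsBigO.of_bound |C| ?_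
        filter_upwards [eventually_nhdsWithin_iff.1 hC] with x hx
        by_cases hx0 : x ∈ Set.Ioi (0 : ℝ)
        · rw [Set.indicator_of_mem hx0]
          exact (hx hx0).trans (mul_le_mul_of_nonneg_right (le_abs_self C) (norm_nonneg _))
        · rw [Set.indicator_of_notMem hx0, norm_zero]
          positivity
      have h2 : (fun x : ℝ => x ^ 2) =o[𝓝 0] fun x => x := isLittleO_pow_id one_lt_two
      simpa using h1.trans_isLittleO h2
    · rw [Set.indicator_of_mem (Set.mem_Ioi.2 hx), iteratedDeriv_succ]
      have h1 : ∀ k, ContDiffAt ℝ ∞ (iteratedDeriv k r) x := fun k => by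
        induction k with
        | zero => simpa using hr.contDiffAt (isOpen_Ioi.mem_nhds hx)
        | succ k ih =>
          rw [iteratedDeriv_succ]
          exact (ih.fderiv_right (m := ∞) (by simp)).clm_apply contDiffAt_const
      refine ((h1 k).differentiableAt (by simp)).hasDerivAt.congr_of_eventuallyEq ?_
      filter_upwards [isOpen_Ioi.mem_nhds hx] with y hy
      exact Set.indicator_of_mem hy _
  have := contDiff_of_hasDerivAt_shift (c := 1)
    (f := fun k => (Set.Ioi 0).indicator (iteratedDeriv k r)) isOpen_univ (fun k x _ => hd k x) 0
  simpa [contDiffOn_univ] using this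

theorem IsSmoothRapid.exists_schwartz {R : ℝ → ℂ} (hR : IsSmoothRapid R) (hs : ContDiff ℝ ∞ R)
    (h0 : ∀ x ≤ 0, R x = 0) : ∃ v : 𝓢(ℝ, ℂ), ⇑v = R := by
  refine ⟨⟨R, hs, fun n k => ?_⟩, rfl⟩
  obtain ⟨C, hC⟩ := hR.decay n k
  obtain ⟨D, hD⟩ := isCompact_Icc.exists_bound_of_continuousOn (s := Set.Icc (0 : ℝ) 1)
    (hs.continuous_iteratedDeriv k (mod_cast le_top)).continuousOn
  have hD0 : 0 ≤ D := (norm_nonneg _).trans (hD 0 (by simp))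
  refine ⟨max C D, fun x => ?_⟩
  rw [norm_iteratedFDeriv_eq_norm_iteratedDeriv, Real.norm_eq_abs]
  rcases lt_or_ge x 0 with hx | hx
  · have : Set.EqOn R (fun _ => 0) (Set.Iio 0) := fun y hy => h0 y (le_of_lt hy)
    rw [this.iteratedDeriv_of_isOpen isOpen_Iio k hx]
    have e : iteratedDeriv k (fun _ : ℝ => (0 : ℂ)) x = 0 := by
      rcases k with _ | k <;> simp
    rw [e, norm_zero, mul_zero]
    exact hD0.trans (le_max_right _ _)
  · rw [abs_of_nonneg hx]
    rcases le_total x 1 with hx1 | hx1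
    · calc x ^ n * ‖iteratedDeriv k R x‖ ≤ 1 * D :=
            mul_le_mul (pow_le_one₀ hx hx1) (hD x ⟨hx, hx1⟩) (norm_nonneg _) zero_le_one
        _ ≤ max C D := by rw [one_mul]; exact le_max_right _ _
    · exact (hC x hx1).trans (le_max_left _ _)

theorem IsSmoothRapid.sub {u v : ℝ → ℂ} (hu : IsSmoothRapid u) (hv : IsSmoothRapid v) :
    IsSmoothRapid (fun x => u x - v x) where
  smooth := hu.smooth.sub hv.smooth
  decay n k := by
    obtain ⟨C, hC⟩ := hu.decay n k
    obtain ⟨D, hD⟩ := hv.decay n k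
    refine ⟨C + D, fun x hx => ?_⟩
    have hx0 : Set.Ioi (0 : ℝ) ∈ 𝓝 x := isOpen_Ioi.mem_nhds (Set.mem_Ioi.2 (by linarith))
    have hle : ((k : ℕ∞) : WithTop ℕ∞) ≤ ∞ := mod_cast le_top
    rw [iteratedDeriv_fun_sub ((hu.smooth.contDiffAt hx0).of_le hle)
      ((hv.smooth.contDiffAt hx0).of_le hle)]
    calc _ ≤ x ^ n * (‖iteratedDeriv k u x‖ + ‖iteratedDeriv k v x‖) :=
          mul_le_mul_of_nonneg_left (norm_sub_le _ _) (by positivity)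
      _ ≤ C + D := by linarith [hC x hx, hD x hx]

theorem InSchwartzP.exists_schwartz_eqOn {a : ℕ → ℕ → ℂ} {u : ℝ → ℂ} (h : InSchwartzP P₀ a u) :
    ∃ v : 𝓢(ℝ, ℂ), Set.EqOn u v (Set.Ioi 0) := by
  obtain ⟨g, hgs, hgc, hg⟩ := exists_contDiff_iteratedDeriv_eq fun n => n.factorial * a n 0
  have hg' : InSchwartzP P₀ a (hgc.toSchwartzMap hgs) := inSchwartzP_of_schwartz _ hg
  have hr := h.1.sub hg'.1
  set r : ℝ → ℂ := fun x => u x - hgc.toSchwartzMap hgs x with hrdef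
  -- `u` and the Borel function have the same coefficients, so their partial sums cancel and the
  -- difference is a symbol of every order.
  have hsym : ∀ s, IsSymbol (𝓝[>] 0) s r := fun s => by
    obtain ⟨N, hN⟩ := exists_nat_gt s
    have hN : s < (P₀ N).1.re := by simpa [P₀] using hN
    have := (h.isSymbol_remainder hN).sub (hg'.isSymbol_remainder hN)
    simpa only [sub_sub_sub_cancel_right] using this
  have hR : ContDiff ℝ ∞ ((Set.Ioi 0).indicator r) := contDiff_indicator_Ioi hr.smooth fun k => by
    -- Order `k + 2` leaves `x ^ 2` after `k` derivatives.
    refine ((hsym (k + 2)).bound k).congr_right fun x => ?_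
    rw [add_sub_cancel_left, ← sq_abs]
    exact mod_cast rfl
  have heq : Set.EqOn r ((Set.Ioi 0).indicator r) (Set.Ioi 0) := fun x hx =>
    (Set.indicator_of_mem hx _).symm
  obtain ⟨v, hv⟩ := (hr.congr heq).exists_schwartz hR fun x hx =>
    Set.indicator_of_notMem (by simpa using hx) _
  refine ⟨hgc.toSchwartzMap hgs + v, fun x hx => ?_⟩
  rw [add_apply, hv, ← heq hx, hrdef]
  ring

theorem hardyP_P₀_subset_hardyS (σ : ℤˣ) : hardyP σ P₀ ⊆ hardyS σ := by
  rintro H ⟨u, ⟨a, h⟩, T, hT, rfl⟩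
  obtain ⟨v, hv⟩ := h.exists_schwartz_eqOn
  refine ⟨u, ⟨reflectS σ v, fun x hx => ?_⟩, T, hT.isZeroExtension, rfl⟩
  rw [reflectS_coe]
  have := hv (Set.mem_Ioi.2 hx)
  rwa [reflect, units_cast_mul_self] at this

end LogPolyhom

end

open LogPolyhom in
theorem mainTheorem7 (P : PowerSeq) (hP : IsAppropriate P) :
    (∀ σ : ℤˣ,
      (∀ u ∈ schwartzP σ P, ∃ T ∈ temperedHalf σ, IsExtension σ P u T) ∧
      hardyS σ = hardyP σ P₀ ∧ hardyP σ P₀ ⊆ hardyP σ P ∧ hardyP σ P ⊆ hardyD σ) ∧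
    (∃ P' : PowerSeq, IsPowerSetInfty P' ∧ ContainsDual P P') ∧
    (∀ P' : PowerSeq, IsPowerSetInfty P' → ContainsDual P P' → ∀ σ : ℤˣ,
      hardyP σ P ⊆ asDistributions (smoothP P') ∧
      hardyP σ P ⊆ asDistributions (smoothBoundaryP (-σ) P')) := by
  refine ⟨fun σ => ⟨fun u hu => ?_, (hardyS_subset σ).antisymm (hardyP_P₀_subset_hardyS σ),
      hardyP_P₀_subset hP σ, hardyP_subset_hardyD σ P⟩,
    exists_containsDual hP.isPowerSet, fun P' hP' hPP' σ => ?_⟩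
  · obtain ⟨T, hT⟩ := exists_isExtension hP hu
    exact ⟨T, hT.mem_temperedHalf, hT⟩
  · have h := hardyP_subset_smoothBoundaryP hP hP' hPP' σ
    exact ⟨h.trans (asDistributions_mono (smoothBoundaryP_subset (-σ) P')), h⟩
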